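/- **Conventions.** A *split display map category* $(\mathbf C,\mathcal D)$ is a category with a chosen terminal object and a class $\mathcal D$ of arrows (display maps, or types in context; $P_A:\Gamma.A\to\Gamma$), with, for each $P_A$ and $f:\Delta\to\Gamma$, a chosen display map $P_{A[f]}:\Delta.A[f]\to\Delta$ and arrow $f.A:\Delta.A[f]\to\Gamma.A$ forming a pullback square, such that $P_{A[1]}=P_A$, $1.A=1$, $P_{A[fg]}=P_{A[f][g]}$, $(f.A)(g.A[f])=(fg).A$. A term of type $A$ is a section of $P_A$. Re-indexing of sections, arrows and 2-cells is by the pullbacks. $A^{\blacktriangledown}$ denotes $A[P_A]$; $P_A^{\bullet}:\Gamma.A.A^{\blacktriangledown}\to\Gamma.A$ is the other projection, $P_A.A$. Such a category is a *model of axiomatic type theory (ATT)* if it carries choice functions, all stable under re-indexing, for: * $=$: types $\mathsf{Id}_A$ over $\Gamma.A.A^{\blacktriangledown}$; terms $\mathsf{refl}_A$ of $\mathsf{Id}_A[\delta_A]$ ($\delta_A$ the diagonal), with induced arrow $\mathsf r_A:\Gamma.A\to\Gamma.A.A^{\blacktriangledown}.\mathsf{Id}_A$; for $C$ over $\Gamma.A.A^{\blacktriangledown}.\mathsf{Id}_A$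 and a term $c$ of $C[\mathsf r_A]$, terms $\mathsf j_c$ of $C$ and $\mathsf H_c$ of $\mathsf{Id}[\mathsf j_c[\mathsf r_A];c]$; * $\Sigma$: types $\Sigma_A^B$ over $\Gamma$; pairing terms of $\Sigma_A^B[P_AP_B]$, with induced arrow $\mathsf p:\Gamma.A.B\to\Gamma.\Sigma_A^B$; for $C$ over $\Gamma.\Sigma_A^B$ and a term $c$ of $C[\mathsf p]$, terms $\mathsf{split}_c$ of $C$ and $\sigma_c$ of $\mathsf{Id}[\mathsf{split}_c[\mathsf p];c]$; * $\Pi$ with function extensionality: types $\Pi_A^B$ over $\Gamma$; evaluation terms $\mathsf{ev}$ of $B[P_{\Pi}.A]$ over $\Gamma.\Pi_A^B.A[P_\Pi]$; for terms $\upsilon$ of $B$, terms $\mathsf{abs}_\upsilon$ of $\Pi_A^B$ and $\beta_\upsilon$ of $\mathsf{Id}_B[\mathsf{ev}[\mathsf{abs}_\upsilon.A];\upsilon]$; for terms $z,z'$ of $\Pi_A^B$ and $q$ of $\Pi_{x:A}\,\mathsf{ev}(z,x)=\mathsf{ev}(z',x)$, terms $\mathsf{funext}_q$ of $\mathsf{Id}[z;z']$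 and $\beta^\Pi_q$ of $\mathsf{happly}(\mathsf{funext}_q)=q$, and for $p$ of $\mathsf{Id}[z;z']$ a term $\eta^\Pi_p$ of $p=\mathsf{funext}_{\mathsf{happly}(p)}$, where $\mathsf{happly}$ is obtained by $\mathsf j$ from $\lambda x.\mathsf{refl}(\mathsf{ev}(z,x))$; * $0,1,2,\mathbb N$: the types over every $\Gamma$, their constructors $\star$; $\bot,\top$; $\mathsf 0,\mathsf{succ}$, the dependent eliminators $\mathsf{ind}$, and terms of identity types for their computation: $\mathsf{ind}^1_c(\star)=c$; $\mathsf{ind}^2_{c,d}(\bot)=c$, $\mathsf{ind}^2_{c,d}(\top)=d$; $\mathsf{ind}^{\mathbb N}_{c,d}(0)=c$ and $\mathsf{ind}^{\mathbb N}_{c,d}(\mathsf s(n))=d(n,\mathsf{ind}^{\mathbb N}_{c,d}(n))$. A *split display map 2-category* $(\mathcal C,\mathcal D)$ is a strict 2-category with invertible 2-cells whose underlying category is a split display map category as above, whose chosen terminal object is 2-terminal and whose chosen pullback squares are 2-pullbacks, in which moreover every display map is a *cloven isofibration*: for each 2-cell $p:f\Rightarrow P_A g$ there are a chosen 1-cell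 $\mathsf t_g^p$ and 2-cell $\tau_g^p:\mathsf t_g^p\Rightarrow g$ with $P_A\mathsf t_g^p=f$, $P_A*\tau_g^p=p$, $\mathsf t_{gh}^{p*h}=\mathsf t_g^ph$, $\tau_{gh}^{p*h}=\tau_g^p*h$; and, for a composable sequence of $n\ge1$ display maps with composite $P_A:\Gamma.A\to\Gamma$, a display map $P_C:\Gamma.A.C\to\Gamma.A$, a 1-cell $f:\Delta\to\Gamma$, and a 2-cell $p:h\Rightarrow P_Cg$ with $P_A*p=1$, one has $\mathsf t_g^p[f.A]=\mathsf t_{g'}^{p[f]}$ and $\tau_g^p[f.A]=\tau_{g'}^{p[f]}$ whenever $g',h'$ are re-indexings of $g,h$ along a common $f':\Omega'\to\Omega$ with $P_{A[f]}P_Cg'=P_{A[f]}h'$. Write $(\mathcal C/\Gamma)(h,P)$ for the category of 1-cells $k$ with $Pk=h$ and 2-cells $\theta$ with $P*\theta=1_h$. It is *endowed with axiomatic* * $=$-*types* if there are chosen $\mathsf{Id}_A$ over $\Gamma.A.A^{\blacktriangledown}$ and 2-cells $\alpha_A:P_{A^{\blacktriangledown}}P_{\mathsf{Id}_A}\Rightarrow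 P_A^{\bullet}P_{\mathsf{Id}_A}$ over $\Gamma$, stable under re-indexing, such that for every $h:\Delta\to\Gamma$ whiskering with $\alpha_A$ is an isomorphism of categories $(\mathcal C/\Gamma)(h,P_AP_{A^{\blacktriangledown}}P_{\mathsf{Id}_A})\cong(\mathcal C/\Gamma)(h,P_A)^{\to}$; * $\Sigma$-*types* if there are chosen $\Sigma_A^B$ over $\Gamma$ and equivalences $(\mathsf p,\pi,\ \eta:1\Rightarrow\mathsf p\pi,\ \beta:\pi\mathsf p\Rightarrow1)$ over $\Gamma$ from $P_AP_B$ to $P_{\Sigma_A^B}$, stable under re-indexing; * $\Pi$-*types and function extensionality* if there are chosen $\Pi_A^B$ over $\Gamma$, stable under re-indexing, and, for all $f:\Delta\to\Gamma$, equivalences of categories $(\lambda,\mathsf{app},\ \beta:\mathsf{app}\,\lambda\cong1,\ \eta:1\cong\lambda\,\mathsf{app})$ between $(\mathcal C/\Gamma.A)(f.A,P_B)$ and $(\mathcal C/\Gamma)(f,P_{\Pi_A^B})$, such that $\lambda,\mathsf{app},\beta,\eta$ strictly commute with precomposition with $g.A[f]$, resp. $g$, for all $g:\Delta'\to\Delta$,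 and with the isomorphisms to $(\mathcal C/\Delta.A[f])(1,P_{B[f.A]})$, resp. $(\mathcal C/\Delta)(1,P_{\Pi_A^B[f]})$, given by the pullbacks; * $0$-, $1$-, $2$-*types* if there are over each $\Gamma$ a chosen type $0$; a type $1$ with a section $\star$; a type $2$ with sections $\bot,\top$; and, for each display map $P_C$ over it, a chosen pseudo-inverse with the two natural isomorphisms of the functor on the category of sections of $P_C$ that is, respectively, the functor to the terminal category, $k\mapsto k\star\in(\mathcal C/\Gamma.1)(\star,P_C)$, and $k\mapsto(k\bot,k\top)\in(\mathcal C/\Gamma.2)(\bot,P_C)\times(\mathcal C/\Gamma.2)(\top,P_C)$; all these data being stable under re-indexing; * $\mathbb N$-*types* if there are over each $\Gamma$ a chosen type $\mathbb N$, a section $\mathsf 0$ and a 1-cell $\mathsf s:\Gamma.\mathbb N\to\Gamma.\mathbb N$ over $\Gamma$, and, for each $P_C$ over $\Gamma.\mathbb N$, $c$ in $(\mathcal C/\Gamma.\mathbb N)(\mathsf 0,P_C)$ and $d$ in $(\mathcal C/\Gamma.\mathbb N)(\mathsf sP_C,P_C)$, a chosen triple $(k,\ k\mathsf 0\Rightarrow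 c,\ k\mathsf s\Rightarrow dk)$, with $k$ a section of $P_C$ and 2-cells over $\Gamma.\mathbb N$, to which every such triple admits exactly one 2-cell over $\Gamma.\mathbb N$ between the sections that is compatible with the two 2-cells; all these data being stable under re-indexing. **Theorem.** Let $(\mathcal C,\mathcal D)$ be a split display map 2-category endowed with axiomatic $=$-types, $\Sigma$-types, $\Pi$-types and function extensionality, and $0$-, $1$-, $2$-, $\mathbb N$-types. Then its underlying split display map category $(\mathbf C,\mathcal D)$ carries choice functions for all the axiomatic type formers that satisfy the stability conditions, i.e. it is a model of ATT. Moreover this can be done with the given types $\mathsf{Id}_A,\Sigma_A^B,\Pi_A^B,0,1,2,\mathbb N$ and the given constructors $\star$; $\bot,\top$; $\mathsf 0$ and $\mathsf s$ (the term $\mathsf{succ}$ being the one with underlying arrow $\mathsf s$). -/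

import Mathlib

open CategoryTheory

universe w v u

/-- A map of the class `D` with codomain `Γ`: a type in context `Γ`, with its projection `P_A : Γ.A ⟶ Γ`. -/
structure DisplayMap {C : Type u} [Category.{v} C] (D : MorphismProperty C) (Γ : C) where
  ext : C
  proj : ext ⟶ Γ
  mem : D proj

/-- A split display map category. `sub A f` is `A[f]` and `lift A f` is `f.A : Δ.A[f] ⟶ Γ.A`. -/
structure DisplayMapCategory (C : Type u) [Category.{v} C] where
  ε : C
  isTerminal : Limits.IsTerminal ε
  D : MorphismProperty C
  sub : ∀ {Γ Δ : C}, DisplayMap D Γ → (Δ ⟶ Γ) → DisplayMap D Δ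
  lift : ∀ {Γ Δ : C} (A : DisplayMap D Γ) (f : Δ ⟶ Γ), (sub A f).ext ⟶ A.ext
  isPullback : ∀ {Γ Δ : C} (A : DisplayMap D Γ) (f : Δ ⟶ Γ),
    IsPullback (lift A f) (sub A f).proj A.proj f
  sub_id : ∀ {Γ : C} (A : DisplayMap D Γ), sub A (𝟙 Γ) = A
  lift_id : ∀ {Γ : C} (A : DisplayMap D Γ),
    lift A (𝟙 Γ) = eqToHom (congrArg DisplayMap.ext (sub_id A))
  sub_comp : ∀ {Γ Δ Ω : C} (A : DisplayMap D Γ) (f : Δ ⟶ Γ) (g : Ω ⟶ Δ),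
    sub A (g ≫ f) = sub (sub A f) g
  lift_comp : ∀ {Γ Δ Ω : C} (A : DisplayMap D Γ) (f : Δ ⟶ Γ) (g : Ω ⟶ Δ),
    lift A (g ≫ f) =
      eqToHom (congrArg DisplayMap.ext (sub_comp A f g)) ≫ lift (sub A f) g ≫ lift A f

namespace DisplayMapCategory

variable {C : Type u} [Category.{v} C] (𝒟 : DisplayMapCategory C)

/-- The types in context `Γ`. -/
abbrev Ty (Γ : C) : Type (max u v) := DisplayMap 𝒟.D Γ

/-- The map `f.A : Δ.A' ⟶ Γ.A`, where `A'` is another name of the type `A[f]`. -/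
def cart {Γ Δ : C} {A : 𝒟.Ty Γ} {f : Δ ⟶ Γ} {A' : 𝒟.Ty Δ} (h : 𝒟.sub A f = A') :
    A'.ext ⟶ A.ext :=
  eqToHom (congrArg DisplayMap.ext h.symm) ≫ 𝒟.lift A f

theorem cart_rfl {Γ Δ : C} (A : 𝒟.Ty Γ) (f : Δ ⟶ Γ) :
    𝒟.cart (rfl : 𝒟.sub A f = 𝒟.sub A f) = 𝒟.lift A f := by
  simp [cart]

theorem cart_isPullback {Γ Δ : C} {A : 𝒟.Ty Γ} {f : Δ ⟶ Γ} {A' : 𝒟.Ty Δ}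
    (h : 𝒟.sub A f = A') : IsPullback (𝒟.cart h) A'.proj A.proj f := by
  subst h
  rw [cart_rfl]
  exact 𝒟.isPullback A f

theorem cart_proj {Γ Δ : C} {A : 𝒟.Ty Γ} {f : Δ ⟶ Γ} {A' : 𝒟.Ty Δ} (h : 𝒟.sub A f = A') :
    𝒟.cart h ≫ A.proj = A'.proj ≫ f :=
  (𝒟.cart_isPullback h).w

theorem cart_hom_ext {Γ Δ X : C} {A : 𝒟.Ty Γ} {f : Δ ⟶ Γ} {A' : 𝒟.Ty Δ}
    (h : 𝒟.sub A f = A') {a b : X ⟶ A'.ext} (h₁ : a ≫ 𝒟.cart h = b ≫ 𝒟.cart h)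
    (h₂ : a ≫ A'.proj = b ≫ A'.proj) : a = b :=
  (𝒟.cart_isPullback h).hom_ext h₁ h₂

theorem cart_id {Γ : C} (A : 𝒟.Ty Γ) : 𝒟.cart (𝒟.sub_id A) = 𝟙 A.ext := by
  simp [cart, 𝒟.lift_id]

theorem sub_trans {Γ Δ Ω : C} {A : 𝒟.Ty Γ} {f : Δ ⟶ Γ} {A' : 𝒟.Ty Δ} {g : Ω ⟶ Δ}
    {A'' : 𝒟.Ty Ω} (h : 𝒟.sub A f = A') (h' : 𝒟.sub A' g = A'') :
    𝒟.sub A (g ≫ f) = A'' := by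
  rw [𝒟.sub_comp, h, h']

theorem cart_trans {Γ Δ Ω : C} {A : 𝒟.Ty Γ} {f : Δ ⟶ Γ} {A' : 𝒟.Ty Δ} {g : Ω ⟶ Δ}
    {A'' : 𝒟.Ty Ω} (h : 𝒟.sub A f = A') (h' : 𝒟.sub A' g = A'') :
    𝒟.cart (𝒟.sub_trans h h') = 𝒟.cart h' ≫ 𝒟.cart h := by
  subst h
  subst h'
  simp [cart, 𝒟.lift_comp]

/-- `cart` depends on the arrow `f` only. -/
theorem cart_congr {Γ Δ : C} {A : 𝒟.Ty Γ} {f g : Δ ⟶ Γ} {A' : 𝒟.Ty Δ} (e : f = g)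
    (h : 𝒟.sub A f = A') (h' : 𝒟.sub A g = A') : 𝒟.cart h = 𝒟.cart h' := by
  subst e
  rfl

/-- Re-indexing along the two sides of a commutative square. -/
theorem sub_square {Γ Γ' Δ Δ' : C} {u : Δ' ⟶ Δ} {k : Δ ⟶ Γ} {k' : Δ' ⟶ Γ'} {m : Γ' ⟶ Γ}
    (sq : k' ≫ m = u ≫ k) {A : 𝒟.Ty Γ} {A' : 𝒟.Ty Γ'} (h : 𝒟.sub A m = A') :
    𝒟.sub (𝒟.sub A k) u = 𝒟.sub A' k' := by
  rw [← 𝒟.sub_comp, ← sq, 𝒟.sub_comp, h]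

theorem cart_square {Γ Γ' Δ Δ' : C} {u : Δ' ⟶ Δ} {k : Δ ⟶ Γ} {k' : Δ' ⟶ Γ'} {m : Γ' ⟶ Γ}
    (sq : k' ≫ m = u ≫ k) {A : 𝒟.Ty Γ} {A' : 𝒟.Ty Γ'} (h : 𝒟.sub A m = A') :
    𝒟.cart (𝒟.sub_square sq h) ≫ 𝒟.lift A k = 𝒟.lift A' k' ≫ 𝒟.cart h := by
  have h₁ := 𝒟.cart_trans (rfl : 𝒟.sub A k = _) (𝒟.sub_square sq h)
  have h₂ := 𝒟.cart_trans h (rfl : 𝒟.sub A' k' = _)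
  rw [cart_rfl] at h₁ h₂
  rw [← h₁, ← h₂]
  exact 𝒟.cart_congr sq.symm _ _

/-- The terms of type `A`, i.e. the sections of its display map. -/
@[ext]
structure Tm {𝒟 : DisplayMapCategory C} {Γ : C} (A : 𝒟.Ty Γ) where
  hom : Γ ⟶ A.ext
  hom_proj : hom ≫ A.proj = 𝟙 Γ

section Terms

variable {𝒟}

/-- The re-indexed term `a[f]`, as a term of the type `A' = A[f]`. -/
noncomputable def Tm.subst {Γ Δ : C} {A : 𝒟.Ty Γ} {f : Δ ⟶ Γ} {A' : 𝒟.Ty Δ} (a : Tm A)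
    (h : 𝒟.sub A f = A') : Tm A' where
  hom := (𝒟.cart_isPullback h).lift (f ≫ a.hom) (𝟙 Δ) (by simp [a.hom_proj])
  hom_proj := (𝒟.cart_isPullback h).lift_snd _ _ _

theorem Tm.subst_hom_cart {Γ Δ : C} {A : 𝒟.Ty Γ} {f : Δ ⟶ Γ} {A' : 𝒟.Ty Δ} (a : Tm A)
    (h : 𝒟.sub A f = A') : (a.subst h).hom ≫ 𝒟.cart h = f ≫ a.hom :=
  (𝒟.cart_isPullback h).lift_fst _ _ _

/-- The re-indexed term `a[f]`. -/
noncomputable abbrev Tm.sub {Γ Δ : C} {A : 𝒟.Ty Γ} (a : Tm A) (f : Δ ⟶ Γ) :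
    Tm (𝒟.sub A f) :=
  a.subst rfl

theorem Tm.ext_cart {Γ Δ : C} {A : 𝒟.Ty Γ} {f : Δ ⟶ Γ} {A' : 𝒟.Ty Δ} {a b : Tm A'}
    (h : 𝒟.sub A f = A') (e : a.hom ≫ 𝒟.cart h = b.hom ≫ 𝒟.cart h) : a = b :=
  Tm.ext (𝒟.cart_hom_ext h e (by rw [a.hom_proj, b.hom_proj]))

theorem Tm.eq_subst {Γ Δ : C} {A : 𝒟.Ty Γ} {f : Δ ⟶ Γ} {A' : 𝒟.Ty Δ} {a : Tm A}
    {b : Tm A'} (h : 𝒟.sub A f = A') (e : b.hom ≫ 𝒟.cart h = f ≫ a.hom) :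
    b = a.subst h :=
  Tm.ext_cart h (by rw [e, a.subst_hom_cart h])

theorem Tm.subst_subst {Γ Δ Ω : C} {A : 𝒟.Ty Γ} {f : Δ ⟶ Γ} {A' : 𝒟.Ty Δ} {g : Ω ⟶ Δ}
    {A'' : 𝒟.Ty Ω} (a : Tm A) (h : 𝒟.sub A f = A') (h' : 𝒟.sub A' g = A'') :
    (a.subst h).subst h' = a.subst (𝒟.sub_trans h h') := by
  apply Tm.eq_subst
  rw [𝒟.cart_trans h h', ← Category.assoc, (a.subst h).subst_hom_cart h', Category.assoc,
    a.subst_hom_cart h, Category.assoc]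

theorem Tm.subst_congr {Γ Δ : C} {A : 𝒟.Ty Γ} {f g : Δ ⟶ Γ} {A' : 𝒟.Ty Δ} (a : Tm A)
    (e : f = g) (h : 𝒟.sub A f = A') (h' : 𝒟.sub A g = A') : a.subst h = a.subst h' := by
  subst e
  rfl

theorem Tm.subst_square {Γ Γ' Δ Δ' : C} {u : Δ' ⟶ Δ} {k : Δ ⟶ Γ} {k' : Δ' ⟶ Γ'}
    {m : Γ' ⟶ Γ} (sq : k' ≫ m = u ≫ k) {A : 𝒟.Ty Γ} {A' : 𝒟.Ty Γ'} (h : 𝒟.sub A m = A')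
    (a : Tm A) : (a.sub k).subst (𝒟.sub_square sq h) = (a.subst h).sub k' := by
  exact (Tm.subst_subst a rfl _).trans
    ((a.subst_congr sq.symm _ _).trans (Tm.subst_subst a h rfl).symm)

/-- The arrow `Δ ⟶ Γ.A` over `k : Δ ⟶ Γ` that corresponds to a term of type `A[k]`. -/
def Tm.arrow {Γ Δ : C} {A : 𝒟.Ty Γ} {k : Δ ⟶ Γ} (a : Tm (𝒟.sub A k)) : Δ ⟶ A.ext :=
  a.hom ≫ 𝒟.lift A k

theorem Tm.arrow_proj {Γ Δ : C} {A : 𝒟.Ty Γ} {k : Δ ⟶ Γ} (a : Tm (𝒟.sub A k)) :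
    a.arrow ≫ A.proj = k := by
  rw [Tm.arrow, Category.assoc, (𝒟.isPullback A k).w, ← Category.assoc, a.hom_proj,
    Category.id_comp]

theorem Tm.arrow_square {Γ Γ' Δ Δ' : C} {u : Δ' ⟶ Δ} {k : Δ ⟶ Γ} {k' : Δ' ⟶ Γ'}
    {m : Γ' ⟶ Γ} (sq : k' ≫ m = u ≫ k) {A : 𝒟.Ty Γ} {A' : 𝒟.Ty Γ'} (h : 𝒟.sub A m = A')
    (a : Tm (𝒟.sub A k)) :
    (a.subst (𝒟.sub_square sq h)).arrow ≫ 𝒟.cart h = u ≫ a.arrow := by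
  rw [Tm.arrow, Category.assoc, ← 𝒟.cart_square sq h, ← Category.assoc, a.subst_hom_cart,
    Tm.arrow, Category.assoc]

/-- The term of type `A[k]` that corresponds to an arrow `Δ ⟶ Γ.A` over `k : Δ ⟶ Γ`. -/
noncomputable def Tm.ofArrow {Γ Δ : C} {A : 𝒟.Ty Γ} {k : Δ ⟶ Γ} (a : Δ ⟶ A.ext)
    (h : a ≫ A.proj = k) : Tm (𝒟.sub A k) where
  hom := (𝒟.isPullback A k).lift a (𝟙 Δ) (by rw [h, Category.id_comp])
  hom_proj := (𝒟.isPullback A k).lift_snd _ _ _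

theorem Tm.ofArrow_arrow {Γ Δ : C} {A : 𝒟.Ty Γ} {k : Δ ⟶ Γ} (a : Δ ⟶ A.ext)
    (h : a ≫ A.proj = k) : (Tm.ofArrow a h).arrow = a :=
  (𝒟.isPullback A k).lift_fst _ _ _

theorem Tm.ext_arrow {Γ Δ : C} {A : 𝒟.Ty Γ} {k : Δ ⟶ Γ} {a b : Tm (𝒟.sub A k)}
    (e : a.arrow = b.arrow) : a = b :=
  Tm.ext ((𝒟.isPullback A k).hom_ext e (by rw [a.hom_proj, b.hom_proj]))

/-- A term seen as a term of an equal type. -/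
def Tm.cast {Γ : C} {A B : 𝒟.Ty Γ} (a : Tm A) (h : A = B) : Tm B := h ▸ a

theorem Tm.cast_subst {Γ Δ : C} {A B : 𝒟.Ty Γ} {A' : 𝒟.Ty Δ} {f : Δ ⟶ Γ} (a : Tm A)
    (h : A = B) (h' : 𝒟.sub B f = A') : (a.cast h).subst h' = a.subst (h ▸ h') := by
  subst h
  rfl

theorem Tm.subst_cast {Γ Δ : C} {A : 𝒟.Ty Γ} {A' B' : 𝒟.Ty Δ} {f : Δ ⟶ Γ} (a : Tm A)
    (h : 𝒟.sub A f = A') (h' : A' = B') : (a.subst h).cast h' = a.subst (h.trans h') := by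
  subst h'
  rfl

/-- The weakening `A[P_A]` of `A`. -/
abbrev wk {Γ : C} (A : 𝒟.Ty Γ) : 𝒟.Ty A.ext := 𝒟.sub A A.proj

theorem wk_sub {Γ Δ : C} {A : 𝒟.Ty Γ} {f : Δ ⟶ Γ} {A' : 𝒟.Ty Δ} (h : 𝒟.sub A f = A') :
    𝒟.sub (wk A) (𝒟.cart h) = wk A' :=
  𝒟.sub_square (𝒟.cart_proj h).symm h

/-- The arrow `a;b : Δ ⟶ Γ.A.A[P_A]` with components `a` and `b`. -/
noncomputable def pr {Γ Δ : C} {A : 𝒟.Ty Γ} (a b : Δ ⟶ A.ext)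
    (h : a ≫ A.proj = b ≫ A.proj) : Δ ⟶ (wk A).ext :=
  (𝒟.isPullback A A.proj).lift b a h.symm

theorem pr_proj {Γ Δ : C} {A : 𝒟.Ty Γ} (a b : Δ ⟶ A.ext) (h : a ≫ A.proj = b ≫ A.proj) :
    pr a b h ≫ (wk A).proj = a :=
  (𝒟.isPullback A A.proj).lift_snd _ _ _

theorem pr_lift {Γ Δ : C} {A : 𝒟.Ty Γ} (a b : Δ ⟶ A.ext) (h : a ≫ A.proj = b ≫ A.proj) :
    pr a b h ≫ 𝒟.lift A A.proj = b :=
  (𝒟.isPullback A A.proj).lift_fst _ _ _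

theorem wk_hom_ext {Γ Δ : C} {A : 𝒟.Ty Γ} {x y : Δ ⟶ (wk A).ext}
    (h₁ : x ≫ (wk A).proj = y ≫ (wk A).proj)
    (h₂ : x ≫ 𝒟.lift A A.proj = y ≫ 𝒟.lift A A.proj) : x = y :=
  (𝒟.isPullback A A.proj).hom_ext h₂ h₁

/-- The arrow `a;b` of two terms of type `A`. -/
noncomputable abbrev pair {Γ : C} {A : 𝒟.Ty Γ} (a b : Tm A) : Γ ⟶ (wk A).ext :=
  pr a.hom b.hom (by rw [a.hom_proj, b.hom_proj])

/-- The diagonal `δ_A : Γ.A ⟶ Γ.A.A[P_A]`. -/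
noncomputable abbrev diag {Γ : C} (A : 𝒟.Ty Γ) : A.ext ⟶ (wk A).ext :=
  pr (𝟙 A.ext) (𝟙 A.ext) rfl

theorem wk_cart_proj {Γ Δ : C} {A : 𝒟.Ty Γ} {f : Δ ⟶ Γ} {A' : 𝒟.Ty Δ}
    (h : 𝒟.sub A f = A') :
    𝒟.cart (wk_sub h) ≫ (wk A).proj = (wk A').proj ≫ 𝒟.cart h :=
  𝒟.cart_proj (wk_sub h)

theorem wk_cart_lift {Γ Δ : C} {A : 𝒟.Ty Γ} {f : Δ ⟶ Γ} {A' : 𝒟.Ty Δ}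
    (h : 𝒟.sub A f = A') :
    𝒟.cart (wk_sub h) ≫ 𝒟.lift A A.proj = 𝒟.lift A' A'.proj ≫ 𝒟.cart h :=
  𝒟.cart_square (𝒟.cart_proj h).symm h

theorem pr_cart {Γ Δ X Y : C} {A : 𝒟.Ty Γ} {f : Δ ⟶ Γ} {A' : 𝒟.Ty Δ} (h : 𝒟.sub A f = A')
    {a' b' : X ⟶ A'.ext} {a b : Y ⟶ A.ext} {u : X ⟶ Y}
    (w' : a' ≫ A'.proj = b' ≫ A'.proj) (w : a ≫ A.proj = b ≫ A.proj)
    (ha : a' ≫ 𝒟.cart h = u ≫ a) (hb : b' ≫ 𝒟.cart h = u ≫ b) :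
    pr a' b' w' ≫ 𝒟.cart (wk_sub h) = u ≫ pr a b w := by
  apply wk_hom_ext
  · rw [Category.assoc, wk_cart_proj, ← Category.assoc, pr_proj, Category.assoc, pr_proj, ha]
  · rw [Category.assoc, wk_cart_lift, ← Category.assoc, pr_lift, Category.assoc, pr_lift, hb]

theorem pair_sub {Γ Δ : C} {A : 𝒟.Ty Γ} {f : Δ ⟶ Γ} {A' : 𝒟.Ty Δ} (h : 𝒟.sub A f = A')
    (a b : Tm A) : pair (a.subst h) (b.subst h) ≫ 𝒟.cart (wk_sub h) = f ≫ pair a b :=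
  pr_cart h _ _ (a.subst_hom_cart h) (b.subst_hom_cart h)

theorem diag_sub {Γ Δ : C} {A : 𝒟.Ty Γ} {f : Δ ⟶ Γ} {A' : 𝒟.Ty Δ} (h : 𝒟.sub A f = A') :
    diag A' ≫ 𝒟.cart (wk_sub h) = 𝒟.cart h ≫ diag A :=
  pr_cart h _ _ (by simp) (by simp)

theorem diag_term {Γ : C} {A : 𝒟.Ty Γ} (a : Tm A) : a.hom ≫ diag A = pair a a := by
  apply wk_hom_ext
  · rw [Category.assoc, pr_proj, pr_proj, Category.comp_id]
  · rw [Category.assoc, pr_lift, pr_lift, Category.comp_id]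

end Terms

/-- A choice of identity types, stable under re-indexing. -/
structure IdFormer where
  Id : ∀ {Γ : C} (A : 𝒟.Ty Γ), 𝒟.Ty (wk A).ext
  Id_sub : ∀ {Γ Δ : C} {A : 𝒟.Ty Γ} {f : Δ ⟶ Γ} {A' : 𝒟.Ty Δ} (h : 𝒟.sub A f = A'),
    𝒟.sub (Id A) (𝒟.cart (wk_sub h)) = Id A'

namespace IdFormer

variable {𝒟} (I : 𝒟.IdFormer)

/-- The type `Id_A[a;b]`. -/
noncomputable abbrev Eq {Γ : C} {A : 𝒟.Ty Γ} (a b : Tm A) : 𝒟.Ty Γ :=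
  𝒟.sub (I.Id A) (pair a b)

theorem Eq_sub {Γ Δ : C} {A : 𝒟.Ty Γ} {f : Δ ⟶ Γ} {A' : 𝒟.Ty Δ} (h : 𝒟.sub A f = A')
    (a b : Tm A) : 𝒟.sub (I.Eq a b) f = I.Eq (a.subst h) (b.subst h) :=
  𝒟.sub_square (pair_sub h a b) (I.Id_sub h)

/-- The type `Id_C[x[k];c]` is stable under re-indexing. -/
theorem Eq_square {Γ Γ' Δ Δ' : C} {u : Δ' ⟶ Δ} {k : Δ ⟶ Γ} {k' : Δ' ⟶ Γ'} {m : Γ' ⟶ Γ}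
    (sq : k' ≫ m = u ≫ k) {A : 𝒟.Ty Γ} {A' : 𝒟.Ty Γ'} (h : 𝒟.sub A m = A') {x : Tm A}
    {x' : Tm A'} (hx : x.subst h = x') (c : Tm (𝒟.sub A k)) :
    𝒟.sub (I.Eq (x.sub k) c) u = I.Eq (x'.sub k') (c.subst (𝒟.sub_square sq h)) := by
  rw [I.Eq_sub (𝒟.sub_square sq h), Tm.subst_square sq h x, hx]

theorem Id_diag_sub {Γ Δ : C} {A : 𝒟.Ty Γ} {f : Δ ⟶ Γ} {A' : 𝒟.Ty Δ}
    (h : 𝒟.sub A f = A') :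
    𝒟.sub (𝒟.sub (I.Id A) (diag A)) (𝒟.cart h) = 𝒟.sub (I.Id A') (diag A') :=
  𝒟.sub_square (diag_sub h) (I.Id_sub h)

end IdFormer

/-- Identity types with reflexivity terms. -/
structure IdIntro extends 𝒟.IdFormer where
  refl : ∀ {Γ : C} (A : 𝒟.Ty Γ), Tm (𝒟.sub (Id A) (diag A))
  refl_sub : ∀ {Γ Δ : C} {A : 𝒟.Ty Γ} {f : Δ ⟶ Γ} {A' : 𝒟.Ty Δ} (h : 𝒟.sub A f = A'),
    (refl A).subst (toIdFormer.Id_diag_sub h) = refl A'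

namespace IdIntro

variable {𝒟} (I : 𝒟.IdIntro)

/-- The arrow `r_A : Γ.A ⟶ Γ.A.A[P_A].Id_A`. -/
noncomputable def r {Γ : C} (A : 𝒟.Ty Γ) : A.ext ⟶ (I.Id A).ext := (I.refl A).arrow

theorem r_sub {Γ Δ : C} {A : 𝒟.Ty Γ} {f : Δ ⟶ Γ} {A' : 𝒟.Ty Δ} (h : 𝒟.sub A f = A') :
    I.r A' ≫ 𝒟.cart (I.Id_sub h) = 𝒟.cart h ≫ I.r A := by
  have := Tm.arrow_square (diag_sub h) (I.Id_sub h) (I.refl A)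
  rwa [I.refl_sub h] at this

theorem r_proj {Γ : C} (A : 𝒟.Ty Γ) : I.r A ≫ (I.Id A).proj = diag A :=
  (I.refl A).arrow_proj

theorem Eq_self {Γ : C} {A : 𝒟.Ty Γ} (a : Tm A) :
    𝒟.sub (𝒟.sub (I.Id A) (diag A)) a.hom = I.Eq a a := by
  rw [← 𝒟.sub_comp, diag_term, IdFormer.Eq]

/-- The reflexivity term of `Id_A[a;a]`. -/
noncomputable def reflAt {Γ : C} {A : 𝒟.Ty Γ} (a : Tm A) : Tm (I.Eq a a) :=
  (I.refl A).subst (I.Eq_self a)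

theorem reflAt_sub {Γ Δ : C} {A : 𝒟.Ty Γ} {f : Δ ⟶ Γ} {A' : 𝒟.Ty Δ} (h : 𝒟.sub A f = A')
    (a : Tm A) : (I.reflAt a).subst (I.Eq_sub h a a) = I.reflAt (a.subst h) := by
  unfold reflAt
  rw [Tm.subst_subst, ← I.refl_sub h, Tm.subst_subst]
  exact (I.refl A).subst_congr (a.subst_hom_cart h).symm _ _

theorem reflAt_subst {Γ Δ : C} {A : 𝒟.Ty Γ} {f : Δ ⟶ Γ} {A' : 𝒟.Ty Δ}
    (h : 𝒟.sub A f = A') {a : Tm A} {a' : Tm A'} (e : a.subst h = a')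
    (hE : 𝒟.sub (I.Eq a a) f = I.Eq a' a') : (I.reflAt a).subst hE = I.reflAt a' := by
  subst e
  exact I.reflAt_sub h a

end IdIntro

/-- Identity types with the elimination rule. -/
structure IdElim extends 𝒟.IdIntro where
  J : ∀ {Γ : C} {A : 𝒟.Ty Γ} (M : 𝒟.Ty (Id A).ext), Tm (𝒟.sub M (toIdIntro.r A)) → Tm M
  J_sub : ∀ {Γ Δ : C} {A : 𝒟.Ty Γ} {f : Δ ⟶ Γ} {A' : 𝒟.Ty Δ} (h : 𝒟.sub A f = A')
    {M : 𝒟.Ty (Id A).ext} {M' : 𝒟.Ty (Id A').ext} (k : 𝒟.sub M (𝒟.cart (Id_sub h)) = M')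
    (c : Tm (𝒟.sub M (toIdIntro.r A))),
    (J M c).subst k = J M' (c.subst (𝒟.sub_square (toIdIntro.r_sub h) k))

/-- Axiomatic identity types: the computation rule of `J` is a term `H` of an identity type. -/
structure AxiomaticId extends 𝒟.IdElim where
  H : ∀ {Γ : C} {A : 𝒟.Ty Γ} (M : 𝒟.Ty (Id A).ext) (c : Tm (𝒟.sub M (toIdIntro.r A))),
    Tm (toIdFormer.Eq ((J M c).sub (toIdIntro.r A)) c)
  H_sub : ∀ {Γ Δ : C} {A : 𝒟.Ty Γ} {f : Δ ⟶ Γ} {A' : 𝒟.Ty Δ} (h : 𝒟.sub A f = A')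
    {M : 𝒟.Ty (Id A).ext} {M' : 𝒟.Ty (Id A').ext} (k : 𝒟.sub M (𝒟.cart (Id_sub h)) = M')
    (c : Tm (𝒟.sub M (toIdIntro.r A))),
    (H M c).subst (toIdFormer.Eq_square (toIdIntro.r_sub h) k (J_sub h k c) c) =
      H M' (c.subst (𝒟.sub_square (toIdIntro.r_sub h) k))

/-- A choice of dependent sum types, stable under re-indexing. -/
structure SigmaFormer where
  Sig : ∀ {Γ : C} (A : 𝒟.Ty Γ), 𝒟.Ty A.ext → 𝒟.Ty Γ
  Sig_sub : ∀ {Γ Δ : C} {A : 𝒟.Ty Γ} {B : 𝒟.Ty A.ext} {f : Δ ⟶ Γ} {A' : 𝒟.Ty Δ}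
    {B' : 𝒟.Ty A'.ext} (h : 𝒟.sub A f = A') (_ : 𝒟.sub B (𝒟.cart h) = B'),
    𝒟.sub (Sig A B) f = Sig A' B'

variable {𝒟} in
theorem cart_cart_proj {Γ Δ : C} {A : 𝒟.Ty Γ} {B : 𝒟.Ty A.ext} {f : Δ ⟶ Γ} {A' : 𝒟.Ty Δ}
    {B' : 𝒟.Ty A'.ext} (h : 𝒟.sub A f = A') (k : 𝒟.sub B (𝒟.cart h) = B') :
    (B'.proj ≫ A'.proj) ≫ f = 𝒟.cart k ≫ B.proj ≫ A.proj := by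
  rw [Category.assoc, ← 𝒟.cart_proj h, ← Category.assoc, ← 𝒟.cart_proj k, Category.assoc]

/-- Dependent sum types with pairing. -/
structure SigmaIntro extends 𝒟.SigmaFormer where
  pair : ∀ {Γ : C} (A : 𝒟.Ty Γ) (B : 𝒟.Ty A.ext), Tm (𝒟.sub (Sig A B) (B.proj ≫ A.proj))
  pair_sub : ∀ {Γ Δ : C} {A : 𝒟.Ty Γ} {B : 𝒟.Ty A.ext} {f : Δ ⟶ Γ} {A' : 𝒟.Ty Δ}
    {B' : 𝒟.Ty A'.ext} (h : 𝒟.sub A f = A') (k : 𝒟.sub B (𝒟.cart h) = B'),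
    (pair A B).subst (𝒟.sub_square (cart_cart_proj h k) (Sig_sub h k)) = pair A' B'

namespace SigmaIntro

variable {𝒟} (S : 𝒟.SigmaIntro)

/-- The arrow `p : Γ.A.B ⟶ Γ.Σ`. -/
noncomputable def p {Γ : C} (A : 𝒟.Ty Γ) (B : 𝒟.Ty A.ext) : B.ext ⟶ (S.Sig A B).ext :=
  (S.pair A B).arrow

theorem p_sub {Γ Δ : C} {A : 𝒟.Ty Γ} {B : 𝒟.Ty A.ext} {f : Δ ⟶ Γ} {A' : 𝒟.Ty Δ}
    {B' : 𝒟.Ty A'.ext} (h : 𝒟.sub A f = A') (k : 𝒟.sub B (𝒟.cart h) = B') :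
    S.p A' B' ≫ 𝒟.cart (S.Sig_sub h k) = 𝒟.cart k ≫ S.p A B := by
  have := Tm.arrow_square (cart_cart_proj h k) (S.Sig_sub h k) (S.pair A B)
  rwa [S.pair_sub h k] at this

end SigmaIntro

/-- Dependent sum types with the elimination rule. -/
structure SigmaElim extends 𝒟.SigmaIntro where
  split : ∀ {Γ : C} {A : 𝒟.Ty Γ} {B : 𝒟.Ty A.ext} (M : 𝒟.Ty (Sig A B).ext),
    Tm (𝒟.sub M (toSigmaIntro.p A B)) → Tm M
  split_sub : ∀ {Γ Δ : C} {A : 𝒟.Ty Γ} {B : 𝒟.Ty A.ext} {f : Δ ⟶ Γ} {A' : 𝒟.Ty Δ}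
    {B' : 𝒟.Ty A'.ext} (h : 𝒟.sub A f = A') (k : 𝒟.sub B (𝒟.cart h) = B')
    {M : 𝒟.Ty (Sig A B).ext} {M' : 𝒟.Ty (Sig A' B').ext}
    (l : 𝒟.sub M (𝒟.cart (Sig_sub h k)) = M') (c : Tm (𝒟.sub M (toSigmaIntro.p A B))),
    (split M c).subst l = split M' (c.subst (𝒟.sub_square (toSigmaIntro.p_sub h k) l))

/-- Axiomatic dependent sum types. -/
structure AxiomaticSigma (I : 𝒟.IdFormer) extends 𝒟.SigmaElim where
  σ : ∀ {Γ : C} {A : 𝒟.Ty Γ} {B : 𝒟.Ty A.ext} (M : 𝒟.Ty (Sig A B).ext)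
    (c : Tm (𝒟.sub M (toSigmaIntro.p A B))),
    Tm (I.Eq ((split M c).sub (toSigmaIntro.p A B)) c)
  σ_sub : ∀ {Γ Δ : C} {A : 𝒟.Ty Γ} {B : 𝒟.Ty A.ext} {f : Δ ⟶ Γ} {A' : 𝒟.Ty Δ}
    {B' : 𝒟.Ty A'.ext} (h : 𝒟.sub A f = A') (k : 𝒟.sub B (𝒟.cart h) = B')
    {M : 𝒟.Ty (Sig A B).ext} {M' : 𝒟.Ty (Sig A' B').ext}
    (l : 𝒟.sub M (𝒟.cart (Sig_sub h k)) = M') (c : Tm (𝒟.sub M (toSigmaIntro.p A B))),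
    (σ M c).subst (I.Eq_square (toSigmaIntro.p_sub h k) l (split_sub h k l c) c) =
      σ M' (c.subst (𝒟.sub_square (toSigmaIntro.p_sub h k) l))

/-- A choice of dependent product types, stable under re-indexing. -/
structure PiFormer where
  Pi : ∀ {Γ : C} (A : 𝒟.Ty Γ), 𝒟.Ty A.ext → 𝒟.Ty Γ
  Pi_sub : ∀ {Γ Δ : C} {A : 𝒟.Ty Γ} {B : 𝒟.Ty A.ext} {f : Δ ⟶ Γ} {A' : 𝒟.Ty Δ}
    {B' : 𝒟.Ty A'.ext} (h : 𝒟.sub A f = A') (_ : 𝒟.sub B (𝒟.cart h) = B'),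
    𝒟.sub (Pi A B) f = Pi A' B'

namespace PiFormer

variable {𝒟} (P : 𝒟.PiFormer)

/-- The type `A[P_Π]` in context `Γ.Π`. -/
abbrev dom {Γ : C} (A : 𝒟.Ty Γ) (B : 𝒟.Ty A.ext) : 𝒟.Ty (P.Pi A B).ext :=
  𝒟.sub A (P.Pi A B).proj

/-- The type `B[P_Π.A]` in context `Γ.Π.A[P_Π]`. -/
abbrev cod {Γ : C} (A : 𝒟.Ty Γ) (B : 𝒟.Ty A.ext) : 𝒟.Ty (P.dom A B).ext :=
  𝒟.sub B (𝒟.lift A (P.Pi A B).proj)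

theorem dom_sub {Γ Δ : C} {A : 𝒟.Ty Γ} {B : 𝒟.Ty A.ext} {f : Δ ⟶ Γ} {A' : 𝒟.Ty Δ}
    {B' : 𝒟.Ty A'.ext} (h : 𝒟.sub A f = A') (k : 𝒟.sub B (𝒟.cart h) = B') :
    𝒟.sub (P.dom A B) (𝒟.cart (P.Pi_sub h k)) = P.dom A' B' :=
  𝒟.sub_square (𝒟.cart_proj (P.Pi_sub h k)).symm h

theorem dom_sub_lift {Γ Δ : C} {A : 𝒟.Ty Γ} {B : 𝒟.Ty A.ext} {f : Δ ⟶ Γ} {A' : 𝒟.Ty Δ}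
    {B' : 𝒟.Ty A'.ext} (h : 𝒟.sub A f = A') (k : 𝒟.sub B (𝒟.cart h) = B') :
    𝒟.lift A' (P.Pi A' B').proj ≫ 𝒟.cart h =
      𝒟.cart (P.dom_sub h k) ≫ 𝒟.lift A (P.Pi A B).proj :=
  (𝒟.cart_square (𝒟.cart_proj (P.Pi_sub h k)).symm h).symm

theorem cod_sub {Γ Δ : C} {A : 𝒟.Ty Γ} {B : 𝒟.Ty A.ext} {f : Δ ⟶ Γ} {A' : 𝒟.Ty Δ}
    {B' : 𝒟.Ty A'.ext} (h : 𝒟.sub A f = A') (k : 𝒟.sub B (𝒟.cart h) = B') :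
    𝒟.sub (P.cod A B) (𝒟.cart (P.dom_sub h k)) = P.cod A' B' :=
  𝒟.sub_square (P.dom_sub_lift h k) k

end PiFormer

/-- Dependent product types with evaluation. -/
structure PiEval extends 𝒟.PiFormer where
  ev : ∀ {Γ : C} (A : 𝒟.Ty Γ) (B : 𝒟.Ty A.ext), Tm (toPiFormer.cod A B)
  ev_sub : ∀ {Γ Δ : C} {A : 𝒟.Ty Γ} {B : 𝒟.Ty A.ext} {f : Δ ⟶ Γ} {A' : 𝒟.Ty Δ}
    {B' : 𝒟.Ty A'.ext} (h : 𝒟.sub A f = A') (k : 𝒟.sub B (𝒟.cart h) = B'),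
    (ev A B).subst (toPiFormer.cod_sub h k) = ev A' B'

namespace PiEval

variable {𝒟} (P : 𝒟.PiEval)

theorem dom_term {Γ Δ : C} {A : 𝒟.Ty Γ} {B : 𝒟.Ty A.ext} {f : Δ ⟶ Γ} {A' : 𝒟.Ty Δ}
    (h : 𝒟.sub A f = A') {z : Δ ⟶ (P.Pi A B).ext} (hz : z ≫ (P.Pi A B).proj = f) :
    𝒟.sub (P.dom A B) z = A' := by
  rw [← 𝒟.sub_comp, hz, h]

theorem dom_term_lift {Γ Δ : C} {A : 𝒟.Ty Γ} {B : 𝒟.Ty A.ext} {f : Δ ⟶ Γ} {A' : 𝒟.Ty Δ}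
    (h : 𝒟.sub A f = A') {z : Δ ⟶ (P.Pi A B).ext} (hz : z ≫ (P.Pi A B).proj = f) :
    𝒟.cart (P.dom_term h hz) ≫ 𝒟.lift A (P.Pi A B).proj = 𝒟.cart h := by
  have := 𝒟.cart_trans (rfl : 𝒟.sub A (P.Pi A B).proj = _) (P.dom_term h hz)
  rw [cart_rfl] at this
  rw [← this]
  exact 𝒟.cart_congr hz _ _

theorem cod_term {Γ Δ : C} {A : 𝒟.Ty Γ} {B : 𝒟.Ty A.ext} {f : Δ ⟶ Γ} {A' : 𝒟.Ty Δ}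
    {B' : 𝒟.Ty A'.ext} (h : 𝒟.sub A f = A') (k : 𝒟.sub B (𝒟.cart h) = B')
    {z : Δ ⟶ (P.Pi A B).ext} (hz : z ≫ (P.Pi A B).proj = f) :
    𝒟.sub (P.cod A B) (𝒟.cart (P.dom_term h hz)) = B' := by
  rw [← 𝒟.sub_comp, P.dom_term_lift h hz, k]

/-- The term `ev[z.A]` of type `B[f.A]`, where `z : Δ ⟶ Γ.Π` lies over `f : Δ ⟶ Γ`. -/
noncomputable def evAt {Γ Δ : C} {A : 𝒟.Ty Γ} {B : 𝒟.Ty A.ext} {f : Δ ⟶ Γ} {A' : 𝒟.Ty Δ}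
    {B' : 𝒟.Ty A'.ext} (h : 𝒟.sub A f = A') (k : 𝒟.sub B (𝒟.cart h) = B')
    (z : Δ ⟶ (P.Pi A B).ext) (hz : z ≫ (P.Pi A B).proj = f) : Tm B' :=
  (P.ev A B).subst (P.cod_term h k hz)

theorem evAt_cart {Γ Δ : C} {A : 𝒟.Ty Γ} {B : 𝒟.Ty A.ext} {f : Δ ⟶ Γ} {A' : 𝒟.Ty Δ}
    {B' : 𝒟.Ty A'.ext} (h : 𝒟.sub A f = A') (k : 𝒟.sub B (𝒟.cart h) = B')
    (z : Δ ⟶ (P.Pi A B).ext) (hz : z ≫ (P.Pi A B).proj = f) :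
    (P.evAt h k z hz).hom ≫ 𝒟.cart k = 𝒟.cart (P.dom_term h hz) ≫ (P.ev A B).arrow := by
  have e : 𝒟.cart k = 𝒟.cart (P.cod_term h k hz) ≫
      𝒟.lift B (𝒟.lift A (P.Pi A B).proj) := by
    have := 𝒟.cart_trans (rfl : 𝒟.sub B (𝒟.lift A (P.Pi A B).proj) = _) (P.cod_term h k hz)
    rw [cart_rfl] at this
    rw [← this]
    exact 𝒟.cart_congr (P.dom_term_lift h hz).symm _ _
  rw [e, ← Category.assoc, evAt, Tm.subst_hom_cart, Category.assoc, Tm.arrow]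

/-- Re-indexing of `ev[z.A]`. -/
theorem evAt_sub {Γ Δ Ω : C} {A : 𝒟.Ty Γ} {B : 𝒟.Ty A.ext} {f : Δ ⟶ Γ} {A' : 𝒟.Ty Δ}
    {B' : 𝒟.Ty A'.ext} (h : 𝒟.sub A f = A') (k : 𝒟.sub B (𝒟.cart h) = B')
    (z : Δ ⟶ (P.Pi A B).ext) (hz : z ≫ (P.Pi A B).proj = f)
    {g : Ω ⟶ Δ} {f₁ : Ω ⟶ Γ} {A₁ : 𝒟.Ty Ω} {B₁ : 𝒟.Ty A₁.ext} (h₁ : 𝒟.sub A f₁ = A₁)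
    (k₁ : 𝒟.sub B (𝒟.cart h₁) = B₁) (z₁ : Ω ⟶ (P.Pi A B).ext)
    (hz₁ : z₁ ≫ (P.Pi A B).proj = f₁) (ez : g ≫ z = z₁) (h' : 𝒟.sub A' g = A₁)
    (k' : 𝒟.sub B' (𝒟.cart h') = B₁) :
    (P.evAt h k z hz).subst k' = P.evAt h₁ k₁ z₁ hz₁ := by
  unfold evAt
  rw [Tm.subst_subst]
  refine (P.ev A B).subst_congr ?_ _ _
  rw [← 𝒟.cart_trans (P.dom_term h hz) h']
  exact 𝒟.cart_congr ez _ _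

/-- Evaluating along an arrow that factors through a re-indexing of the type `Π`. -/
theorem evAt_cart_Pi {Γ Δ Ω : C} {A : 𝒟.Ty Γ} {B : 𝒟.Ty A.ext} {f : Δ ⟶ Γ} {A' : 𝒟.Ty Δ}
    {B' : 𝒟.Ty A'.ext} (h : 𝒟.sub A f = A') (k : 𝒟.sub B (𝒟.cart h) = B')
    {g : Ω ⟶ Δ} {A₁ : 𝒟.Ty Ω} {B₁ : 𝒟.Ty A₁.ext} (h' : 𝒟.sub A' g = A₁)
    (k' : 𝒟.sub B' (𝒟.cart h') = B₁) (z' : Ω ⟶ (P.Pi A' B').ext)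
    (hz' : z' ≫ (P.Pi A' B').proj = g)
    {f₁ : Ω ⟶ Γ} (h₁ : 𝒟.sub A f₁ = A₁) (k₁ : 𝒟.sub B (𝒟.cart h₁) = B₁)
    (z : Ω ⟶ (P.Pi A B).ext) (hz : z ≫ (P.Pi A B).proj = f₁)
    (ez : z' ≫ 𝒟.cart (P.Pi_sub h k) = z) :
    P.evAt h' k' z' hz' = P.evAt h₁ k₁ z hz := by
  unfold evAt
  rw [← P.ev_sub h k, Tm.subst_subst]
  refine (P.ev A B).subst_congr ?_ _ _
  rw [← 𝒟.cart_trans (P.dom_sub h k) (P.dom_term h' hz')]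
  exact 𝒟.cart_congr ez _ _

theorem sub_cart_id {Γ : C} {A : 𝒟.Ty Γ} (B : 𝒟.Ty A.ext) :
    𝒟.sub B (𝒟.cart (𝒟.sub_id A)) = B := by
  rw [cart_id, 𝒟.sub_id]

/-- The term `ev[z.A]` of type `B`, for a term `z` of type `Π`. -/
noncomputable def app {Γ : C} {A : 𝒟.Ty Γ} {B : 𝒟.Ty A.ext} (z : Tm (P.Pi A B)) : Tm B :=
  P.evAt (𝒟.sub_id A) (sub_cart_id B) z.hom z.hom_proj

theorem app_sub {Γ Δ : C} {A : 𝒟.Ty Γ} {B : 𝒟.Ty A.ext} {f : Δ ⟶ Γ} {A' : 𝒟.Ty Δ}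
    {B' : 𝒟.Ty A'.ext} (h : 𝒟.sub A f = A') (k : 𝒟.sub B (𝒟.cart h) = B')
    (z : Tm (P.Pi A B)) : (P.app z).subst k = P.app (z.subst (P.Pi_sub h k)) := by
  unfold app
  rw [P.evAt_cart_Pi h k (𝒟.sub_id A') (sub_cart_id B') (z.subst (P.Pi_sub h k)).hom
    (Tm.hom_proj _) h k (f ≫ z.hom) (by rw [Category.assoc, z.hom_proj, Category.comp_id])
    (z.subst_hom_cart _)]
  exact P.evAt_sub _ _ _ _ _ _ _ _ rfl _ _

end PiEval

/-- Dependent product types with abstraction. -/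
structure PiIntro extends 𝒟.PiEval where
  abs : ∀ {Γ : C} {A : 𝒟.Ty Γ} {B : 𝒟.Ty A.ext}, Tm B → Tm (Pi A B)
  abs_sub : ∀ {Γ Δ : C} {A : 𝒟.Ty Γ} {B : 𝒟.Ty A.ext} {f : Δ ⟶ Γ} {A' : 𝒟.Ty Δ}
    {B' : 𝒟.Ty A'.ext} (h : 𝒟.sub A f = A') (k : 𝒟.sub B (𝒟.cart h) = B') (υ : Tm B),
    (abs υ).subst (Pi_sub h k) = abs (υ.subst k)

namespace PiIntro

variable {𝒟} (P : 𝒟.PiIntro) (I : 𝒟.IdFormer)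

theorem Eq_app_abs_sub {Γ Δ : C} {A : 𝒟.Ty Γ} {B : 𝒟.Ty A.ext} {f : Δ ⟶ Γ} {A' : 𝒟.Ty Δ}
    {B' : 𝒟.Ty A'.ext} (h : 𝒟.sub A f = A') (k : 𝒟.sub B (𝒟.cart h) = B') (υ : Tm B) :
    𝒟.sub (I.Eq (P.app (P.abs υ)) υ) (𝒟.cart h) =
      I.Eq (P.app (P.abs (υ.subst k))) (υ.subst k) := by
  rw [I.Eq_sub k, P.app_sub h k, P.abs_sub h k]

end PiIntro

/-- Axiomatic dependent product types. -/
structure AxiomaticPi (I : 𝒟.IdFormer) extends 𝒟.PiIntro where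
  β : ∀ {Γ : C} {A : 𝒟.Ty Γ} {B : 𝒟.Ty A.ext} (υ : Tm B),
    Tm (I.Eq (toPiEval.app (abs υ)) υ)
  β_sub : ∀ {Γ Δ : C} {A : 𝒟.Ty Γ} {B : 𝒟.Ty A.ext} {f : Δ ⟶ Γ} {A' : 𝒟.Ty Δ}
    {B' : 𝒟.Ty A'.ext} (h : 𝒟.sub A f = A') (k : 𝒟.sub B (𝒟.cart h) = B') (υ : Tm B),
    (β υ).subst (toPiIntro.Eq_app_abs_sub I h k υ) = β (υ.subst k)

section FunctionExtensionality

variable {𝒟} {I : 𝒟.AxiomaticId} (P : 𝒟.AxiomaticPi I.toIdFormer)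

namespace AxiomaticPi

/-- The type `Π_{x:A'} ev(z,x) = ev(z',x)`, for two arrows `z`, `z'` into `Γ.Π` over `f`. -/
noncomputable def Htpy {Γ Δ : C} {A : 𝒟.Ty Γ} {B : 𝒟.Ty A.ext} {f : Δ ⟶ Γ} {A' : 𝒟.Ty Δ}
    {B' : 𝒟.Ty A'.ext} (h : 𝒟.sub A f = A') (k : 𝒟.sub B (𝒟.cart h) = B')
    (z z' : Δ ⟶ (P.Pi A B).ext) (hz : z ≫ (P.Pi A B).proj = f)
    (hz' : z' ≫ (P.Pi A B).proj = f) : 𝒟.Ty Δ :=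
  P.Pi A' (I.Eq (P.evAt h k z hz) (P.evAt h k z' hz'))

theorem Htpy_sub {Γ Δ Ω : C} {A : 𝒟.Ty Γ} {B : 𝒟.Ty A.ext} {f : Δ ⟶ Γ} {A' : 𝒟.Ty Δ}
    {B' : 𝒟.Ty A'.ext} (h : 𝒟.sub A f = A') (k : 𝒟.sub B (𝒟.cart h) = B')
    (z z' : Δ ⟶ (P.Pi A B).ext) (hz : z ≫ (P.Pi A B).proj = f)
    (hz' : z' ≫ (P.Pi A B).proj = f)
    {g : Ω ⟶ Δ} {f₁ : Ω ⟶ Γ} {A₁ : 𝒟.Ty Ω} {B₁ : 𝒟.Ty A₁.ext} (h₁ : 𝒟.sub A f₁ = A₁)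
    (k₁ : 𝒟.sub B (𝒟.cart h₁) = B₁) (z₁ z₁' : Ω ⟶ (P.Pi A B).ext)
    (hz₁ : z₁ ≫ (P.Pi A B).proj = f₁) (hz₁' : z₁' ≫ (P.Pi A B).proj = f₁)
    (ez : g ≫ z = z₁) (ez' : g ≫ z' = z₁') :
    𝒟.sub (P.Htpy h k z z' hz hz') g = P.Htpy h₁ k₁ z₁ z₁' hz₁ hz₁' := by
  have e : g ≫ f = f₁ := by rw [← hz, ← hz₁, ← ez, Category.assoc]
  have h' : 𝒟.sub A' g = A₁ := by rw [← h, ← 𝒟.sub_comp, e, h₁]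
  have ec : 𝒟.cart h' ≫ 𝒟.cart h = 𝒟.cart h₁ := by
    rw [← 𝒟.cart_trans h h']
    exact 𝒟.cart_congr e _ _
  have k' : 𝒟.sub B' (𝒟.cart h') = B₁ := by rw [← k, ← 𝒟.sub_comp, ec, k₁]
  unfold Htpy
  rw [P.Pi_sub h' rfl, I.Eq_sub k', P.evAt_sub h k z hz h₁ k₁ z₁ hz₁ ez h' k',
    P.evAt_sub h k z' hz' h₁ k₁ z₁' hz₁' ez' h' k']

theorem Htpy_cart_Pi {Γ Δ Ω : C} {A : 𝒟.Ty Γ} {B : 𝒟.Ty A.ext} {f : Δ ⟶ Γ} {A' : 𝒟.Ty Δ}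
    {B' : 𝒟.Ty A'.ext} (h : 𝒟.sub A f = A') (k : 𝒟.sub B (𝒟.cart h) = B')
    {g : Ω ⟶ Δ} {A₁ : 𝒟.Ty Ω} {B₁ : 𝒟.Ty A₁.ext} (h' : 𝒟.sub A' g = A₁)
    (k' : 𝒟.sub B' (𝒟.cart h') = B₁) (z z' : Ω ⟶ (P.Pi A' B').ext)
    (hz : z ≫ (P.Pi A' B').proj = g) (hz' : z' ≫ (P.Pi A' B').proj = g)
    {f₁ : Ω ⟶ Γ} (h₁ : 𝒟.sub A f₁ = A₁) (k₁ : 𝒟.sub B (𝒟.cart h₁) = B₁)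
    (z₁ z₁' : Ω ⟶ (P.Pi A B).ext) (hz₁ : z₁ ≫ (P.Pi A B).proj = f₁)
    (hz₁' : z₁' ≫ (P.Pi A B).proj = f₁) (ez : z ≫ 𝒟.cart (P.Pi_sub h k) = z₁)
    (ez' : z' ≫ 𝒟.cart (P.Pi_sub h k) = z₁') :
    P.Htpy h' k' z z' hz hz' = P.Htpy h₁ k₁ z₁ z₁' hz₁ hz₁' := by
  unfold Htpy
  rw [P.evAt_cart_Pi h k h' k' z hz h₁ k₁ z₁ hz₁ ez,
    P.evAt_cart_Pi h k h' k' z' hz' h₁ k₁ z₁' hz₁' ez']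

/-- The first projection `s : Γ.Π.Π.Id ⟶ Γ.Π`. -/
noncomputable def s {Γ : C} (A : 𝒟.Ty Γ) (B : 𝒟.Ty A.ext) :
    (I.Id (P.Pi A B)).ext ⟶ (P.Pi A B).ext :=
  (I.Id (P.Pi A B)).proj ≫ (wk (P.Pi A B)).proj

/-- The second projection `t : Γ.Π.Π.Id ⟶ Γ.Π`. -/
noncomputable def t {Γ : C} (A : 𝒟.Ty Γ) (B : 𝒟.Ty A.ext) :
    (I.Id (P.Pi A B)).ext ⟶ (P.Pi A B).ext :=
  (I.Id (P.Pi A B)).proj ≫ 𝒟.lift (P.Pi A B) (P.Pi A B).proj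

theorem t_proj {Γ : C} (A : 𝒟.Ty Γ) (B : 𝒟.Ty A.ext) :
    P.t A B ≫ (P.Pi A B).proj = P.s A B ≫ (P.Pi A B).proj := by
  rw [t, s, Category.assoc, Category.assoc, (𝒟.isPullback _ _).w]

theorem r_s {Γ : C} (A : 𝒟.Ty Γ) (B : 𝒟.Ty A.ext) :
    I.r (P.Pi A B) ≫ P.s A B = 𝟙 _ := by
  rw [s, ← Category.assoc, I.r_proj, pr_proj]

theorem r_t {Γ : C} (A : 𝒟.Ty Γ) (B : 𝒟.Ty A.ext) :
    I.r (P.Pi A B) ≫ P.t A B = 𝟙 _ := by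
  rw [t, ← Category.assoc, I.r_proj, pr_lift]

theorem cart_s {Γ Δ : C} {A : 𝒟.Ty Γ} {B : 𝒟.Ty A.ext} {f : Δ ⟶ Γ} {A' : 𝒟.Ty Δ}
    {B' : 𝒟.Ty A'.ext} (h : 𝒟.sub A f = A') (k : 𝒟.sub B (𝒟.cart h) = B') :
    𝒟.cart (I.Id_sub (P.Pi_sub h k)) ≫ P.s A B = P.s A' B' ≫ 𝒟.cart (P.Pi_sub h k) := by
  rw [s, s, ← Category.assoc, 𝒟.cart_proj, Category.assoc, wk_cart_proj, Category.assoc]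

theorem cart_t {Γ Δ : C} {A : 𝒟.Ty Γ} {B : 𝒟.Ty A.ext} {f : Δ ⟶ Γ} {A' : 𝒟.Ty Δ}
    {B' : 𝒟.Ty A'.ext} (h : 𝒟.sub A f = A') (k : 𝒟.sub B (𝒟.cart h) = B') :
    𝒟.cart (I.Id_sub (P.Pi_sub h k)) ≫ P.t A B = P.t A' B' ≫ 𝒟.cart (P.Pi_sub h k) := by
  rw [t, t, ← Category.assoc, 𝒟.cart_proj, Category.assoc, wk_cart_lift, Category.assoc]

/-- The type of `happly`, in context `Γ.Π.Π.Id`. -/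
noncomputable def happlyType {Γ : C} (A : 𝒟.Ty Γ) (B : 𝒟.Ty A.ext) :
    𝒟.Ty (I.Id (P.Pi A B)).ext :=
  P.Htpy (A := A) (B := B) (f := P.s A B ≫ (P.Pi A B).proj) rfl rfl (P.s A B) (P.t A B) rfl
    (P.t_proj A B)

theorem cod_id {Γ : C} (A : 𝒟.Ty Γ) (B : 𝒟.Ty A.ext) :
    𝒟.sub B (𝒟.cart (rfl : 𝒟.sub A (P.Pi A B).proj = P.dom A B)) = P.cod A B := by
  rw [cart_rfl]

theorem evAt_id {Γ : C} (A : 𝒟.Ty Γ) (B : 𝒟.Ty A.ext) :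
    P.evAt (rfl : 𝒟.sub A (P.Pi A B).proj = P.dom A B) (P.cod_id A B) (𝟙 _)
      (Category.id_comp _) = P.ev A B := by
  unfold PiEval.evAt
  refine (Tm.eq_subst _ ?_).symm
  have e : 𝒟.cart (P.dom_term (rfl : 𝒟.sub A (P.Pi A B).proj = P.dom A B)
      (Category.id_comp _)) = 𝟙 (P.dom A B).ext := 𝒟.cart_id (P.dom A B)
  have e' : 𝒟.cart (P.cod_term (rfl : 𝒟.sub A (P.Pi A B).proj = P.dom A B)
      (P.cod_id A B) (Category.id_comp _)) = 𝟙 (P.cod A B).ext :=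
    (𝒟.cart_congr e _ (𝒟.sub_id _)).trans (𝒟.cart_id _)
  exact (congrArg ((P.ev A B).hom ≫ ·) e').trans ((Category.comp_id _).trans
    ((Category.id_comp _).symm.trans (congrArg (· ≫ (P.ev A B).hom) e.symm)))

theorem happlyType_r {Γ : C} (A : 𝒟.Ty Γ) (B : 𝒟.Ty A.ext) :
    P.Pi (P.dom A B) (I.Eq (P.ev A B) (P.ev A B)) =
      𝒟.sub (P.happlyType A B) (I.r (P.Pi A B)) := by
  have := P.Htpy_sub (A := A) (B := B) (f := P.s A B ≫ (P.Pi A B).proj) rfl rfl (P.s A B)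
    (P.t A B) rfl (P.t_proj A B) (rfl : 𝒟.sub A (P.Pi A B).proj = P.dom A B) (P.cod_id A B)
    (𝟙 _) (𝟙 _) (Category.id_comp _) (Category.id_comp _) (P.r_s A B) (P.r_t A B)
  rw [happlyType, this, Htpy, evAt_id]

theorem happlyType_sub {Γ Δ : C} {A : 𝒟.Ty Γ} {B : 𝒟.Ty A.ext} {f : Δ ⟶ Γ} {A' : 𝒟.Ty Δ}
    {B' : 𝒟.Ty A'.ext} (h : 𝒟.sub A f = A') (k : 𝒟.sub B (𝒟.cart h) = B') :
    𝒟.sub (P.happlyType A B) (𝒟.cart (I.Id_sub (P.Pi_sub h k))) = P.happlyType A' B' := by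
  let g := P.s A' B' ≫ (P.Pi A' B').proj
  have h₁ : 𝒟.sub A (g ≫ f) = 𝒟.sub A' g := 𝒟.sub_trans h rfl
  have k₁ : 𝒟.sub B (𝒟.cart h₁) = 𝒟.sub B' (𝒟.cart (rfl : 𝒟.sub A' g = 𝒟.sub A' g)) := by
    rw [𝒟.cart_trans h (rfl : 𝒟.sub A' g = 𝒟.sub A' g)]
    exact (𝒟.sub_comp B _ _).trans (congrArg (𝒟.sub · _) k)
  have hs : (P.s A' B' ≫ 𝒟.cart (P.Pi_sub h k)) ≫ (P.Pi A B).proj = g ≫ f := by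
    rw [Category.assoc, 𝒟.cart_proj, ← Category.assoc]
  have ht : (P.t A' B' ≫ 𝒟.cart (P.Pi_sub h k)) ≫ (P.Pi A B).proj = g ≫ f := by
    rw [Category.assoc, 𝒟.cart_proj, ← Category.assoc, t_proj]
  have e₁ := P.Htpy_sub (A := A) (B := B) (f := P.s A B ≫ (P.Pi A B).proj) rfl rfl (P.s A B)
    (P.t A B) rfl (P.t_proj A B) h₁ k₁ _ _ hs ht (P.cart_s h k) (P.cart_t h k)
  have e₂ := P.Htpy_cart_Pi h k (rfl : 𝒟.sub A' g = 𝒟.sub A' g) rfl (P.s A' B') (P.t A' B') rfl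
    (P.t_proj A' B') h₁ k₁ _ _ hs ht rfl rfl
  exact e₁.trans e₂.symm

/-- The term of type `Π_{x:A} ev(z,x) = ev(z',x)` in context `z, z' : Π; p : z = z'` that is
obtained by elimination from the term `λx.refl(ev(z,x))` in context `z : Π`. -/
noncomputable def happly {Γ : C} (A : 𝒟.Ty Γ) (B : 𝒟.Ty A.ext) : Tm (P.happlyType A B) :=
  I.J (P.happlyType A B)
    ((P.abs (I.reflAt (P.ev A B))).cast (P.happlyType_r A B))

theorem happly_sub {Γ Δ : C} {A : 𝒟.Ty Γ} {B : 𝒟.Ty A.ext} {f : Δ ⟶ Γ} {A' : 𝒟.Ty Δ}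
    {B' : 𝒟.Ty A'.ext} (h : 𝒟.sub A f = A') (k : 𝒟.sub B (𝒟.cart h) = B') :
    (P.happly A B).subst (P.happlyType_sub h k) = P.happly A' B' := by
  unfold happly
  rw [I.J_sub (P.Pi_sub h k) (P.happlyType_sub h k)]
  congr 1
  have hE : 𝒟.sub (I.Eq (P.ev A B) (P.ev A B)) (𝒟.cart (P.dom_sub h k)) =
      I.Eq (P.ev A' B') (P.ev A' B') := by
    rw [I.Eq_sub (P.cod_sub h k), P.ev_sub h k]
  have hr : (I.reflAt (P.ev A B)).subst hE = I.reflAt (P.ev A' B') :=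
    I.reflAt_subst (P.cod_sub h k) (P.ev_sub h k) hE
  rw [Tm.cast_subst]
  have ha := P.abs_sub (P.dom_sub h k) hE (I.reflAt (P.ev A B))
  rw [hr] at ha
  rw [← ha, Tm.subst_cast]

/-- The section `z, z', p : Γ ⟶ Γ.Π.Π.Id`. -/
noncomputable def pathArrow {Γ : C} {A : 𝒟.Ty Γ} {B : 𝒟.Ty A.ext} {z z' : Tm (P.Pi A B)}
    (p : Tm (I.Eq z z')) : Γ ⟶ (I.Id (P.Pi A B)).ext :=
  Tm.arrow (A := I.Id (P.Pi A B)) (k := pair z z') p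

theorem pathArrow_s {Γ : C} {A : 𝒟.Ty Γ} {B : 𝒟.Ty A.ext} {z z' : Tm (P.Pi A B)}
    (p : Tm (I.Eq z z')) : P.pathArrow p ≫ P.s A B = z.hom := by
  rw [pathArrow, s, ← Category.assoc, Tm.arrow_proj, pr_proj]

theorem pathArrow_t {Γ : C} {A : 𝒟.Ty Γ} {B : 𝒟.Ty A.ext} {z z' : Tm (P.Pi A B)}
    (p : Tm (I.Eq z z')) : P.pathArrow p ≫ P.t A B = z'.hom := by
  rw [pathArrow, t, ← Category.assoc, Tm.arrow_proj, pr_lift]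

theorem pathArrow_sub {Γ Δ : C} {A : 𝒟.Ty Γ} {B : 𝒟.Ty A.ext} {f : Δ ⟶ Γ} {A' : 𝒟.Ty Δ}
    {B' : 𝒟.Ty A'.ext} (h : 𝒟.sub A f = A') (k : 𝒟.sub B (𝒟.cart h) = B')
    {z z' : Tm (P.Pi A B)} (p : Tm (I.Eq z z')) :
    P.pathArrow (p.subst (I.Eq_sub (P.Pi_sub h k) z z')) ≫
      𝒟.cart (I.Id_sub (P.Pi_sub h k)) = f ≫ P.pathArrow p :=
  Tm.arrow_square (pair_sub (P.Pi_sub h k) z z') (I.Id_sub (P.Pi_sub h k)) p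

theorem happlyType_path {Γ : C} {A : 𝒟.Ty Γ} {B : 𝒟.Ty A.ext} {z z' : Tm (P.Pi A B)}
    (p : Tm (I.Eq z z')) :
    𝒟.sub (P.happlyType A B) (P.pathArrow p) = P.Pi A (I.Eq (P.app z) (P.app z')) :=
  P.Htpy_sub (A := A) (B := B) (f := P.s A B ≫ (P.Pi A B).proj) rfl rfl (P.s A B)
    (P.t A B) rfl (P.t_proj A B) (𝒟.sub_id A) (PiEval.sub_cart_id B) z.hom z'.hom z.hom_proj
    z'.hom_proj (P.pathArrow_s p) (P.pathArrow_t p)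

/-- The term of type `Π_{x:A} ev(z,x) = ev(z',x)` induced by `p : z = z'`. -/
noncomputable def happlyAt {Γ : C} {A : 𝒟.Ty Γ} {B : 𝒟.Ty A.ext} {z z' : Tm (P.Pi A B)}
    (p : Tm (I.Eq z z')) : Tm (P.Pi A (I.Eq (P.app z) (P.app z'))) :=
  (P.happly A B).subst (P.happlyType_path p)

theorem Pi_Eq_app_sub {Γ Δ : C} {A : 𝒟.Ty Γ} {B : 𝒟.Ty A.ext} {f : Δ ⟶ Γ} {A' : 𝒟.Ty Δ}
    {B' : 𝒟.Ty A'.ext} (h : 𝒟.sub A f = A') (k : 𝒟.sub B (𝒟.cart h) = B')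
    (z z' : Tm (P.Pi A B)) :
    𝒟.sub (P.Pi A (I.Eq (P.app z) (P.app z'))) f =
      P.Pi A' (I.Eq (P.app (z.subst (P.Pi_sub h k))) (P.app (z'.subst (P.Pi_sub h k)))) := by
  apply P.Pi_sub h
  rw [I.Eq_sub k, P.app_sub h k, P.app_sub h k]

theorem happlyAt_sub {Γ Δ : C} {A : 𝒟.Ty Γ} {B : 𝒟.Ty A.ext} {f : Δ ⟶ Γ} {A' : 𝒟.Ty Δ}
    {B' : 𝒟.Ty A'.ext} (h : 𝒟.sub A f = A') (k : 𝒟.sub B (𝒟.cart h) = B')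
    {z z' : Tm (P.Pi A B)} (p : Tm (I.Eq z z')) :
    (P.happlyAt p).subst (P.Pi_Eq_app_sub h k z z') =
      P.happlyAt (p.subst (I.Eq_sub (P.Pi_sub h k) z z')) := by
  unfold happlyAt
  rw [← P.happly_sub h k, Tm.subst_subst, Tm.subst_subst]
  exact (P.happly A B).subst_congr (P.pathArrow_sub h k p).symm _ _

end AxiomaticPi

/-- Axiomatic function extensionality. -/
structure AxiomaticFunext where
  funext : ∀ {Γ : C} {A : 𝒟.Ty Γ} {B : 𝒟.Ty A.ext} {z z' : Tm (P.Pi A B)},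
    Tm (P.Pi A (I.Eq (P.app z) (P.app z'))) → Tm (I.Eq z z')
  β_funext : ∀ {Γ : C} {A : 𝒟.Ty Γ} {B : 𝒟.Ty A.ext} {z z' : Tm (P.Pi A B)}
    (q : Tm (P.Pi A (I.Eq (P.app z) (P.app z')))), Tm (I.Eq (P.happlyAt (funext q)) q)
  η_funext : ∀ {Γ : C} {A : 𝒟.Ty Γ} {B : 𝒟.Ty A.ext} {z z' : Tm (P.Pi A B)} (p : Tm (I.Eq z z')),
    Tm (I.Eq p (funext (P.happlyAt p)))
  funext_sub : ∀ {Γ Δ : C} {A : 𝒟.Ty Γ} {B : 𝒟.Ty A.ext} {f : Δ ⟶ Γ} {A' : 𝒟.Ty Δ}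
    {B' : 𝒟.Ty A'.ext} (h : 𝒟.sub A f = A') (k : 𝒟.sub B (𝒟.cart h) = B')
    {z z' : Tm (P.Pi A B)} (q : Tm (P.Pi A (I.Eq (P.app z) (P.app z')))),
    (funext q).subst (I.Eq_sub (P.Pi_sub h k) z z') =
      funext (q.subst (P.Pi_Eq_app_sub h k z z'))
  β_funext_sub : ∀ {Γ Δ : C} {A : 𝒟.Ty Γ} {B : 𝒟.Ty A.ext} {f : Δ ⟶ Γ} {A' : 𝒟.Ty Δ}
    {B' : 𝒟.Ty A'.ext} (h : 𝒟.sub A f = A') (k : 𝒟.sub B (𝒟.cart h) = B')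
    {z z' : Tm (P.Pi A B)} (q : Tm (P.Pi A (I.Eq (P.app z) (P.app z')))),
    (β_funext q).subst
      ((I.Eq_sub (P.Pi_Eq_app_sub h k z z') _ q).trans (congrArg (I.Eq · _)
        ((P.happlyAt_sub h k (funext q)).trans (congrArg P.happlyAt (funext_sub h k q))))) =
      β_funext (q.subst (P.Pi_Eq_app_sub h k z z'))
  η_funext_sub : ∀ {Γ Δ : C} {A : 𝒟.Ty Γ} {B : 𝒟.Ty A.ext} {f : Δ ⟶ Γ} {A' : 𝒟.Ty Δ}
    {B' : 𝒟.Ty A'.ext} (h : 𝒟.sub A f = A') (k : 𝒟.sub B (𝒟.cart h) = B')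
    {z z' : Tm (P.Pi A B)} (p : Tm (I.Eq z z')),
    (η_funext p).subst
      ((I.Eq_sub (I.Eq_sub (P.Pi_sub h k) z z') p _).trans (congrArg (I.Eq _)
        ((funext_sub h k _).trans (congrArg funext (P.happlyAt_sub h k p))))) =
      η_funext (p.subst (I.Eq_sub (P.Pi_sub h k) z z'))

end FunctionExtensionality

/-- A choice of empty types, stable under re-indexing. -/
structure EmptyFormer where
  T : ∀ Γ : C, 𝒟.Ty Γ
  T_sub : ∀ {Γ Δ : C} (f : Δ ⟶ Γ), 𝒟.sub (T Γ) f = T Δ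

/-- Axiomatic empty types. -/
structure AxiomaticEmpty extends 𝒟.EmptyFormer where
  ind : ∀ {Γ : C} (M : 𝒟.Ty (T Γ).ext), Tm M
  ind_sub : ∀ {Γ Δ : C} (f : Δ ⟶ Γ) {M : 𝒟.Ty (T Γ).ext} {M' : 𝒟.Ty (T Δ).ext}
    (k : 𝒟.sub M (𝒟.cart (T_sub f)) = M'), (ind M).subst k = ind M'

/-- A choice of unit types with their canonical terms, stable under re-indexing. -/
structure UnitFormer where
  T : ∀ Γ : C, 𝒟.Ty Γ
  star : ∀ Γ : C, Tm (T Γ)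
  T_sub : ∀ {Γ Δ : C} (f : Δ ⟶ Γ), 𝒟.sub (T Γ) f = T Δ
  star_sub : ∀ {Γ Δ : C} (f : Δ ⟶ Γ), (star Γ).subst (T_sub f) = star Δ

variable {𝒟} in
theorem term_square {Γ Δ : C} {A : 𝒟.Ty Γ} {A' : 𝒟.Ty Δ} {f : Δ ⟶ Γ} {a : Tm A} {a' : Tm A'}
    {h : 𝒟.sub A f = A'} (e : a.subst h = a') : a'.hom ≫ 𝒟.cart h = f ≫ a.hom := by
  rw [← e, Tm.subst_hom_cart]

/-- Axiomatic unit types. -/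
structure AxiomaticUnit (I : 𝒟.IdFormer) extends 𝒟.UnitFormer where
  ind : ∀ {Γ : C} (M : 𝒟.Ty (T Γ).ext), Tm (𝒟.sub M (star Γ).hom) → Tm M
  β : ∀ {Γ : C} (M : 𝒟.Ty (T Γ).ext) (c : Tm (𝒟.sub M (star Γ).hom)),
    Tm (I.Eq ((ind M c).sub (star Γ).hom) c)
  ind_sub : ∀ {Γ Δ : C} (f : Δ ⟶ Γ) {M : 𝒟.Ty (T Γ).ext} {M' : 𝒟.Ty (T Δ).ext}
    (k : 𝒟.sub M (𝒟.cart (T_sub f)) = M') (c : Tm (𝒟.sub M (star Γ).hom)),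
    (ind M c).subst k = ind M' (c.subst (𝒟.sub_square (term_square (star_sub f)) k))
  β_sub : ∀ {Γ Δ : C} (f : Δ ⟶ Γ) {M : 𝒟.Ty (T Γ).ext} {M' : 𝒟.Ty (T Δ).ext}
    (k : 𝒟.sub M (𝒟.cart (T_sub f)) = M') (c : Tm (𝒟.sub M (star Γ).hom)),
    (β M c).subst (I.Eq_square (term_square (star_sub f)) k (ind_sub f k c) c) =
      β M' (c.subst (𝒟.sub_square (term_square (star_sub f)) k))

/-- A choice of types with two canonical terms, stable under re-indexing. -/
structure BoolFormer where
  T : ∀ Γ : C, 𝒟.Ty Γ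
  bot : ∀ Γ : C, Tm (T Γ)
  top : ∀ Γ : C, Tm (T Γ)
  T_sub : ∀ {Γ Δ : C} (f : Δ ⟶ Γ), 𝒟.sub (T Γ) f = T Δ
  bot_sub : ∀ {Γ Δ : C} (f : Δ ⟶ Γ), (bot Γ).subst (T_sub f) = bot Δ
  top_sub : ∀ {Γ Δ : C} (f : Δ ⟶ Γ), (top Γ).subst (T_sub f) = top Δ

/-- Axiomatic two-element types. -/
structure AxiomaticBool (I : 𝒟.IdFormer) extends 𝒟.BoolFormer where
  ind : ∀ {Γ : C} (M : 𝒟.Ty (T Γ).ext), Tm (𝒟.sub M (bot Γ).hom) →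
    Tm (𝒟.sub M (top Γ).hom) → Tm M
  βbot : ∀ {Γ : C} (M : 𝒟.Ty (T Γ).ext) (c : Tm (𝒟.sub M (bot Γ).hom))
    (d : Tm (𝒟.sub M (top Γ).hom)), Tm (I.Eq ((ind M c d).sub (bot Γ).hom) c)
  βtop : ∀ {Γ : C} (M : 𝒟.Ty (T Γ).ext) (c : Tm (𝒟.sub M (bot Γ).hom))
    (d : Tm (𝒟.sub M (top Γ).hom)), Tm (I.Eq ((ind M c d).sub (top Γ).hom) d)
  ind_sub : ∀ {Γ Δ : C} (f : Δ ⟶ Γ) {M : 𝒟.Ty (T Γ).ext} {M' : 𝒟.Ty (T Δ).ext}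
    (k : 𝒟.sub M (𝒟.cart (T_sub f)) = M') (c : Tm (𝒟.sub M (bot Γ).hom))
    (d : Tm (𝒟.sub M (top Γ).hom)),
    (ind M c d).subst k = ind M' (c.subst (𝒟.sub_square (term_square (bot_sub f)) k))
      (d.subst (𝒟.sub_square (term_square (top_sub f)) k))
  βbot_sub : ∀ {Γ Δ : C} (f : Δ ⟶ Γ) {M : 𝒟.Ty (T Γ).ext} {M' : 𝒟.Ty (T Δ).ext}
    (k : 𝒟.sub M (𝒟.cart (T_sub f)) = M') (c : Tm (𝒟.sub M (bot Γ).hom))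
    (d : Tm (𝒟.sub M (top Γ).hom)),
    (βbot M c d).subst (I.Eq_square (term_square (bot_sub f)) k (ind_sub f k c d) c) =
      βbot M' (c.subst (𝒟.sub_square (term_square (bot_sub f)) k))
        (d.subst (𝒟.sub_square (term_square (top_sub f)) k))
  βtop_sub : ∀ {Γ Δ : C} (f : Δ ⟶ Γ) {M : 𝒟.Ty (T Γ).ext} {M' : 𝒟.Ty (T Δ).ext}
    (k : 𝒟.sub M (𝒟.cart (T_sub f)) = M') (c : Tm (𝒟.sub M (bot Γ).hom))
    (d : Tm (𝒟.sub M (top Γ).hom)),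
    (βtop M c d).subst (I.Eq_square (term_square (top_sub f)) k (ind_sub f k c d) d) =
      βtop M' (c.subst (𝒟.sub_square (term_square (bot_sub f)) k))
        (d.subst (𝒟.sub_square (term_square (top_sub f)) k))

/-- A choice of types of natural numbers with zero and successor, stable under re-indexing. -/
structure NatFormer where
  N : ∀ Γ : C, 𝒟.Ty Γ
  zero : ∀ Γ : C, Tm (N Γ)
  succ : ∀ Γ : C, Tm (wk (N Γ))
  N_sub : ∀ {Γ Δ : C} (f : Δ ⟶ Γ), 𝒟.sub (N Γ) f = N Δ
  zero_sub : ∀ {Γ Δ : C} (f : Δ ⟶ Γ), (zero Γ).subst (N_sub f) = zero Δ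
  succ_sub : ∀ {Γ Δ : C} (f : Δ ⟶ Γ), (succ Γ).subst (wk_sub (N_sub f)) = succ Δ

namespace NatFormer

variable {𝒟} (𝒩 : 𝒟.NatFormer)

/-- The successor as an arrow `Γ.N ⟶ Γ.N` over `Γ`. -/
def s (Γ : C) : (𝒩.N Γ).ext ⟶ (𝒩.N Γ).ext := (𝒩.succ Γ).arrow

theorem s_sub {Γ Δ : C} (f : Δ ⟶ Γ) :
    𝒩.s Δ ≫ 𝒟.cart (𝒩.N_sub f) = 𝒟.cart (𝒩.N_sub f) ≫ 𝒩.s Γ := by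
  have := Tm.arrow_square (𝒟.cart_proj (𝒩.N_sub f)).symm (𝒩.N_sub f) (𝒩.succ Γ)
  have e := 𝒩.succ_sub f
  unfold s
  rw [← e]
  exact this

theorem proj_s_sub {Γ Δ : C} (f : Δ ⟶ Γ) {M : 𝒟.Ty (𝒩.N Γ).ext} {M' : 𝒟.Ty (𝒩.N Δ).ext}
    (k : 𝒟.sub M (𝒟.cart (𝒩.N_sub f)) = M') :
    (M'.proj ≫ 𝒩.s Δ) ≫ 𝒟.cart (𝒩.N_sub f) = 𝒟.cart k ≫ M.proj ≫ 𝒩.s Γ := by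
  rw [Category.assoc, 𝒩.s_sub, ← Category.assoc, ← 𝒟.cart_proj k, Category.assoc]

variable {𝒩} in
theorem step_type {Γ : C} {M : 𝒟.Ty (𝒩.N Γ).ext} (x : Tm M) :
    𝒟.sub (𝒟.sub M (M.proj ≫ 𝒩.s Γ)) x.hom = 𝒟.sub M (𝒩.s Γ) := by
  rw [← 𝒟.sub_comp, ← Category.assoc, x.hom_proj, Category.id_comp]

/-- The term `d(n, x(n))` of type `M(s(n))` in context `n : N`. -/
noncomputable def step {Γ : C} {M : 𝒟.Ty (𝒩.N Γ).ext}
    (d : Tm (𝒟.sub M (M.proj ≫ 𝒩.s Γ))) (x : Tm M) : Tm (𝒟.sub M (𝒩.s Γ)) :=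
  d.subst (step_type x)

theorem step_sub {Γ Δ : C} (f : Δ ⟶ Γ) {M : 𝒟.Ty (𝒩.N Γ).ext} {M' : 𝒟.Ty (𝒩.N Δ).ext}
    (k : 𝒟.sub M (𝒟.cart (𝒩.N_sub f)) = M') (d : Tm (𝒟.sub M (M.proj ≫ 𝒩.s Γ)))
    {x : Tm M} {x' : Tm M'} (hx : x.subst k = x') :
    (𝒩.step d x).subst (𝒟.sub_square (𝒩.s_sub f) k) =
      𝒩.step (d.subst (𝒟.sub_square (𝒩.proj_s_sub f k) k)) x' := by
  unfold step
  rw [Tm.subst_subst, Tm.subst_subst]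
  exact d.subst_congr (term_square hx).symm _ _

end NatFormer

/-- Axiomatic natural numbers types. -/
structure AxiomaticNat (I : 𝒟.IdFormer) extends 𝒟.NatFormer where
  ind : ∀ {Γ : C} (M : 𝒟.Ty (N Γ).ext), Tm (𝒟.sub M (zero Γ).hom) →
    Tm (𝒟.sub M (M.proj ≫ toNatFormer.s Γ)) → Tm M
  βzero : ∀ {Γ : C} (M : 𝒟.Ty (N Γ).ext) (c : Tm (𝒟.sub M (zero Γ).hom))
    (d : Tm (𝒟.sub M (M.proj ≫ toNatFormer.s Γ))),
    Tm (I.Eq ((ind M c d).sub (zero Γ).hom) c)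
  βsucc : ∀ {Γ : C} (M : 𝒟.Ty (N Γ).ext) (c : Tm (𝒟.sub M (zero Γ).hom))
    (d : Tm (𝒟.sub M (M.proj ≫ toNatFormer.s Γ))),
    Tm (I.Eq ((ind M c d).sub (toNatFormer.s Γ)) (toNatFormer.step d (ind M c d)))
  ind_sub : ∀ {Γ Δ : C} (f : Δ ⟶ Γ) {M : 𝒟.Ty (N Γ).ext} {M' : 𝒟.Ty (N Δ).ext}
    (k : 𝒟.sub M (𝒟.cart (N_sub f)) = M') (c : Tm (𝒟.sub M (zero Γ).hom))
    (d : Tm (𝒟.sub M (M.proj ≫ toNatFormer.s Γ))),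
    (ind M c d).subst k = ind M' (c.subst (𝒟.sub_square (term_square (zero_sub f)) k))
      (d.subst (𝒟.sub_square (toNatFormer.proj_s_sub f k) k))
  βzero_sub : ∀ {Γ Δ : C} (f : Δ ⟶ Γ) {M : 𝒟.Ty (N Γ).ext} {M' : 𝒟.Ty (N Δ).ext}
    (k : 𝒟.sub M (𝒟.cart (N_sub f)) = M') (c : Tm (𝒟.sub M (zero Γ).hom))
    (d : Tm (𝒟.sub M (M.proj ≫ toNatFormer.s Γ))),
    (βzero M c d).subst (I.Eq_square (term_square (zero_sub f)) k (ind_sub f k c d) c) =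
      βzero M' (c.subst (𝒟.sub_square (term_square (zero_sub f)) k))
        (d.subst (𝒟.sub_square (toNatFormer.proj_s_sub f k) k))
  βsucc_sub : ∀ {Γ Δ : C} (f : Δ ⟶ Γ) {M : 𝒟.Ty (N Γ).ext} {M' : 𝒟.Ty (N Δ).ext}
    (k : 𝒟.sub M (𝒟.cart (N_sub f)) = M') (c : Tm (𝒟.sub M (zero Γ).hom))
    (d : Tm (𝒟.sub M (M.proj ≫ toNatFormer.s Γ))),
    (βsucc M c d).subst
      ((I.Eq_square (toNatFormer.s_sub f) k (ind_sub f k c d) _).trans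
        (congrArg (I.Eq _) (toNatFormer.step_sub f k d (ind_sub f k c d)))) =
      βsucc M' (c.subst (𝒟.sub_square (term_square (zero_sub f)) k))
        (d.subst (𝒟.sub_square (toNatFormer.proj_s_sub f k) k))

/-- A model of axiomatic type theory over the display map category `𝒟`. -/
structure ModelOfATT where
  id : 𝒟.AxiomaticId
  sigma : 𝒟.AxiomaticSigma id.toIdFormer
  pi : 𝒟.AxiomaticPi id.toIdFormer
  funext : AxiomaticFunext pi
  empty : 𝒟.AxiomaticEmpty
  unit : 𝒟.AxiomaticUnit id.toIdFormer
  bool : 𝒟.AxiomaticBool id.toIdFormer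
  nat : 𝒟.AxiomaticNat id.toIdFormer

end DisplayMapCategory

section TwoCells

open Bicategory

variable {B : Type u} [Bicategory.{w, v} B]

/-- Two 2-cells are the same 2-cell: their boundaries are equal and they agree along these
equalities. In a strict bicategory this is the equality of 2-cells of the 2-category. -/
def SameCell {X Y : B} {f g f' g' : X ⟶ Y} (p : f ⟶ g) (q : f' ⟶ g') : Prop :=
  Arrow.mk p = Arrow.mk q

theorem SameCell.left {X Y : B} {f g f' g' : X ⟶ Y} {p : f ⟶ g} {q : f' ⟶ g'}
    (h : SameCell p q) : f = f' :=
  congrArg Comma.left h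

theorem SameCell.right {X Y : B} {f g f' g' : X ⟶ Y} {p : f ⟶ g} {q : f' ⟶ g'}
    (h : SameCell p q) : g = g' :=
  congrArg Comma.right h

theorem sameCell_iff {X Y : B} {f g f' g' : X ⟶ Y} {p : f ⟶ g} {q : f' ⟶ g'} :
    SameCell p q ↔ ∃ (h₁ : f = f') (h₂ : g = g'), p = eqToHom h₁ ≫ q ≫ eqToHom h₂.symm := by
  constructor
  · intro h
    obtain rfl := h.left
    obtain rfl := h.right
    exact ⟨rfl, rfl, by simpa using (Arrow.mk_inj _ _).1 h⟩
  · rintro ⟨rfl, rfl, h⟩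
    simp only [eqToHom_refl, Category.comp_id, Category.id_comp] at h
    subst h
    rfl

theorem SameCell.eq {X Y : B} {f g : X ⟶ Y} {p q : f ⟶ g} (h : SameCell p q) : p = q :=
  (Arrow.mk_inj _ _).1 h

theorem SameCell.trans {X Y : B} {f g f' g' f'' g'' : X ⟶ Y} {p : f ⟶ g} {q : f' ⟶ g'}
    {r : f'' ⟶ g''} (h : SameCell p q) (h' : SameCell q r) : SameCell p r :=
  Eq.trans h h'

theorem SameCell.comp {X Y : B} {f g k f' g' k' : X ⟶ Y} {p : f ⟶ g} {q : g ⟶ k}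
    {p' : f' ⟶ g'} {q' : g' ⟶ k'} (h : SameCell p p') (h' : SameCell q q') :
    SameCell (p ≫ q) (p' ≫ q') := by
  obtain rfl := h.left
  obtain rfl := h.right
  obtain rfl := h'.right
  rw [h.eq, h'.eq]
  rfl

theorem SameCell.whiskerLeft {X Y Z : B} (m : X ⟶ Y) {f g f' g' : Y ⟶ Z} {p : f ⟶ g}
    {p' : f' ⟶ g'} (h : SameCell p p') : SameCell (m ◁ p) (m ◁ p') := by
  obtain rfl := h.left
  obtain rfl := h.right
  rw [h.eq]
  rfl

theorem SameCell.whiskerRight {X Y Z : B} (m : Y ⟶ Z) {f g f' g' : X ⟶ Y} {p : f ⟶ g}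
    {p' : f' ⟶ g'} (h : SameCell p p') : SameCell (p ▷ m) (p' ▷ m) := by
  obtain rfl := h.left
  obtain rfl := h.right
  rw [h.eq]
  rfl

theorem sameCell_whiskerLeft_whiskerRight [Bicategory.Strict B] {W X Y Z : B} (m : W ⟶ X)
    {f g : X ⟶ Y} (p : f ⟶ g) (n : Y ⟶ Z) : SameCell ((m ◁ p) ▷ n) (m ◁ p ▷ n) := by
  rw [whisker_assoc, Strict.associator_eqToIso, Strict.associator_eqToIso, eqToIso.hom,
    eqToIso.inv]
  exact sameCell_iff.2 ⟨by simp, by simp, by simp⟩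

theorem sameCell_whiskerRight_comp [Bicategory.Strict B] {X Y Z W : B} {f g : X ⟶ Y}
    (p : f ⟶ g) (m : Y ⟶ Z) (n : Z ⟶ W) : SameCell (p ▷ m ▷ n) (p ▷ (m ≫ n)) := by
  rw [whiskerRight_comp, Strict.associator_eqToIso, Strict.associator_eqToIso, eqToIso.hom,
    eqToIso.inv]
  exact sameCell_iff.2 ⟨by simp, by simp, by simp⟩

/-- The category `(B/Γ)(h, P)`: its objects are the 1-cells `k` with `k ≫ P = h`. -/
@[ext]
structure SliceHom {Γ Θ E : B} (h : Θ ⟶ Γ) (P : E ⟶ Γ) where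
  hom : Θ ⟶ E
  comm : hom ≫ P = h

/-- The arrows of `(B/Γ)(h, P)`: the 2-cells whose whiskering with `P` is the identity of `h`. -/
@[ext]
structure SliceHom.Hom {Γ Θ E : B} {h : Θ ⟶ Γ} {P : E ⟶ Γ} (k l : SliceHom h P) where
  cell : k.hom ⟶ l.hom
  vertical : SameCell (cell ▷ P) (𝟙 h)

instance {Γ Θ E : B} (h : Θ ⟶ Γ) (P : E ⟶ Γ) : Category (SliceHom h P) where
  Hom := SliceHom.Hom
  id k := ⟨𝟙 k.hom, by rw [id_whiskerRight, k.comm]; rfl⟩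
  comp p q := ⟨p.cell ≫ q.cell, by
    rw [comp_whiskerRight]
    simpa using p.vertical.comp q.vertical⟩
  id_comp _ := SliceHom.Hom.ext (Category.id_comp _)
  comp_id _ := SliceHom.Hom.ext (Category.comp_id _)
  assoc _ _ _ := SliceHom.Hom.ext (Category.assoc _ _ _)

variable [Bicategory.Strict B]

/-- Precomposition with `m`, as a functor `(B/Γ)(h, P) ⥤ (B/Γ)(h', P)`, where `h' = m ≫ h`. -/
def SliceHom.pre {Γ Θ Θ' E : B} {h : Θ ⟶ Γ} {h' : Θ' ⟶ Γ} (P : E ⟶ Γ) (m : Θ' ⟶ Θ)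
    (w : m ≫ h = h') : SliceHom h P ⥤ SliceHom h' P where
  obj k := ⟨m ≫ k.hom, by rw [Category.assoc, k.comm, w]⟩
  map p := ⟨m ◁ p.cell, by
    have := (sameCell_whiskerLeft_whiskerRight m p.cell P).trans (p.vertical.whiskerLeft m)
    rwa [whiskerLeft_id, w] at this⟩
  map_id _ := SliceHom.Hom.ext (whiskerLeft_id _ _)
  map_comp _ _ := SliceHom.Hom.ext (whiskerLeft_comp _ _ _)

end TwoCells

section Reindexing

variable {B : Type u} [Bicategory.{w, v} B]

/-- The 1-cell `k'` is a re-indexing of `k`: the square with sides `u` and `m` commutes. -/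
def Reindexes₁ {Θ Θ' E E' : B} (u : Θ' ⟶ Θ) (m : E' ⟶ E) (k' : Θ' ⟶ E') (k : Θ ⟶ E) : Prop :=
  k' ≫ m = u ≫ k

open Bicategory in
/-- The 2-cell `p'` is a re-indexing of `p`: the square with sides `u` and `m` commutes. -/
def Reindexes₂ {Θ Θ' E E' : B} (u : Θ' ⟶ Θ) (m : E' ⟶ E) {k' l' : Θ' ⟶ E'} {k l : Θ ⟶ E}
    (p' : k' ⟶ l') (p : k ⟶ l) : Prop :=
  SameCell (p' ▷ m) (u ◁ p)

end Reindexing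

namespace DisplayMapCategory

variable {C : Type u} [Category.{v} C] (𝒟 : DisplayMapCategory C)

/-- The telescopes in context `Γ`: the composable sequences of display maps of length `n ≥ 1`. -/
inductive Tele : C → Type (max u v)
  | one {Γ : C} (A : 𝒟.Ty Γ) : Tele Γ
  | cons {Γ : C} (A : 𝒟.Ty Γ) (T : Tele A.ext) : Tele Γ

namespace Tele

variable {𝒟}

/-- The context `Γ.A₁.….Aₙ`. -/
def ext {Γ : C} : 𝒟.Tele Γ → C
  | one A => A.ext
  | cons _ T => T.ext

/-- The composite of the display maps of a telescope. -/
def proj {Γ : C} : (T : 𝒟.Tele Γ) → (T.ext ⟶ Γ)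
  | one A => A.proj
  | cons A T => T.proj ≫ A.proj

/-- The re-indexed telescope `A₁[f].A₂[f.A₁].….Aₙ[f.A₁.….Aₙ₋₁]`. -/
def sub {Γ : C} : (T : 𝒟.Tele Γ) → {Δ : C} → (Δ ⟶ Γ) → 𝒟.Tele Δ
  | one A, _, f => one (𝒟.sub A f)
  | cons A T, _, f => cons (𝒟.sub A f) (T.sub (𝒟.lift A f))

/-- The arrow `f.A₁.….Aₙ`. -/
def lift {Γ : C} : (T : 𝒟.Tele Γ) → {Δ : C} → (f : Δ ⟶ Γ) → ((T.sub f).ext ⟶ T.ext)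
  | one A, _, f => 𝒟.lift A f
  | cons A T, _, f => T.lift (𝒟.lift A f)

end Tele

end DisplayMapCategory

open Bicategory in
/-- A split display map 2-category, on a strict 2-category `B` with invertible 2-cells. The data
`tr A g p` and `τ A g p` are the cloven isofibration structure of the display map of `A`. -/
structure DisplayMap2Category (B : Type u) [Bicategory.{w, v} B] [Bicategory.Strict B] extends
    DisplayMapCategory B where
  isIso : ∀ {X Y : B} {f g : X ⟶ Y} (p : f ⟶ g), IsIso p
  isTwoTerminal : ∀ (X : B) (f g : X ⟶ toDisplayMapCategory.ε), Nonempty (Unique (f ⟶ g))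
  isTwoPullback : ∀ {Γ Θ X : B} (A : DisplayMap D Γ) (f : Θ ⟶ Γ) (k l : X ⟶ (sub A f).ext)
    (σ : k ≫ (sub A f).proj ⟶ l ≫ (sub A f).proj) (ρ : k ≫ lift A f ⟶ l ≫ lift A f),
    SameCell (ρ ▷ A.proj) (σ ▷ f) →
      ∃! θ : k ⟶ l, θ ▷ (sub A f).proj = σ ∧ θ ▷ lift A f = ρ
  tr : ∀ {Γ X : B} (A : DisplayMap D Γ) (g : X ⟶ A.ext) {f : X ⟶ Γ} (_ : f ⟶ g ≫ A.proj),
    (X ⟶ A.ext)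
  τ : ∀ {Γ X : B} (A : DisplayMap D Γ) (g : X ⟶ A.ext) {f : X ⟶ Γ} (p : f ⟶ g ≫ A.proj),
    tr A g p ⟶ g
  tr_proj : ∀ {Γ X : B} (A : DisplayMap D Γ) (g : X ⟶ A.ext) {f : X ⟶ Γ}
    (p : f ⟶ g ≫ A.proj), tr A g p ≫ A.proj = f
  τ_proj : ∀ {Γ X : B} (A : DisplayMap D Γ) (g : X ⟶ A.ext) {f : X ⟶ Γ}
    (p : f ⟶ g ≫ A.proj), SameCell (τ A g p ▷ A.proj) p
  tr_comp : ∀ {Γ X Y : B} (A : DisplayMap D Γ) (g : X ⟶ A.ext) {f : X ⟶ Γ}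
    (p : f ⟶ g ≫ A.proj) (h : Y ⟶ X),
    tr A (h ≫ g) (h ◁ p ≫ (α_ h g A.proj).inv) = h ≫ tr A g p
  τ_comp : ∀ {Γ X Y : B} (A : DisplayMap D Γ) (g : X ⟶ A.ext) {f : X ⟶ Γ}
    (p : f ⟶ g ≫ A.proj) (h : Y ⟶ X),
    SameCell (τ A (h ≫ g) (h ◁ p ≫ (α_ h g A.proj).inv)) (h ◁ τ A g p)
  tr_sub : ∀ {Γ Θ Ω Ω' : B} (T : toDisplayMapCategory.Tele Γ) (M : DisplayMap D T.ext)
    (f : Θ ⟶ Γ) (f' : Ω' ⟶ Ω) {g : Ω ⟶ M.ext} {h : Ω ⟶ T.ext} (p : h ⟶ g ≫ M.proj)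
    {g' : Ω' ⟶ (sub M (T.lift f)).ext} {h' : Ω' ⟶ (T.sub f).ext}
    (p' : h' ⟶ g' ≫ (sub M (T.lift f)).proj),
    SameCell (p ▷ T.proj) (𝟙 (h ≫ T.proj)) →
    SameCell (p' ▷ (T.sub f).proj) (𝟙 (h' ≫ (T.sub f).proj)) →
    Reindexes₁ f' (lift M (T.lift f)) g' g → Reindexes₁ f' (T.lift f) h' h →
    Reindexes₂ f' (T.lift f) p' p →
    Reindexes₁ f' (lift M (T.lift f)) (tr (sub M (T.lift f)) g' p') (tr M g p)
  τ_sub : ∀ {Γ Θ Ω Ω' : B} (T : toDisplayMapCategory.Tele Γ) (M : DisplayMap D T.ext)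
    (f : Θ ⟶ Γ) (f' : Ω' ⟶ Ω) {g : Ω ⟶ M.ext} {h : Ω ⟶ T.ext} (p : h ⟶ g ≫ M.proj)
    {g' : Ω' ⟶ (sub M (T.lift f)).ext} {h' : Ω' ⟶ (T.sub f).ext}
    (p' : h' ⟶ g' ≫ (sub M (T.lift f)).proj),
    SameCell (p ▷ T.proj) (𝟙 (h ≫ T.proj)) →
    SameCell (p' ▷ (T.sub f).proj) (𝟙 (h' ≫ (T.sub f).proj)) →
    Reindexes₁ f' (lift M (T.lift f)) g' g → Reindexes₁ f' (T.lift f) h' h →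
    Reindexes₂ f' (T.lift f) p' p →
    Reindexes₂ f' (lift M (T.lift f)) (τ (sub M (T.lift f)) g' p') (τ M g p)

/-- A chosen pseudo-inverse of a functor, with the natural isomorphisms between the two
composites and the identities. -/
structure PseudoInverse {X Y : Type*} [Category* X] [Category* Y] (F : X ⥤ Y) where
  inv : Y ⥤ X
  β : inv ⋙ F ≅ 𝟭 Y
  η : 𝟭 X ≅ F ⋙ inv

namespace DisplayMap2Category

open Bicategory DisplayMapCategory

variable {B : Type u} [Bicategory.{w, v} B] [Bicategory.Strict B] (𝒟 : DisplayMap2Category B)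

/-- The types in context `Γ`. -/
abbrev Ty (Γ : B) : Type (max u v) := 𝒟.toDisplayMapCategory.Ty Γ

/-- The structure of axiomatic `=`-types on a display map 2-category: the 2-cell `α A`, over `Γ`,
is an arrow object of the display map of `A`. -/
structure AxiomaticId extends 𝒟.toDisplayMapCategory.IdFormer where
  α : ∀ {Γ : B} (A : 𝒟.Ty Γ),
    (Id A).proj ≫ (wk A).proj ⟶ (Id A).proj ≫ 𝒟.lift A A.proj
  α_vertical : ∀ {Γ : B} (A : 𝒟.Ty Γ),
    SameCell (α A ▷ A.proj) (𝟙 ((Id A).proj ≫ (wk A).proj ≫ A.proj))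
  factor : ∀ {Γ Θ : B} (A : 𝒟.Ty Γ) (h : Θ ⟶ Γ) (a b : SliceHom h A.proj) (p : a ⟶ b),
    ∃! u : Θ ⟶ (Id A).ext, SameCell (u ◁ α A) p.cell
  factor₂ : ∀ {Γ Θ : B} (A : 𝒟.Ty Γ) (h : Θ ⟶ Γ)
    (u v : SliceHom h ((Id A).proj ≫ (wk A).proj ≫ A.proj))
    (σ : u.hom ≫ (Id A).proj ≫ (wk A).proj ⟶ v.hom ≫ (Id A).proj ≫ (wk A).proj)
    (ρ : u.hom ≫ (Id A).proj ≫ 𝒟.lift A A.proj ⟶ v.hom ≫ (Id A).proj ≫ 𝒟.lift A A.proj),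
    SameCell (σ ▷ A.proj) (𝟙 h) → SameCell (ρ ▷ A.proj) (𝟙 h) →
    σ ≫ v.hom ◁ α A = u.hom ◁ α A ≫ ρ →
      ∃! θ : u ⟶ v, θ.cell ▷ ((Id A).proj ≫ (wk A).proj) = σ ∧
        θ.cell ▷ ((Id A).proj ≫ 𝒟.lift A A.proj) = ρ
  α_sub : ∀ {Γ Θ : B} {A : 𝒟.Ty Γ} {f : Θ ⟶ Γ} {A' : 𝒟.Ty Θ} (h : 𝒟.sub A f = A'),
    Reindexes₂ (𝒟.cart (Id_sub h)) (𝒟.cart h) (α A') (α A)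

/-- The structure of axiomatic `Σ`-types on a display map 2-category: an equivalence over `Γ`
between the composite of the display maps of `E` and `A` and the display map of `Sig A E`. -/
structure AxiomaticSigma extends 𝒟.toDisplayMapCategory.SigmaFormer where
  p : ∀ {Γ : B} (A : 𝒟.Ty Γ) (E : 𝒟.Ty A.ext), E.ext ⟶ (Sig A E).ext
  π : ∀ {Γ : B} (A : 𝒟.Ty Γ) (E : 𝒟.Ty A.ext), (Sig A E).ext ⟶ E.ext
  p_proj : ∀ {Γ : B} (A : 𝒟.Ty Γ) (E : 𝒟.Ty A.ext), p A E ≫ (Sig A E).proj = E.proj ≫ A.proj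
  π_proj : ∀ {Γ : B} (A : 𝒟.Ty Γ) (E : 𝒟.Ty A.ext), π A E ≫ E.proj ≫ A.proj = (Sig A E).proj
  η : ∀ {Γ : B} (A : 𝒟.Ty Γ) (E : 𝒟.Ty A.ext), 𝟙 (Sig A E).ext ⟶ π A E ≫ p A E
  β : ∀ {Γ : B} (A : 𝒟.Ty Γ) (E : 𝒟.Ty A.ext), p A E ≫ π A E ⟶ 𝟙 E.ext
  η_vertical : ∀ {Γ : B} (A : 𝒟.Ty Γ) (E : 𝒟.Ty A.ext),
    SameCell (η A E ▷ (Sig A E).proj) (𝟙 (Sig A E).proj)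
  β_vertical : ∀ {Γ : B} (A : 𝒟.Ty Γ) (E : 𝒟.Ty A.ext),
    SameCell (β A E ▷ (E.proj ≫ A.proj)) (𝟙 (E.proj ≫ A.proj))
  p_sub : ∀ {Γ Θ : B} {A : 𝒟.Ty Γ} {E : 𝒟.Ty A.ext} {f : Θ ⟶ Γ} {A' : 𝒟.Ty Θ}
    {E' : 𝒟.Ty A'.ext} (h : 𝒟.sub A f = A') (k : 𝒟.sub E (𝒟.cart h) = E'),
    Reindexes₁ (𝒟.cart k) (𝒟.cart (Sig_sub h k)) (p A' E') (p A E)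
  π_sub : ∀ {Γ Θ : B} {A : 𝒟.Ty Γ} {E : 𝒟.Ty A.ext} {f : Θ ⟶ Γ} {A' : 𝒟.Ty Θ}
    {E' : 𝒟.Ty A'.ext} (h : 𝒟.sub A f = A') (k : 𝒟.sub E (𝒟.cart h) = E'),
    Reindexes₁ (𝒟.cart (Sig_sub h k)) (𝒟.cart k) (π A' E') (π A E)
  η_sub : ∀ {Γ Θ : B} {A : 𝒟.Ty Γ} {E : 𝒟.Ty A.ext} {f : Θ ⟶ Γ} {A' : 𝒟.Ty Θ}
    {E' : 𝒟.Ty A'.ext} (h : 𝒟.sub A f = A') (k : 𝒟.sub E (𝒟.cart h) = E'),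
    Reindexes₂ (𝒟.cart (Sig_sub h k)) (𝒟.cart (Sig_sub h k)) (η A' E') (η A E)
  β_sub : ∀ {Γ Θ : B} {A : 𝒟.Ty Γ} {E : 𝒟.Ty A.ext} {f : Θ ⟶ Γ} {A' : 𝒟.Ty Θ}
    {E' : 𝒟.Ty A'.ext} (h : 𝒟.sub A f = A') (k : 𝒟.sub E (𝒟.cart h) = E'),
    Reindexes₂ (𝒟.cart k) (𝒟.cart k) (β A' E') (β A E)

/-- Precomposition with `g.A : Ω.A₂ ⟶ Θ.A₁`, where `A₁ = A[f]` and `A₂ = A₁[g]`. -/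
def preCart {Γ Θ Ω : B} {A : 𝒟.Ty Γ} {f : Θ ⟶ Γ} {A₁ : 𝒟.Ty Θ} {g : Ω ⟶ Θ} {A₂ : 𝒟.Ty Ω}
    (E : 𝒟.Ty A.ext) (h : 𝒟.sub A f = A₁) (h₁ : 𝒟.sub A₁ g = A₂) :
    SliceHom (𝒟.cart h) E.proj ⥤ SliceHom (𝒟.cart (𝒟.sub_trans h h₁)) E.proj :=
  SliceHom.pre E.proj (𝒟.cart h₁) (𝒟.cart_trans h h₁).symm

/-- The structure of axiomatic `Π`-types and axiomatic function extensionality on a display map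
2-category: an equivalence of categories `(B/Γ.A)(f.A, E) ≃ (B/Γ)(f, Pi A E)`, where
`h : A[f] = A₁`. The fields with suffix `nat` express the naturality with respect to
precomposition with an arrow `g`, those with suffix `sub` the one with respect to re-indexing
along `f`; there the arrow `k'` of the form `1;k` is given by the equation `k' ≫ f.A.E = k`. -/
structure AxiomaticPi extends 𝒟.toDisplayMapCategory.PiFormer where
  lam : ∀ {Γ Θ : B} (A : 𝒟.Ty Γ) (E : 𝒟.Ty A.ext) {f : Θ ⟶ Γ} {A₁ : 𝒟.Ty Θ}
    (h : 𝒟.sub A f = A₁), SliceHom (𝒟.cart h) E.proj ⥤ SliceHom f (Pi A E).proj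
  app : ∀ {Γ Θ : B} (A : 𝒟.Ty Γ) (E : 𝒟.Ty A.ext) {f : Θ ⟶ Γ} {A₁ : 𝒟.Ty Θ}
    (h : 𝒟.sub A f = A₁), SliceHom f (Pi A E).proj ⥤ SliceHom (𝒟.cart h) E.proj
  β : ∀ {Γ Θ : B} (A : 𝒟.Ty Γ) (E : 𝒟.Ty A.ext) {f : Θ ⟶ Γ} {A₁ : 𝒟.Ty Θ}
    (h : 𝒟.sub A f = A₁), lam A E h ⋙ app A E h ≅ 𝟭 (SliceHom (𝒟.cart h) E.proj)
  η : ∀ {Γ Θ : B} (A : 𝒟.Ty Γ) (E : 𝒟.Ty A.ext) {f : Θ ⟶ Γ} {A₁ : 𝒟.Ty Θ}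
    (h : 𝒟.sub A f = A₁), 𝟭 (SliceHom f (Pi A E).proj) ≅ app A E h ⋙ lam A E h
  lam_nat : ∀ {Γ Θ Ω : B} (A : 𝒟.Ty Γ) (E : 𝒟.Ty A.ext) {f : Θ ⟶ Γ} {A₁ : 𝒟.Ty Θ}
    (h : 𝒟.sub A f = A₁) {g : Ω ⟶ Θ} {A₂ : 𝒟.Ty Ω} (h₁ : 𝒟.sub A₁ g = A₂),
    𝒟.preCart E h h₁ ⋙ lam A E (𝒟.sub_trans h h₁) =
      lam A E h ⋙ SliceHom.pre (Pi A E).proj g rfl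
  app_nat : ∀ {Γ Θ Ω : B} (A : 𝒟.Ty Γ) (E : 𝒟.Ty A.ext) {f : Θ ⟶ Γ} {A₁ : 𝒟.Ty Θ}
    (h : 𝒟.sub A f = A₁) {g : Ω ⟶ Θ} {A₂ : 𝒟.Ty Ω} (h₁ : 𝒟.sub A₁ g = A₂),
    SliceHom.pre (Pi A E).proj g rfl ⋙ app A E (𝒟.sub_trans h h₁) =
      app A E h ⋙ 𝒟.preCart E h h₁
  β_nat : ∀ {Γ Θ Ω : B} (A : 𝒟.Ty Γ) (E : 𝒟.Ty A.ext) {f : Θ ⟶ Γ} {A₁ : 𝒟.Ty Θ}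
    (h : 𝒟.sub A f = A₁) {g : Ω ⟶ Θ} {A₂ : 𝒟.Ty Ω} (h₁ : 𝒟.sub A₁ g = A₂)
    (k : SliceHom (𝒟.cart h) E.proj),
    SameCell (𝒟.cart h₁ ◁ ((β A E h).hom.app k).cell)
      ((β A E (𝒟.sub_trans h h₁)).hom.app ((𝒟.preCart E h h₁).obj k)).cell
  η_nat : ∀ {Γ Θ Ω : B} (A : 𝒟.Ty Γ) (E : 𝒟.Ty A.ext) {f : Θ ⟶ Γ} {A₁ : 𝒟.Ty Θ}
    (h : 𝒟.sub A f = A₁) {g : Ω ⟶ Θ} {A₂ : 𝒟.Ty Ω} (h₁ : 𝒟.sub A₁ g = A₂)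
    (k : SliceHom f (Pi A E).proj),
    SameCell (g ◁ ((η A E h).hom.app k).cell)
      ((η A E (𝒟.sub_trans h h₁)).hom.app ((SliceHom.pre (Pi A E).proj g rfl).obj k)).cell
  lam_obj_sub : ∀ {Γ Θ : B} {A : 𝒟.Ty Γ} {E : 𝒟.Ty A.ext} {f : Θ ⟶ Γ} {A' : 𝒟.Ty Θ}
    {E' : 𝒟.Ty A'.ext} (h : 𝒟.sub A f = A') (hE : 𝒟.sub E (𝒟.cart h) = E')
    (k' : SliceHom (𝒟.cart (𝒟.sub_id A')) E'.proj) (k : SliceHom (𝒟.cart h) E.proj),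
    k'.hom ≫ 𝒟.cart hE = k.hom →
    ((lam A' E' (𝒟.sub_id A')).obj k').hom ≫ 𝒟.cart (Pi_sub h hE) = ((lam A E h).obj k).hom
  lam_map_sub : ∀ {Γ Θ : B} {A : 𝒟.Ty Γ} {E : 𝒟.Ty A.ext} {f : Θ ⟶ Γ} {A' : 𝒟.Ty Θ}
    {E' : 𝒟.Ty A'.ext} (h : 𝒟.sub A f = A') (hE : 𝒟.sub E (𝒟.cart h) = E')
    {k' l' : SliceHom (𝒟.cart (𝒟.sub_id A')) E'.proj} {k l : SliceHom (𝒟.cart h) E.proj}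
    (p' : k' ⟶ l') (p : k ⟶ l), SameCell (p'.cell ▷ 𝒟.cart hE) p.cell →
    SameCell (((lam A' E' (𝒟.sub_id A')).map p').cell ▷ 𝒟.cart (Pi_sub h hE))
      ((lam A E h).map p).cell
  app_obj_sub : ∀ {Γ Θ : B} {A : 𝒟.Ty Γ} {E : 𝒟.Ty A.ext} {f : Θ ⟶ Γ} {A' : 𝒟.Ty Θ}
    {E' : 𝒟.Ty A'.ext} (h : 𝒟.sub A f = A') (hE : 𝒟.sub E (𝒟.cart h) = E')
    (k' : SliceHom (𝟙 Θ) (Pi A' E').proj) (k : SliceHom f (Pi A E).proj),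
    k'.hom ≫ 𝒟.cart (Pi_sub h hE) = k.hom →
    ((app A' E' (𝒟.sub_id A')).obj k').hom ≫ 𝒟.cart hE = ((app A E h).obj k).hom
  app_map_sub : ∀ {Γ Θ : B} {A : 𝒟.Ty Γ} {E : 𝒟.Ty A.ext} {f : Θ ⟶ Γ} {A' : 𝒟.Ty Θ}
    {E' : 𝒟.Ty A'.ext} (h : 𝒟.sub A f = A') (hE : 𝒟.sub E (𝒟.cart h) = E')
    {k' l' : SliceHom (𝟙 Θ) (Pi A' E').proj} {k l : SliceHom f (Pi A E).proj}
    (p' : k' ⟶ l') (p : k ⟶ l), SameCell (p'.cell ▷ 𝒟.cart (Pi_sub h hE)) p.cell →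
    SameCell (((app A' E' (𝒟.sub_id A')).map p').cell ▷ 𝒟.cart hE) ((app A E h).map p).cell
  β_sub : ∀ {Γ Θ : B} {A : 𝒟.Ty Γ} {E : 𝒟.Ty A.ext} {f : Θ ⟶ Γ} {A' : 𝒟.Ty Θ}
    {E' : 𝒟.Ty A'.ext} (h : 𝒟.sub A f = A') (hE : 𝒟.sub E (𝒟.cart h) = E')
    (k' : SliceHom (𝒟.cart (𝒟.sub_id A')) E'.proj) (k : SliceHom (𝒟.cart h) E.proj),
    k'.hom ≫ 𝒟.cart hE = k.hom →
    SameCell (((β A' E' (𝒟.sub_id A')).hom.app k').cell ▷ 𝒟.cart hE)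
      ((β A E h).hom.app k).cell
  η_sub : ∀ {Γ Θ : B} {A : 𝒟.Ty Γ} {E : 𝒟.Ty A.ext} {f : Θ ⟶ Γ} {A' : 𝒟.Ty Θ}
    {E' : 𝒟.Ty A'.ext} (h : 𝒟.sub A f = A') (hE : 𝒟.sub E (𝒟.cart h) = E')
    (k' : SliceHom (𝟙 Θ) (Pi A' E').proj) (k : SliceHom f (Pi A E).proj),
    k'.hom ≫ 𝒟.cart (Pi_sub h hE) = k.hom →
    SameCell (((η A' E' (𝒟.sub_id A')).hom.app k').cell ▷ 𝒟.cart (Pi_sub h hE))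
      ((η A E h).hom.app k).cell

/-- The category `(B/Γ)(1_Γ, A)` of sections of the display map of `A`. -/
abbrev Sect {Γ : B} (A : 𝒟.Ty Γ) : Type _ := SliceHom (𝟙 Γ) A.proj

variable {𝒟} in
/-- Precomposition of the sections of `M` with an arrow `a`. -/
def evalAt {Γ Θ : B} (M : 𝒟.Ty Γ) (a : Θ ⟶ Γ) : 𝒟.Sect M ⥤ SliceHom a M.proj :=
  SliceHom.pre M.proj a (Category.comp_id a)

/-- The structure of axiomatic `0`-types on a display map 2-category. -/
structure AxiomaticEmpty extends 𝒟.toDisplayMapCategory.EmptyFormer where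
  ind : ∀ {Γ : B} (M : 𝒟.Ty (T Γ).ext), PseudoInverse (Functor.star.{0} (𝒟.Sect M))
  ind_sub : ∀ {Γ Θ : B} (f : Θ ⟶ Γ) {M : 𝒟.Ty (T Γ).ext} {M' : 𝒟.Ty (T Θ).ext}
    (k : 𝒟.sub M (𝒟.cart (T_sub f)) = M'),
    Reindexes₁ (𝒟.cart (T_sub f)) (𝒟.cart k) ((ind M').inv.obj ⟨⟨⟩⟩).hom
      ((ind M).inv.obj ⟨⟨⟩⟩).hom
  η_sub : ∀ {Γ Θ : B} (f : Θ ⟶ Γ) {M : 𝒟.Ty (T Γ).ext} {M' : 𝒟.Ty (T Θ).ext}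
    (k : 𝒟.sub M (𝒟.cart (T_sub f)) = M') (a' : 𝒟.Sect M') (a : 𝒟.Sect M),
    Reindexes₁ (𝒟.cart (T_sub f)) (𝒟.cart k) a'.hom a.hom →
    Reindexes₂ (𝒟.cart (T_sub f)) (𝒟.cart k) ((ind M').η.hom.app a').cell
      ((ind M).η.hom.app a).cell

/-- The structure of axiomatic `1`-types on a display map 2-category. -/
structure AxiomaticUnit extends 𝒟.toDisplayMapCategory.UnitFormer where
  ind : ∀ {Γ : B} (M : 𝒟.Ty (T Γ).ext), PseudoInverse (evalAt M (star Γ).hom)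
  ind_obj_sub : ∀ {Γ Θ : B} (f : Θ ⟶ Γ) {M : 𝒟.Ty (T Γ).ext} {M' : 𝒟.Ty (T Θ).ext}
    (k : 𝒟.sub M (𝒟.cart (T_sub f)) = M') (c' : SliceHom (star Θ).hom M'.proj)
    (c : SliceHom (star Γ).hom M.proj), Reindexes₁ f (𝒟.cart k) c'.hom c.hom →
    Reindexes₁ (𝒟.cart (T_sub f)) (𝒟.cart k) ((ind M').inv.obj c').hom
      ((ind M).inv.obj c).hom
  ind_map_sub : ∀ {Γ Θ : B} (f : Θ ⟶ Γ) {M : 𝒟.Ty (T Γ).ext} {M' : 𝒟.Ty (T Θ).ext}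
    (k : 𝒟.sub M (𝒟.cart (T_sub f)) = M') {c' d' : SliceHom (star Θ).hom M'.proj}
    {c d : SliceHom (star Γ).hom M.proj} (p' : c' ⟶ d') (p : c ⟶ d),
    Reindexes₁ f (𝒟.cart k) c'.hom c.hom → Reindexes₁ f (𝒟.cart k) d'.hom d.hom →
    Reindexes₂ f (𝒟.cart k) p'.cell p.cell →
    Reindexes₂ (𝒟.cart (T_sub f)) (𝒟.cart k) ((ind M').inv.map p').cell
      ((ind M).inv.map p).cell
  β_sub : ∀ {Γ Θ : B} (f : Θ ⟶ Γ) {M : 𝒟.Ty (T Γ).ext} {M' : 𝒟.Ty (T Θ).ext}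
    (k : 𝒟.sub M (𝒟.cart (T_sub f)) = M') (c' : SliceHom (star Θ).hom M'.proj)
    (c : SliceHom (star Γ).hom M.proj), Reindexes₁ f (𝒟.cart k) c'.hom c.hom →
    Reindexes₂ f (𝒟.cart k) ((ind M').β.hom.app c').cell ((ind M).β.hom.app c).cell
  η_sub : ∀ {Γ Θ : B} (f : Θ ⟶ Γ) {M : 𝒟.Ty (T Γ).ext} {M' : 𝒟.Ty (T Θ).ext}
    (k : 𝒟.sub M (𝒟.cart (T_sub f)) = M') (a' : 𝒟.Sect M') (a : 𝒟.Sect M),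
    Reindexes₁ (𝒟.cart (T_sub f)) (𝒟.cart k) a'.hom a.hom →
    Reindexes₂ (𝒟.cart (T_sub f)) (𝒟.cart k) ((ind M').η.hom.app a').cell
      ((ind M).η.hom.app a).cell

/-- The structure of axiomatic `2`-types on a display map 2-category. -/
structure AxiomaticBool extends 𝒟.toDisplayMapCategory.BoolFormer where
  ind : ∀ {Γ : B} (M : 𝒟.Ty (T Γ).ext),
    PseudoInverse ((evalAt M (bot Γ).hom).prod' (evalAt M (top Γ).hom))
  ind_obj_sub : ∀ {Γ Θ : B} (f : Θ ⟶ Γ) {M : 𝒟.Ty (T Γ).ext} {M' : 𝒟.Ty (T Θ).ext}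
    (k : 𝒟.sub M (𝒟.cart (T_sub f)) = M')
    (c' : SliceHom (bot Θ).hom M'.proj × SliceHom (top Θ).hom M'.proj)
    (c : SliceHom (bot Γ).hom M.proj × SliceHom (top Γ).hom M.proj),
    Reindexes₁ f (𝒟.cart k) c'.1.hom c.1.hom → Reindexes₁ f (𝒟.cart k) c'.2.hom c.2.hom →
    Reindexes₁ (𝒟.cart (T_sub f)) (𝒟.cart k) ((ind M').inv.obj c').hom
      ((ind M).inv.obj c).hom
  ind_map_sub : ∀ {Γ Θ : B} (f : Θ ⟶ Γ) {M : 𝒟.Ty (T Γ).ext} {M' : 𝒟.Ty (T Θ).ext}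
    (k : 𝒟.sub M (𝒟.cart (T_sub f)) = M')
    {c' d' : SliceHom (bot Θ).hom M'.proj × SliceHom (top Θ).hom M'.proj}
    {c d : SliceHom (bot Γ).hom M.proj × SliceHom (top Γ).hom M.proj}
    (p' : c' ⟶ d') (p : c ⟶ d),
    Reindexes₁ f (𝒟.cart k) c'.1.hom c.1.hom → Reindexes₁ f (𝒟.cart k) c'.2.hom c.2.hom →
    Reindexes₁ f (𝒟.cart k) d'.1.hom d.1.hom → Reindexes₁ f (𝒟.cart k) d'.2.hom d.2.hom →
    Reindexes₂ f (𝒟.cart k) p'.1.cell p.1.cell → Reindexes₂ f (𝒟.cart k) p'.2.cell p.2.cell →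
    Reindexes₂ (𝒟.cart (T_sub f)) (𝒟.cart k) ((ind M').inv.map p').cell
      ((ind M).inv.map p).cell
  β_sub : ∀ {Γ Θ : B} (f : Θ ⟶ Γ) {M : 𝒟.Ty (T Γ).ext} {M' : 𝒟.Ty (T Θ).ext}
    (k : 𝒟.sub M (𝒟.cart (T_sub f)) = M')
    (c' : SliceHom (bot Θ).hom M'.proj × SliceHom (top Θ).hom M'.proj)
    (c : SliceHom (bot Γ).hom M.proj × SliceHom (top Γ).hom M.proj),
    Reindexes₁ f (𝒟.cart k) c'.1.hom c.1.hom → Reindexes₁ f (𝒟.cart k) c'.2.hom c.2.hom →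
    Reindexes₂ f (𝒟.cart k) ((ind M').β.hom.app c').1.cell ((ind M).β.hom.app c).1.cell ∧
      Reindexes₂ f (𝒟.cart k) ((ind M').β.hom.app c').2.cell ((ind M).β.hom.app c).2.cell
  η_sub : ∀ {Γ Θ : B} (f : Θ ⟶ Γ) {M : 𝒟.Ty (T Γ).ext} {M' : 𝒟.Ty (T Θ).ext}
    (k : 𝒟.sub M (𝒟.cart (T_sub f)) = M') (a' : 𝒟.Sect M') (a : 𝒟.Sect M),
    Reindexes₁ (𝒟.cart (T_sub f)) (𝒟.cart k) a'.hom a.hom →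
    Reindexes₂ (𝒟.cart (T_sub f)) (𝒟.cart k) ((ind M').η.hom.app a').cell
      ((ind M).η.hom.app a).cell

/-- A choice of types of natural numbers, stable under re-indexing, with the successor given as
an arrow `s` over `Γ`. -/
structure NatData where
  N : ∀ Γ : B, 𝒟.Ty Γ
  zero : ∀ Γ : B, Tm (N Γ)
  s : ∀ Γ : B, (N Γ).ext ⟶ (N Γ).ext
  s_proj : ∀ Γ : B, s Γ ≫ (N Γ).proj = (N Γ).proj
  N_sub : ∀ {Γ Θ : B} (f : Θ ⟶ Γ), 𝒟.sub (N Γ) f = N Θ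
  zero_sub : ∀ {Γ Θ : B} (f : Θ ⟶ Γ), (zero Γ).subst (N_sub f) = zero Θ
  s_sub : ∀ {Γ Θ : B} (f : Θ ⟶ Γ), Reindexes₁ (𝒟.cart (N_sub f)) (𝒟.cart (N_sub f)) (s Θ) (s Γ)

namespace NatData

variable {𝒟} (𝒩 : 𝒟.NatData)

/-- The same data, with the successor given as the term of type `N` in context `N` with
underlying arrow `s`. -/
noncomputable def toNatFormer : 𝒟.toDisplayMapCategory.NatFormer where
  N := 𝒩.N
  zero := 𝒩.zero
  succ Γ := Tm.ofArrow (𝒩.s Γ) (𝒩.s_proj Γ)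
  N_sub := 𝒩.N_sub
  zero_sub := 𝒩.zero_sub
  succ_sub {Γ Θ} f := by
    refine Tm.ext ((𝒟.isPullback (𝒩.N Θ) (𝒩.N Θ).proj).hom_ext
      (𝒟.cart_hom_ext (𝒩.N_sub f) ?_ ?_) ?_)
    · refine (Tm.arrow_square (𝒟.cart_proj (𝒩.N_sub f)).symm (𝒩.N_sub f)
        (Tm.ofArrow (𝒩.s Γ) (𝒩.s_proj Γ))).trans ?_
      rw [Tm.ofArrow_arrow]
      refine (𝒩.s_sub f).symm.trans ?_
      exact congrArg (· ≫ 𝒟.cart (𝒩.N_sub f)) (Tm.ofArrow_arrow (𝒩.s Θ) (𝒩.s_proj Θ)).symm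
    · exact (Tm.arrow_proj _).trans (Tm.arrow_proj _).symm
    · rw [Tm.hom_proj, Tm.hom_proj]

/-- For a type `M` over `Γ.N` with an arrow `c` over zero and an arrow `d` over the successor: a
section `k` of `M` with 2-cells from `k(0)` to `c` and, in context `n : N`, from `k(s(n))` to
`d(n, k(n))`. -/
structure Alg {Γ : B} (M : 𝒟.Ty (𝒩.N Γ).ext) (c : SliceHom (𝒩.zero Γ).hom M.proj)
    (d : SliceHom (M.proj ≫ 𝒩.s Γ) M.proj) where
  sec : 𝒟.Sect M
  atZero : (evalAt M (𝒩.zero Γ).hom).obj sec ⟶ c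
  atSucc : (evalAt M (𝒩.s Γ)).obj sec ⟶ (SliceHom.pre M.proj sec.hom
    (by rw [← Category.assoc, sec.comm, Category.id_comp])).obj d

/-- A 2-cell between the underlying sections is a morphism if it commutes with the 2-cells over
zero and over the successor. -/
def Alg.IsHom {Γ : B} {M : 𝒟.Ty (𝒩.N Γ).ext} {c : SliceHom (𝒩.zero Γ).hom M.proj}
    {d : SliceHom (M.proj ≫ 𝒩.s Γ) M.proj} (X Y : 𝒩.Alg M c d) (p : X.sec ⟶ Y.sec) : Prop :=
  (𝒩.zero Γ).hom ◁ p.cell ≫ Y.atZero.cell = X.atZero.cell ∧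
    𝒩.s Γ ◁ p.cell ≫ Y.atSucc.cell = X.atSucc.cell ≫ p.cell ▷ d.hom

end NatData

/-- The structure of axiomatic natural numbers types on a display map 2-category. -/
structure AxiomaticNat extends 𝒟.NatData where
  ind : ∀ {Γ : B} (M : 𝒟.Ty (N Γ).ext) (c : SliceHom (zero Γ).hom M.proj)
    (d : SliceHom (M.proj ≫ s Γ) M.proj), toNatData.Alg M c d
  ind_unique : ∀ {Γ : B} (M : 𝒟.Ty (N Γ).ext) (c : SliceHom (zero Γ).hom M.proj)
    (d : SliceHom (M.proj ≫ s Γ) M.proj) (X : toNatData.Alg M c d),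
    ∃! p : X.sec ⟶ (ind M c d).sec, NatData.Alg.IsHom toNatData X (ind M c d) p
  sec_sub : ∀ {Γ Θ : B} (f : Θ ⟶ Γ) {M : 𝒟.Ty (N Γ).ext} {M' : 𝒟.Ty (N Θ).ext}
    (k : 𝒟.sub M (𝒟.cart (N_sub f)) = M')
    (c' : SliceHom (zero Θ).hom M'.proj) (c : SliceHom (zero Γ).hom M.proj)
    (d' : SliceHom (M'.proj ≫ s Θ) M'.proj) (d : SliceHom (M.proj ≫ s Γ) M.proj),
    Reindexes₁ f (𝒟.cart k) c'.hom c.hom → Reindexes₁ (𝒟.cart k) (𝒟.cart k) d'.hom d.hom →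
    Reindexes₁ (𝒟.cart (N_sub f)) (𝒟.cart k) (ind M' c' d').sec.hom (ind M c d).sec.hom
  atZero_sub : ∀ {Γ Θ : B} (f : Θ ⟶ Γ) {M : 𝒟.Ty (N Γ).ext} {M' : 𝒟.Ty (N Θ).ext}
    (k : 𝒟.sub M (𝒟.cart (N_sub f)) = M')
    (c' : SliceHom (zero Θ).hom M'.proj) (c : SliceHom (zero Γ).hom M.proj)
    (d' : SliceHom (M'.proj ≫ s Θ) M'.proj) (d : SliceHom (M.proj ≫ s Γ) M.proj),
    Reindexes₁ f (𝒟.cart k) c'.hom c.hom → Reindexes₁ (𝒟.cart k) (𝒟.cart k) d'.hom d.hom →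
    Reindexes₂ f (𝒟.cart k) (ind M' c' d').atZero.cell (ind M c d).atZero.cell
  atSucc_sub : ∀ {Γ Θ : B} (f : Θ ⟶ Γ) {M : 𝒟.Ty (N Γ).ext} {M' : 𝒟.Ty (N Θ).ext}
    (k : 𝒟.sub M (𝒟.cart (N_sub f)) = M')
    (c' : SliceHom (zero Θ).hom M'.proj) (c : SliceHom (zero Γ).hom M.proj)
    (d' : SliceHom (M'.proj ≫ s Θ) M'.proj) (d : SliceHom (M.proj ≫ s Γ) M.proj),
    Reindexes₁ f (𝒟.cart k) c'.hom c.hom → Reindexes₁ (𝒟.cart k) (𝒟.cart k) d'.hom d.hom →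
    Reindexes₂ (𝒟.cart (N_sub f)) (𝒟.cart k) (ind M' c' d').atSucc.cell
      (ind M c d).atSucc.cell

end DisplayMap2Category

/-! The arrow-object property of `α` makes terms of `Id_A[a;b]` the same thing as vertical 2-cells
between the sections `a` and `b` (`ofCell`, `cell`). So every propositional computation rule amounts
to producing a vertical 2-cell. Eliminators come from the 2-dimensional data, or from transport
along a 2-cell using the cloven isofibration structure.

For identity types, `rArrow` classifies the identity 2-cell and serves as reflexivity. The type of
identities contracts onto reflexivities by a 2-cell `contraction` from the identity to `src`
followed by `rArrow`. Given `c` over reflexivity, `J` is the transport of `src ≫ c` along this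
contraction. Because the contraction restricts to an identity along `rArrow`, the transporting
2-cell restricted along `rArrow` is vertical and gives `H`.

For `Σ`, `split` is the transport of `π ≫ c` along `η`. Its computation 2-cell combines the
transporting 2-cell with the counit, and is vertical only if a triangle identity holds; hence `β` is
first replaced by an adjoint counit (`counit`). For `0`, `1`, `2` and `ℕ` the chosen sections and
2-cells are used directly.

For `Π`, evaluation is `app` at the identity of `Γ.Π`, abstraction is `lam`, and `β` is the given
2-cell. Function extensionality uses that `app` is fully faithful, so a 2-cell between applications
comes from a unique 2-cell between functions (`unapp`). What has to be proved is that the syntactic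
`happly`, defined by `J`, is the action of `app` on 2-cells (`app_happly`, `app_happlyAt`). This
relies on identity types being discrete: terms of an identity type that are propositionally equal
are equal (`eq_of_term`), so `J` and the `β` rule for `Π` can be used to prove strict equations
between such terms.

Stability follows from uniqueness. The chosen transports are stable by the isofibration axioms for
telescopes of length one (`tr_sub_one`) and three (`tr_sub_three`). Terms classifying 2-cells are
stable as soon as the 2-cells are, because classification is unique (`ofCell_subst`,
`ofSlice_subst`). -/

section SameCellLemmas

open Bicategory

variable {B : Type u} [Bicategory.{w, v} B]

/-! ### Calculus of 2-cells up to equality of their boundaries, and of re-indexed 2-cells. -/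

theorem SameCell.refl {X Y : B} {f g : X ⟶ Y} (p : f ⟶ g) : SameCell p p := rfl

theorem SameCell.symm {X Y : B} {f g f' g' : X ⟶ Y} {p : f ⟶ g} {q : f' ⟶ g'}
    (h : SameCell p q) : SameCell q p :=
  Eq.symm h

theorem SameCell.of_eq {X Y : B} {f g : X ⟶ Y} {p q : f ⟶ g} (h : p = q) : SameCell p q :=
  congrArg Arrow.mk h

theorem sameCell_id {X Y : B} {f g : X ⟶ Y} (h : f = g) : SameCell (𝟙 f) (𝟙 g) := by
  subst h
  rfl

theorem sameCell_eqToHom {X Y : B} {f g : X ⟶ Y} (h : f = g) : SameCell (eqToHom h) (𝟙 f) := by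
  subst h
  rfl

theorem sameCell_eqToHom_comp {X Y : B} {f g k : X ⟶ Y} (h : f = g) (p : g ⟶ k) :
    SameCell (eqToHom h ≫ p) p := by
  subst h
  exact .of_eq (Category.id_comp p)

theorem sameCell_comp_eqToHom {X Y : B} {f g k : X ⟶ Y} (p : f ⟶ g) (h : g = k) :
    SameCell (p ≫ eqToHom h) p := by
  subst h
  exact .of_eq (Category.comp_id p)

/-- A 2-cell with its boundary replaced by an equal one. -/
def castCell {X Y : B} {f g f' g' : X ⟶ Y} (hf : f = f') (hg : g = g') (p : f ⟶ g) : f' ⟶ g' :=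
  eqToHom hf.symm ≫ p ≫ eqToHom hg

theorem sameCell_castCell {X Y : B} {f g f' g' : X ⟶ Y} (hf : f = f') (hg : g = g')
    (p : f ⟶ g) : SameCell (castCell hf hg p) p :=
  (sameCell_eqToHom_comp _ _).trans (sameCell_comp_eqToHom _ _)

/-- The identity in the hypothesis sits on an independent 1-cell `z`, so a factor that is an
identity only after rewriting its boundary can be dropped without casts. -/
theorem SameCell.comp_id {X Y : B} {f g k x y z : X ⟶ Y} {p : f ⟶ g} {q : g ⟶ k} {r : x ⟶ y}
    (h : SameCell p r) (h' : SameCell q (𝟙 z)) : SameCell (p ≫ q) r := by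
  obtain rfl := h.left
  obtain rfl := h.right
  obtain rfl := h'.left
  obtain rfl := h'.right
  rw [h.eq, h'.eq, Category.comp_id]
  rfl

theorem SameCell.id_comp {X Y : B} {f g k x y z : X ⟶ Y} {p : f ⟶ g} {q : g ⟶ k} {r : x ⟶ y}
    (h : SameCell p (𝟙 z)) (h' : SameCell q r) : SameCell (p ≫ q) r := by
  obtain rfl := h.left
  obtain rfl := h.right
  obtain rfl := h'.left
  obtain rfl := h'.right
  rw [h.eq, h'.eq, Category.id_comp]
  rfl

theorem SameCell.inv {X Y : B} {f g f' g' : X ⟶ Y} {p : f ⟶ g} {q : f' ⟶ g'} [IsIso p]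
    [IsIso q] (h : SameCell p q) : SameCell (inv p) (inv q) := by
  obtain rfl := h.left
  obtain rfl := h.right
  exact .of_eq (by simp only [h.eq])

theorem SameCell.inv_id {X Y : B} {f g z : X ⟶ Y} {p : f ⟶ g} [IsIso p]
    (h : SameCell p (𝟙 z)) : SameCell (CategoryTheory.inv p) (𝟙 z) := by
  simpa using h.inv

theorem sameCell_whiskerLeft_congr {X Y Z : B} {m n : X ⟶ Y} (e : m = n) {f g : Y ⟶ Z}
    (p : f ⟶ g) : SameCell (m ◁ p) (n ◁ p) := by
  subst e
  rfl

theorem sameCell_whiskerRight_congr {X Y Z : B} {m n : Y ⟶ Z} (e : m = n) {f g : X ⟶ Y}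
    (p : f ⟶ g) : SameCell (p ▷ m) (p ▷ n) := by
  subst e
  rfl

theorem SameCell.whiskerLeft_id {X Y Z : B} (m : X ⟶ Y) {f g z : Y ⟶ Z} {p : f ⟶ g}
    (h : SameCell p (𝟙 z)) : SameCell (m ◁ p) (𝟙 (m ≫ z)) := by
  simpa using h.whiskerLeft m

theorem SameCell.whiskerRight_id {X Y Z : B} (m : Y ⟶ Z) {f g z : X ⟶ Y} {p : f ⟶ g}
    (h : SameCell p (𝟙 z)) : SameCell (p ▷ m) (𝟙 (z ≫ m)) := by
  simpa using h.whiskerRight m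

variable [Bicategory.Strict B]

/-- In a strict bicategory the associators of the whiskering law are `eqToHom`s, which `SameCell`
absorbs. -/
theorem sameCell_comp_whiskerLeft {X Y Z W : B} (m : X ⟶ Y) (n : Y ⟶ Z) {f g : Z ⟶ W}
    (p : f ⟶ g) : SameCell ((m ≫ n) ◁ p) (m ◁ n ◁ p) := by
  rw [comp_whiskerLeft, Strict.associator_eqToIso, Strict.associator_eqToIso, eqToIso.hom,
    eqToIso.inv]
  exact sameCell_iff.2 ⟨by simp, by simp, by simp⟩

theorem sameCell_id_whiskerLeft {X Y : B} {f g : X ⟶ Y} (p : f ⟶ g) :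
    SameCell (𝟙 X ◁ p) p := by
  rw [id_whiskerLeft, Strict.leftUnitor_eqToIso, Strict.leftUnitor_eqToIso, eqToIso.hom,
    eqToIso.inv]
  exact sameCell_iff.2 ⟨by simp, by simp, by simp⟩

theorem sameCell_whiskerRight_id {X Y : B} {f g : X ⟶ Y} (p : f ⟶ g) :
    SameCell (p ▷ 𝟙 Y) p := by
  rw [Bicategory.whiskerRight_id, Strict.rightUnitor_eqToIso, Strict.rightUnitor_eqToIso,
    eqToIso.hom, eqToIso.inv]
  exact sameCell_iff.2 ⟨by simp, by simp, by simp⟩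

/-- Whiskering a re-indexed 2-cell along a commutative square. -/
theorem Reindexes₂.whiskerRight {Θ Θ' E E' F F' : B} {u : Θ' ⟶ Θ} {m : E' ⟶ E} {k' l' : Θ' ⟶ E'}
    {k l : Θ ⟶ E} {p' : k' ⟶ l'} {p : k ⟶ l} (h : Reindexes₂ u m p' p) {x' : E' ⟶ F'} {x : E ⟶ F}
    {n : F' ⟶ F} (sq : x' ≫ n = m ≫ x) : Reindexes₂ u n (p' ▷ x') (p ▷ x) :=
  (sameCell_whiskerRight_comp _ _ _).trans <| (sameCell_whiskerRight_congr sq _).trans <|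
    (sameCell_whiskerRight_comp _ _ _).symm.trans <| (SameCell.whiskerRight x h).trans
      (sameCell_whiskerLeft_whiskerRight _ _ _)

theorem Reindexes₂.whiskerLeft {Ω Ω' Θ Θ' E E' : B} {u : Θ' ⟶ Θ} {m : E' ⟶ E} {k' l' : Θ' ⟶ E'}
    {k l : Θ ⟶ E} {p' : k' ⟶ l'} {p : k ⟶ l} (h : Reindexes₂ u m p' p) {x' : Ω' ⟶ Θ'} {x : Ω ⟶ Θ}
    {n : Ω' ⟶ Ω} (sq : x' ≫ u = n ≫ x) : Reindexes₂ n m (x' ◁ p') (x ◁ p) :=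
  (sameCell_whiskerLeft_whiskerRight _ _ _).trans <| (SameCell.whiskerLeft x' h).trans <|
    (sameCell_comp_whiskerLeft _ _ _).symm.trans <| (sameCell_whiskerLeft_congr sq _).trans
      (sameCell_comp_whiskerLeft _ _ _)

theorem Reindexes₂.congr {Θ Θ' E E' : B} {u : Θ' ⟶ Θ} {m : E' ⟶ E} {k' l' x' y' : Θ' ⟶ E'}
    {k l x y : Θ ⟶ E} {p' : k' ⟶ l'} {p : k ⟶ l} {q' : x' ⟶ y'} {q : x ⟶ y}
    (h : Reindexes₂ u m p' p) (e' : SameCell q' p') (e : SameCell q p) : Reindexes₂ u m q' q :=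
  (SameCell.whiskerRight m e').trans (SameCell.trans h (SameCell.whiskerLeft u e).symm)

theorem Reindexes₂.comp {Θ Θ' E E' : B} {u : Θ' ⟶ Θ} {m : E' ⟶ E} {k' l' j' : Θ' ⟶ E'}
    {k l j : Θ ⟶ E} {p' : k' ⟶ l'} {p : k ⟶ l} {q' : l' ⟶ j'} {q : l ⟶ j}
    (h : Reindexes₂ u m p' p) (hq : Reindexes₂ u m q' q) :
    Reindexes₂ u m (p' ≫ q') (p ≫ q) := by
  unfold Reindexes₂
  rw [comp_whiskerRight, Bicategory.whiskerLeft_comp]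
  exact SameCell.comp h hq

theorem Reindexes₂.inv {Θ Θ' E E' : B} {u : Θ' ⟶ Θ} {m : E' ⟶ E} {k' l' : Θ' ⟶ E'}
    {k l : Θ ⟶ E} {p' : k' ⟶ l'} {p : k ⟶ l} [IsIso p'] [IsIso p]
    (h : Reindexes₂ u m p' p) : Reindexes₂ u m (CategoryTheory.inv p') (CategoryTheory.inv p) := by
  unfold Reindexes₂
  rw [← inv_whiskerRight, ← inv_whiskerLeft]
  exact SameCell.inv h

theorem Reindexes₂.id {Θ Θ' E E' : B} {u : Θ' ⟶ Θ} {m : E' ⟶ E} {k' : Θ' ⟶ E'} {k : Θ ⟶ E}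
    (h : Reindexes₁ u m k' k) : Reindexes₂ u m (𝟙 k') (𝟙 k) := by
  unfold Reindexes₂
  rw [Bicategory.id_whiskerRight, Bicategory.whiskerLeft_id]
  exact sameCell_id h

end SameCellLemmas

/-! ### Two-dimensional pullbacks, stability of transport, and terms as sections. -/

namespace DisplayMap2Category

open Bicategory DisplayMapCategory

variable {B : Type u} [Bicategory.{w, v} B] [Bicategory.Strict B] {𝒟 : DisplayMap2Category B}

theorem cart_existsUnique_cell {Γ Θ X : B} {A : 𝒟.Ty Γ} {f : Θ ⟶ Γ} {A' : 𝒟.Ty Θ}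
    (h : 𝒟.sub A f = A') (k l : X ⟶ A'.ext) (σ : k ≫ A'.proj ⟶ l ≫ A'.proj)
    (ρ : k ≫ 𝒟.cart h ⟶ l ≫ 𝒟.cart h) (e : SameCell (ρ ▷ A.proj) (σ ▷ f)) :
    ∃! θ : k ⟶ l, θ ▷ A'.proj = σ ∧ θ ▷ 𝒟.cart h = ρ := by
  subst h
  -- `cart` of a reflexivity proof equals `lift` only propositionally; making it a variable first
  -- allows the replacement in all dependent types at once.
  generalize hc : 𝒟.cart (rfl : 𝒟.sub A f = 𝒟.sub A f) = c at *
  obtain rfl := hc.symm.trans (𝒟.cart_rfl A f)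
  exact 𝒟.isTwoPullback A f k l σ ρ e

/-- Uniqueness in the 2-pullback: the two projections jointly detect 2-cells, and the 1-dimensional
pullback identifies the boundaries. This is how 2-cells in a re-indexed type are compared below. -/
theorem sameCell_of_cart {Γ Θ X : B} {A : 𝒟.Ty Γ} {f : Θ ⟶ Γ} {A' : 𝒟.Ty Θ}
    (h : 𝒟.sub A f = A') {k l k' l' : X ⟶ A'.ext} {p : k ⟶ l} {q : k' ⟶ l'}
    (h₁ : SameCell (p ▷ A'.proj) (q ▷ A'.proj))
    (h₂ : SameCell (p ▷ 𝒟.cart h) (q ▷ 𝒟.cart h)) : SameCell p q := by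
  obtain rfl : k = k' := 𝒟.cart_hom_ext h h₂.left h₁.left
  obtain rfl : l = l' := 𝒟.cart_hom_ext h h₂.right h₁.right
  refine .of_eq ((𝒟.cart_existsUnique_cell h k l (q ▷ A'.proj) (q ▷ 𝒟.cart h) ?_).unique
    ⟨h₁.eq, h₂.eq⟩ ⟨rfl, rfl⟩)
  exact (sameCell_whiskerRight_comp _ _ _).trans <|
    (sameCell_whiskerRight_congr (𝒟.cart_proj h) _).trans
      (sameCell_whiskerRight_comp _ _ _).symm

/-- Vertical 2-cells between arrows into `A[f]` over `g` are vertical 2-cells between the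
induced arrows into `A`. -/
theorem exists_sliceHom_cart {Γ Θ X : B} {A : 𝒟.Ty Γ} {f : Θ ⟶ Γ} {A' : 𝒟.Ty Θ}
    (h : 𝒟.sub A f = A') {g : X ⟶ Θ} {k l : SliceHom g A'.proj} {g' : X ⟶ Γ}
    {x y : SliceHom g' A.proj} (hk : k.hom ≫ 𝒟.cart h = x.hom)
    (hl : l.hom ≫ 𝒟.cart h = y.hom) (p : x ⟶ y) :
    ∃ θ : k ⟶ l, SameCell (θ.cell ▷ 𝒟.cart h) p.cell := by
  have eg : g' = g ≫ f := by
    rw [← x.comm, ← hk, Category.assoc, 𝒟.cart_proj, ← Category.assoc, k.comm]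
  have hσ : SameCell (castCell k.comm.symm l.comm.symm (𝟙 g)) (𝟙 g) := sameCell_castCell _ _ _
  have hρ : SameCell (castCell hk.symm hl.symm p.cell) p.cell := sameCell_castCell _ _ _
  obtain ⟨θ, ⟨h₁, h₂⟩, -⟩ := 𝒟.cart_existsUnique_cell h k.hom l.hom
    (castCell k.comm.symm l.comm.symm (𝟙 g)) (castCell hk.symm hl.symm p.cell)
    ((hρ.whiskerRight A.proj).trans <| p.vertical.trans <|
      (sameCell_id eg).trans (hσ.whiskerRight_id f).symm)
  exact ⟨⟨θ, (SameCell.of_eq h₁).trans hσ⟩, (SameCell.of_eq h₂).trans hρ⟩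

/-- The stability axioms of the cloven isofibrations for a telescope of length one, with arbitrary
names for the re-indexed types. It is applied to `Γ.Σ` over `Γ`. -/
theorem tr_sub_one {Γ Θ Ω Ω' : B} {A : 𝒟.Ty Γ} {A' : 𝒟.Ty Θ} {f : Θ ⟶ Γ} (hA : 𝒟.sub A f = A')
    {M : 𝒟.Ty A.ext} {M' : 𝒟.Ty A'.ext} (hM : 𝒟.sub M (𝒟.cart hA) = M') (f' : Ω' ⟶ Ω)
    {g : Ω ⟶ M.ext} {h : Ω ⟶ A.ext} (p : h ⟶ g ≫ M.proj) {g' : Ω' ⟶ M'.ext} {h' : Ω' ⟶ A'.ext}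
    (p' : h' ⟶ g' ≫ M'.proj) (hp : SameCell (p ▷ A.proj) (𝟙 (h ≫ A.proj)))
    (hp' : SameCell (p' ▷ A'.proj) (𝟙 (h' ≫ A'.proj))) (hg : Reindexes₁ f' (𝒟.cart hM) g' g)
    (hh : Reindexes₁ f' (𝒟.cart hA) h' h) (hpp : Reindexes₂ f' (𝒟.cart hA) p' p) :
    Reindexes₁ f' (𝒟.cart hM) (𝒟.tr M' g' p') (𝒟.tr M g p) ∧
      Reindexes₂ f' (𝒟.cart hM) (𝒟.τ M' g' p') (𝒟.τ M g p) := by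
  subst hA
  generalize hc : 𝒟.cart (rfl : 𝒟.sub A f = 𝒟.sub A f) = c at *
  obtain rfl := hc.symm.trans (𝒟.cart_rfl A f)
  subst hM
  rw [cart_rfl] at *
  exact ⟨𝒟.tr_sub (.one A) M f f' p p' hp hp' hg hh hpp,
    𝒟.τ_sub (.one A) M f f' p p' hp hp' hg hh hpp⟩

/-- The same for a telescope of length three, which is what `Γ.A.A[P_A].Id_A` over `Γ` is. The
composite projections are bracketed as they arise from `Tele.proj`. -/
theorem tr_sub_three {Γ Θ Ω Ω' : B} {A : 𝒟.Ty Γ} {A' : 𝒟.Ty Θ} {f : Θ ⟶ Γ} (hA : 𝒟.sub A f = A')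
    {E : 𝒟.Ty A.ext} {E' : 𝒟.Ty A'.ext} (hE : 𝒟.sub E (𝒟.cart hA) = E')
    {F : 𝒟.Ty E.ext} {F' : 𝒟.Ty E'.ext} (hF : 𝒟.sub F (𝒟.cart hE) = F')
    {M : 𝒟.Ty F.ext} {M' : 𝒟.Ty F'.ext} (hM : 𝒟.sub M (𝒟.cart hF) = M') (f' : Ω' ⟶ Ω)
    {g : Ω ⟶ M.ext} {h : Ω ⟶ F.ext} (p : h ⟶ g ≫ M.proj) {g' : Ω' ⟶ M'.ext} {h' : Ω' ⟶ F'.ext}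
    (p' : h' ⟶ g' ≫ M'.proj)
    (hp : SameCell (p ▷ ((F.proj ≫ E.proj) ≫ A.proj)) (𝟙 (h ≫ (F.proj ≫ E.proj) ≫ A.proj)))
    (hp' : SameCell (p' ▷ ((F'.proj ≫ E'.proj) ≫ A'.proj))
      (𝟙 (h' ≫ (F'.proj ≫ E'.proj) ≫ A'.proj)))
    (hg : Reindexes₁ f' (𝒟.cart hM) g' g) (hh : Reindexes₁ f' (𝒟.cart hF) h' h)
    (hpp : Reindexes₂ f' (𝒟.cart hF) p' p) :
    Reindexes₁ f' (𝒟.cart hM) (𝒟.tr M' g' p') (𝒟.tr M g p) ∧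
      Reindexes₂ f' (𝒟.cart hM) (𝒟.τ M' g' p') (𝒟.τ M g p) := by
  subst hA
  generalize hc : 𝒟.cart (rfl : 𝒟.sub A f = 𝒟.sub A f) = c at *
  obtain rfl := hc.symm.trans (𝒟.cart_rfl A f)
  subst hE
  generalize hc' : 𝒟.cart (rfl : 𝒟.sub E (𝒟.lift A f) = 𝒟.sub E (𝒟.lift A f)) = c' at *
  obtain rfl := hc'.symm.trans (𝒟.cart_rfl E _)
  subst hF
  generalize hc'' : 𝒟.cart (rfl : 𝒟.sub F (𝒟.lift E (𝒟.lift A f)) = _) = c'' at *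
  obtain rfl := hc''.symm.trans (𝒟.cart_rfl F _)
  subst hM
  rw [cart_rfl] at *
  exact ⟨𝒟.tr_sub (.cons A (.cons E (.one F))) M f f' p p' hp hp' hg hh hpp,
    𝒟.τ_sub (.cons A (.cons E (.one F))) M f f' p p' hp hp' hg hh hpp⟩

/-- A term as an object of the category of sections. -/
def sect {Γ : B} {A : 𝒟.Ty Γ} (a : Tm A) : 𝒟.Sect A := ⟨a.hom, a.hom_proj⟩

/-- An object of the category of sections as a term. -/
def ofSect {Γ : B} {A : 𝒟.Ty Γ} (a : 𝒟.Sect A) : Tm A := ⟨a.hom, a.comm⟩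

/-- The arrow of a term of type `A[k]`, as an object of the slice over `k`. -/
def slice {Γ Θ : B} {A : 𝒟.Ty Γ} {k : Θ ⟶ Γ} (a : Tm (𝒟.sub A k)) : SliceHom k A.proj :=
  ⟨a.arrow, a.arrow_proj⟩

theorem arrow_sub {Γ Θ : B} {A : 𝒟.Ty Γ} (a : Tm A) (k : Θ ⟶ Γ) :
    (a.sub k).arrow = k ≫ a.hom := by
  rw [← a.subst_hom_cart (rfl : 𝒟.sub A k = _), cart_rfl, Tm.arrow]

theorem reindexes_term {Γ Θ : B} {A : 𝒟.Ty Γ} {f : Θ ⟶ Γ} {A' : 𝒟.Ty Θ} (h : 𝒟.sub A f = A')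
    {a : Tm A} {a' : Tm A'} (e : a.subst h = a') : Reindexes₁ f (𝒟.cart h) a'.hom a.hom := by
  rw [← e]
  exact a.subst_hom_cart h

theorem ofSect_subst {Γ Θ : B} {A : 𝒟.Ty Γ} {f : Θ ⟶ Γ} {A' : 𝒟.Ty Θ} (h : 𝒟.sub A f = A')
    {a : 𝒟.Sect A} {a' : 𝒟.Sect A'} (e : Reindexes₁ f (𝒟.cart h) a'.hom a.hom) :
    (ofSect a).subst h = ofSect a' :=
  (Tm.eq_subst (a := ofSect a) (b := ofSect a') h e).symm

theorem reindexes_arrow {Γ Γ' Θ Θ' : B} {u : Θ' ⟶ Θ} {k : Θ ⟶ Γ} {k' : Θ' ⟶ Γ'} {m : Γ' ⟶ Γ}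
    (sq : k' ≫ m = u ≫ k) {A : 𝒟.Ty Γ} {A' : 𝒟.Ty Γ'} (h : 𝒟.sub A m = A')
    {a : Tm (𝒟.sub A k)} {a' : Tm (𝒟.sub A' k')} (e : a.subst (𝒟.sub_square sq h) = a') :
    Reindexes₁ u (𝒟.cart h) a'.arrow a.arrow := by
  rw [← e]
  exact Tm.arrow_square sq h a

/-- Whiskering `p` with `f` gives a vertical 2-cell over `f` between arrows into `A`, and the
2-pullback lifts it to `A[f]`. -/
theorem exists_reindexed {Γ Θ : B} {A : 𝒟.Ty Γ} {f : Θ ⟶ Γ} {A' : 𝒟.Ty Θ}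
    (h : 𝒟.sub A f = A') {a b : Tm A} {a' b' : Tm A'} (ha : a.subst h = a')
    (hb : b.subst h = b') (p : sect a ⟶ sect b) :
    ∃ p' : sect a' ⟶ sect b', Reindexes₂ f (𝒟.cart h) p'.cell p.cell :=
  exists_sliceHom_cart (k := sect a') (l := sect b') (g' := f) (h := h)
    (x := ⟨f ≫ a.hom, by rw [Category.assoc, a.hom_proj, Category.comp_id]⟩)
    (y := ⟨f ≫ b.hom, by rw [Category.assoc, b.hom_proj, Category.comp_id]⟩)
    (reindexes_term h ha) (reindexes_term h hb)
    ⟨f ◁ p.cell, (sameCell_whiskerLeft_whiskerRight _ _ _).trans <|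
      (p.vertical.whiskerLeft_id f).trans (sameCell_id (Category.comp_id f))⟩

/-! ### Terms of identity types as vertical 2-cells. -/

namespace AxiomaticId

variable (I : 𝒟.AxiomaticId)

/-- The first projection of the type of identities. -/
abbrev src {Γ : B} (A : 𝒟.Ty Γ) : (I.Id A).ext ⟶ A.ext := (I.Id A).proj ≫ (wk A).proj

/-- The second projection of the type of identities. -/
abbrev tgt {Γ : B} (A : 𝒟.Ty Γ) : (I.Id A).ext ⟶ A.ext := (I.Id A).proj ≫ 𝒟.lift A A.proj

theorem tgt_proj {Γ : B} (A : 𝒟.Ty Γ) : I.tgt A ≫ A.proj = I.src A ≫ A.proj := by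
  rw [Category.assoc, Category.assoc, (𝒟.isPullback A A.proj).w]

theorem src_cart {Γ Θ : B} {A : 𝒟.Ty Γ} {f : Θ ⟶ Γ} {A' : 𝒟.Ty Θ} (h : 𝒟.sub A f = A') :
    I.src A' ≫ 𝒟.cart h = 𝒟.cart (I.Id_sub h) ≫ I.src A := by
  rw [← Category.assoc, 𝒟.cart_proj, Category.assoc, Category.assoc, wk_cart_proj]

theorem tgt_cart {Γ Θ : B} {A : 𝒟.Ty Γ} {f : Θ ⟶ Γ} {A' : 𝒟.Ty Θ} (h : 𝒟.sub A f = A') :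
    I.tgt A' ≫ 𝒟.cart h = 𝒟.cart (I.Id_sub h) ≫ I.tgt A := by
  rw [← Category.assoc, 𝒟.cart_proj, Category.assoc, Category.assoc, wk_cart_lift]

/-- The 2-cell obtained by whiskering `α` with `x` is itself vertical, so both arrows classify the
same 2-cell and uniqueness in `factor` applies. -/
theorem hom_ext {Γ Θ : B} {A : 𝒟.Ty Γ} {x y : Θ ⟶ (I.Id A).ext}
    (h : SameCell (x ◁ I.α A) (y ◁ I.α A)) : x = y := by
  have hv : SameCell ((x ◁ I.α A) ▷ A.proj) (𝟙 (x ≫ I.src A ≫ A.proj)) :=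
    (sameCell_whiskerLeft_whiskerRight _ _ _).trans <|
      ((I.α_vertical A).whiskerLeft_id x).trans (sameCell_id (by simp))
  exact (I.factor A (x ≫ I.src A ≫ A.proj) ⟨x ≫ I.src A, Category.assoc _ _ _⟩
    ⟨x ≫ I.tgt A, by rw [Category.assoc, I.tgt_proj]⟩ ⟨x ◁ I.α A, hv⟩).unique
    (.refl _) h.symm

theorem exists_factor {Γ Θ : B} {A : 𝒟.Ty Γ} {h : Θ ⟶ Γ} {a b : SliceHom h A.proj} (p : a ⟶ b) :
    ∃ x : Θ ⟶ (I.Id A).ext, SameCell (x ◁ I.α A) p.cell :=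
  (I.factor A h a b p).exists

/-- A form of `factor₂` with free names for the boundaries. Uniqueness holds among all 2-cells with
the given projections: verticality follows from that of the source projection. -/
theorem existsUnique_cell {Γ Θ : B} {A : 𝒟.Ty Γ} {x y : Θ ⟶ (I.Id A).ext} {h : Θ ⟶ Γ}
    {a b : Θ ⟶ A.ext} {c d : Θ ⟶ A.ext} (σ : a ⟶ b) (ρ : c ⟶ d)
    (hσ : SameCell (σ ▷ A.proj) (𝟙 h)) (hρ : SameCell (ρ ▷ A.proj) (𝟙 h))
    (hax : x ≫ I.src A = a) (hby : y ≫ I.src A = b) (hcx : x ≫ I.tgt A = c)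
    (hdy : y ≫ I.tgt A = d)
    (w : σ ≫ castCell hby hdy (y ◁ I.α A) = castCell hax hcx (x ◁ I.α A) ≫ ρ) :
    ∃ θ : x ⟶ y, (SameCell (θ ▷ I.src A) σ ∧ SameCell (θ ▷ I.tgt A) ρ) ∧
      ∀ θ' : x ⟶ y, SameCell (θ' ▷ I.src A) σ → SameCell (θ' ▷ I.tgt A) ρ → θ' = θ := by
  subst hax hby hcx hdy
  simp only [castCell, eqToHom_refl, Category.id_comp, Category.comp_id] at w
  have hx : x ≫ (I.Id A).proj ≫ (wk A).proj ≫ A.proj = h := by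
    simpa using hσ.left
  have hy : y ≫ (I.Id A).proj ≫ (wk A).proj ≫ A.proj = h := by
    simpa using hσ.right
  obtain ⟨θ, ⟨h₁, h₂⟩, hu⟩ := I.factor₂ A h ⟨x, hx⟩ ⟨y, hy⟩ σ ρ hσ hρ w
  refine ⟨θ.cell, ⟨.of_eq h₁, .of_eq h₂⟩, fun θ' h₁' h₂' => ?_⟩
  have hv : SameCell (θ' ▷ ((I.Id A).proj ≫ (wk A).proj ≫ A.proj)) (𝟙 h) :=
    (sameCell_whiskerRight_congr (Category.assoc _ _ _).symm _).trans <|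
      (sameCell_whiskerRight_comp _ _ _).symm.trans <| (h₁'.whiskerRight _).trans hσ
  exact congrArg SliceHom.Hom.cell (hu ⟨θ', hv⟩ ⟨h₁'.eq, h₂'.eq⟩)

/-- A vertical 2-cell into the type of identities is determined by its two projections. The
compatibility square with `α` that `existsUnique_cell` asks for is the interchange law. -/
theorem sameCell_of_src_tgt {Γ Θ : B} {A : 𝒟.Ty Γ} {x y x' y' : Θ ⟶ (I.Id A).ext}
    (ex : x = x') (ey : y = y') {θ : x ⟶ y} {θ' : x' ⟶ y'} {h : Θ ⟶ Γ}
    (hv : SameCell (θ ▷ (I.src A ≫ A.proj)) (𝟙 h))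
    (h₁ : SameCell (θ ▷ I.src A) (θ' ▷ I.src A)) (h₂ : SameCell (θ ▷ I.tgt A) (θ' ▷ I.tgt A)) :
    SameCell θ θ' := by
  subst ex ey
  have hs : SameCell ((θ ▷ I.src A) ▷ A.proj) (𝟙 h) :=
    (sameCell_whiskerRight_comp _ _ _).trans hv
  have ht : SameCell ((θ ▷ I.tgt A) ▷ A.proj) (𝟙 h) :=
    (sameCell_whiskerRight_comp _ _ _).trans <|
      (sameCell_whiskerRight_congr (I.tgt_proj A) _).trans hv
  obtain ⟨θ₀, -, hu⟩ := I.existsUnique_cell (x := x) (y := y) (θ ▷ I.src A) (θ ▷ I.tgt A) hs ht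
    rfl rfl rfl rfl (by simpa [castCell] using (whisker_exchange θ (I.α A)).symm)
  exact .of_eq ((hu θ (.refl _) (.refl _)).trans (hu θ' h₁.symm h₂.symm).symm)

/-- The 2-cell `p` is the one classified by the term `e` of an identity type. -/
def Path {Γ : B} {A : 𝒟.Ty Γ} {a b : Tm A} (e : Tm (I.Eq a b)) {x y : Γ ⟶ A.ext} (p : x ⟶ y) :
    Prop :=
  SameCell (Tm.arrow (A := I.Id A) (k := pair a b) e ◁ I.α A) p

variable {I}

theorem Path.unique {Γ : B} {A : 𝒟.Ty Γ} {a b : Tm A} {e : Tm (I.Eq a b)}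
    {x y x' y' : Γ ⟶ A.ext} {p : x ⟶ y} {q : x' ⟶ y'} (h : I.Path e p) (h' : I.Path e q) :
    SameCell p q :=
  SameCell.trans (SameCell.symm h) h'

theorem Path.ext {Γ : B} {A : 𝒟.Ty Γ} {a b : Tm A} {e e' : Tm (I.Eq a b)} {x y x' y' : Γ ⟶ A.ext}
    {p : x ⟶ y} {q : x' ⟶ y'} (h : I.Path e p) (h' : I.Path e' q) (hpq : SameCell p q) :
    e = e' :=
  Tm.ext_arrow (I.hom_ext (SameCell.trans h (hpq.trans (SameCell.symm h'))))

/-- Compared through the 2-pullback: both sides are vertical, which settles the projection to the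
context, and `α_sub` settles the component in `A`. -/
theorem Path.subst {Γ Θ : B} {A : 𝒟.Ty Γ} {f : Θ ⟶ Γ} {A' : 𝒟.Ty Θ} (h : 𝒟.sub A f = A')
    {a b : Tm A} {a' b' : Tm A'} (ha : a.subst h = a') (hb : b.subst h = b') {e : Tm (I.Eq a b)}
    {p : a.hom ⟶ b.hom} {p' : a'.hom ⟶ b'.hom} (hp : I.Path e p)
    (hp' : SameCell (p' ▷ A'.proj) (𝟙 (𝟙 Θ))) (hpp : Reindexes₂ f (𝒟.cart h) p' p)
    (hE : 𝒟.sub (I.Eq a b) f = I.Eq a' b') : I.Path (e.subst hE) p' := by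
  subst ha hb
  have ea : (e.subst hE).arrow ≫ 𝒟.cart (I.Id_sub h) = f ≫ e.arrow :=
    Tm.arrow_square (pair_sub h a b) (I.Id_sub h) e
  refine sameCell_of_cart h ?_ ?_
  · refine (sameCell_whiskerLeft_whiskerRight _ _ _).trans <|
      ((I.α_vertical A').whiskerLeft_id _).trans <| .trans (sameCell_id ?_) hp'.symm
    rw [← Category.assoc, Tm.arrow_proj, ← Category.assoc, pr_proj, Tm.hom_proj]
  · refine (sameCell_whiskerLeft_whiskerRight _ _ _).trans <|
      (SameCell.whiskerLeft _ (I.α_sub h)).trans <| (sameCell_comp_whiskerLeft _ _ _).symm.trans <|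
        (sameCell_whiskerLeft_congr ea _).trans <| (sameCell_comp_whiskerLeft _ _ _).trans <|
          (SameCell.whiskerLeft f hp).trans (SameCell.symm hpp)

variable (I)

theorem exists_path {Γ : B} {A : 𝒟.Ty Γ} {a b : Tm A} (e : Tm (I.Eq a b)) :
    ∃ p : sect a ⟶ sect b, I.Path e p.cell := by
  have h₁ : e.arrow ≫ I.src A = a.hom := by
    rw [← Category.assoc, Tm.arrow_proj, pr_proj]
  have h₂ : e.arrow ≫ I.tgt A = b.hom := by
    rw [← Category.assoc, Tm.arrow_proj, pr_lift]
  have hc := sameCell_castCell h₁ h₂ (e.arrow ◁ I.α A)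
  refine ⟨⟨castCell h₁ h₂ (e.arrow ◁ I.α A), ?_⟩, hc.symm⟩
  refine (hc.whiskerRight _).trans <| (sameCell_whiskerLeft_whiskerRight _ _ _).trans <|
    ((I.α_vertical A).whiskerLeft_id _).trans (sameCell_id ?_)
  rw [← Category.assoc, Tm.arrow_proj, ← Category.assoc, pr_proj, Tm.hom_proj]

/-- The 2-cell classified by a term of an identity type. -/
noncomputable def cell {Γ : B} {A : 𝒟.Ty Γ} {a b : Tm A} (e : Tm (I.Eq a b)) :
    sect a ⟶ sect b :=
  (I.exists_path e).choose

theorem path_cell {Γ : B} {A : 𝒟.Ty Γ} {a b : Tm A} (e : Tm (I.Eq a b)) :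
    I.Path e (I.cell e).cell :=
  (I.exists_path e).choose_spec

theorem exists_term {Γ : B} {A : 𝒟.Ty Γ} {a b : Tm A} (p : sect a ⟶ sect b) :
    ∃ e : Tm (I.Eq a b), I.Path e p.cell := by
  obtain ⟨x, hx⟩ := I.exists_factor p
  have hx' : x ≫ (I.Id A).proj = pair a b := by
    apply wk_hom_ext
    · rw [pr_proj, Category.assoc]
      exact hx.left
    · rw [pr_lift, Category.assoc]
      exact hx.right
  exact ⟨Tm.ofArrow x hx', (sameCell_whiskerLeft_congr (Tm.ofArrow_arrow x hx') _).trans hx⟩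

/-- The term of an identity type that classifies a 2-cell. -/
noncomputable def ofCell {Γ : B} {A : 𝒟.Ty Γ} {a b : Tm A} (p : sect a ⟶ sect b) :
    Tm (I.Eq a b) :=
  (I.exists_term p).choose

theorem path_ofCell {Γ : B} {A : 𝒟.Ty Γ} {a b : Tm A} (p : sect a ⟶ sect b) :
    I.Path (I.ofCell p) p.cell :=
  (I.exists_term p).choose_spec

/-- Although `ofCell` is obtained by choice, the classifying term is unique, so stability of the
2-cell is enough. -/
theorem ofCell_subst {Γ Θ : B} {A : 𝒟.Ty Γ} {f : Θ ⟶ Γ} {A' : 𝒟.Ty Θ} (h : 𝒟.sub A f = A')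
    {a b : Tm A} {a' b' : Tm A'} (ha : a.subst h = a') (hb : b.subst h = b')
    {p : sect a ⟶ sect b} {p' : sect a' ⟶ sect b'}
    (hpp : Reindexes₂ f (𝒟.cart h) p'.cell p.cell)
    (hE : 𝒟.sub (I.Eq a b) f = I.Eq a' b') : (I.ofCell p).subst hE = I.ofCell p' :=
  Path.ext ((I.path_ofCell p).subst h ha hb p'.vertical hpp hE) (I.path_ofCell p') (.refl _)

/-- The re-indexing of the 2-cell of `e` exists by `exists_reindexed` and is classified by the
re-indexed term, hence it is the chosen 2-cell of that term. -/
theorem cell_subst {Γ Θ : B} {A : 𝒟.Ty Γ} {f : Θ ⟶ Γ} {A' : 𝒟.Ty Θ} (h : 𝒟.sub A f = A')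
    {a b : Tm A} {a' b' : Tm A'} (ha : a.subst h = a') (hb : b.subst h = b')
    (e : Tm (I.Eq a b)) (hE : 𝒟.sub (I.Eq a b) f = I.Eq a' b') :
    Reindexes₂ f (𝒟.cart h) (I.cell (e.subst hE)).cell (I.cell e).cell := by
  obtain ⟨p, hp⟩ := exists_reindexed h ha hb (I.cell e)
  exact Reindexes₂.congr hp
    (((I.path_cell e).subst h ha hb p.vertical hp hE).unique (I.path_cell _)).symm (.refl _)

theorem cell_ofCell {Γ : B} {A : 𝒟.Ty Γ} {a b : Tm A} (p : sect a ⟶ sect b) :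
    I.cell (I.ofCell p) = p :=
  SliceHom.Hom.ext ((I.path_cell _).unique (I.path_ofCell p)).eq

theorem ofCell_cell {Γ : B} {A : 𝒟.Ty Γ} {a b : Tm A} (e : Tm (I.Eq a b)) :
    I.ofCell (I.cell e) = e :=
  (I.path_ofCell _).ext (I.path_cell e) (.refl _)

/-- Two terms of an identity type are equal if there is a term of their identity type. -/
theorem eq_of_term {Γ : B} {A : 𝒟.Ty Γ} {a b : Tm A} {e e' : Tm (I.Eq a b)}
    (t : Tm (I.Eq e e')) : e = e' := by
  let p := (I.cell t).cell ▷ 𝒟.lift (I.Id A) (pair a b)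
  have hp : SameCell (p ▷ (I.Id A).proj) (𝟙 (pair a b)) :=
    (sameCell_whiskerRight_comp _ _ _).trans <|
      (sameCell_whiskerRight_congr (𝒟.isPullback _ _).w _).trans <|
        (sameCell_whiskerRight_comp _ _ _).symm.trans <|
          ((I.cell t).vertical.whiskerRight_id _).trans (sameCell_id (Category.id_comp _))
  have hs : SameCell (p ▷ I.src A) (𝟙 a.hom) :=
    (sameCell_whiskerRight_comp _ _ _).symm.trans <| (hp.whiskerRight_id _).trans <|
      sameCell_id (pr_proj _ _ _)
  have ht : SameCell (p ▷ I.tgt A) (𝟙 b.hom) :=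
    (sameCell_whiskerRight_comp _ _ _).symm.trans <| (hp.whiskerRight_id _).trans <|
      sameCell_id (pr_lift _ _ _)
  -- The 2-cell `p` lies over the fixed pair of endpoints, so both its projections are identities.
  -- Interchange with `α` then says that `e` and `e'` classify the same 2-cell.
  have hw := whisker_exchange p (I.α A)
  refine Tm.ext_arrow (I.hom_ext ?_)
  refine (SameCell.comp_id (.refl _) ht).symm.trans ?_
  exact (SameCell.of_eq hw).trans (SameCell.id_comp hs (.refl _))

/-- The 2-cells of `t` and `t'`, seen in `Id_A`, both lie over the identity of `a;b`. They therefore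
have the same projections to `A`, and these determine them. -/
theorem term_subsingleton {Γ : B} {A : 𝒟.Ty Γ} {a b : Tm A} {e e' : Tm (I.Eq a b)}
    (t t' : Tm (I.Eq e e')) : t = t' := by
  refine (I.path_cell t).ext (I.path_cell t') ?_
  refine sameCell_of_cart (rfl : 𝒟.sub (I.Id A) (pair a b) = _) ?_ ?_
  · exact (I.cell t).vertical.trans (I.cell t').vertical.symm
  rw [cart_rfl]
  have key : ∀ t : Tm (I.Eq e e'), SameCell
      (((I.cell t).cell ▷ 𝒟.lift (I.Id A) (pair a b)) ▷ (I.Id A).proj) (𝟙 (pair a b)) :=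
    fun t => (sameCell_whiskerRight_comp _ _ _).trans <|
      (sameCell_whiskerRight_congr (𝒟.isPullback _ _).w _).trans <|
        (sameCell_whiskerRight_comp _ _ _).symm.trans <|
          ((I.cell t).vertical.whiskerRight_id _).trans (sameCell_id (Category.id_comp _))
  have key' : ∀ {F : B} (m : (wk A).ext ⟶ F), SameCell
      (((I.cell t).cell ▷ 𝒟.lift (I.Id A) (pair a b)) ▷ ((I.Id A).proj ≫ m))
      (((I.cell t').cell ▷ 𝒟.lift (I.Id A) (pair a b)) ▷ ((I.Id A).proj ≫ m)) := fun m =>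
    (sameCell_whiskerRight_comp _ _ _).symm.trans <|
      (((key t).trans (key t').symm).whiskerRight m).trans (sameCell_whiskerRight_comp _ _ _)
  refine I.sameCell_of_src_tgt rfl rfl (h := 𝟙 Γ) ?_ (key' _) (key' _)
  refine (sameCell_whiskerRight_congr (Category.assoc _ _ _) _).trans <|
    (sameCell_whiskerRight_comp _ _ _).symm.trans <| ((key t).whiskerRight_id _).trans <|
      sameCell_id ?_
  rw [← Category.assoc, pr_proj, Tm.hom_proj]

/-- The term of an identity type of `A[f]` that classifies a 2-cell between arrows into `A`. -/
noncomputable def ofLift {Γ Θ : B} {A : 𝒟.Ty Γ} {f : Θ ⟶ Γ} {A' : 𝒟.Ty Θ}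
    (h : 𝒟.sub A f = A') (a b : Tm A') {x y : SliceHom f A.proj} (ha : a.hom ≫ 𝒟.cart h = x.hom)
    (hb : b.hom ≫ 𝒟.cart h = y.hom) (p : x ⟶ y) : Tm (I.Eq a b) :=
  I.ofCell (exists_sliceHom_cart (k := sect a) (l := sect b) h ha hb p).choose

theorem cell_ofLift {Γ Θ : B} {A : 𝒟.Ty Γ} {f : Θ ⟶ Γ} {A' : 𝒟.Ty Θ}
    (h : 𝒟.sub A f = A') (a b : Tm A') {x y : SliceHom f A.proj} (ha : a.hom ≫ 𝒟.cart h = x.hom)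
    (hb : b.hom ≫ 𝒟.cart h = y.hom) (p : x ⟶ y) :
    SameCell ((I.cell (I.ofLift h a b ha hb p)).cell ▷ 𝒟.cart h) p.cell :=
  (((I.path_cell _).unique (I.path_ofCell _)).whiskerRight _).trans
    (exists_sliceHom_cart (k := sect a) (l := sect b) h ha hb p).choose_spec

/-- Two terms of an identity type in `A[f]` are equal if the 2-cells into `A` agree. -/
theorem term_ext {Γ Θ : B} {A : 𝒟.Ty Γ} {f : Θ ⟶ Γ} {A' : 𝒟.Ty Θ} (h : 𝒟.sub A f = A')
    {a b : Tm A'} {e e' : Tm (I.Eq a b)} (hc : SameCell ((I.cell e).cell ▷ 𝒟.cart h)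
      ((I.cell e').cell ▷ 𝒟.cart h)) : e = e' :=
  (I.path_cell e).ext (I.path_cell e') <| sameCell_of_cart h
    ((I.cell e).vertical.trans (I.cell e').vertical.symm) hc

/-- The term of an identity type of `A[k]` that classifies a 2-cell between arrows into `A`. -/
noncomputable def ofSlice {Γ Θ : B} {A : 𝒟.Ty Γ} {k : Θ ⟶ Γ} (a b : Tm (𝒟.sub A k))
    {x y : SliceHom k A.proj} (ha : a.arrow = x.hom) (hb : b.arrow = y.hom) (p : x ⟶ y) :
    Tm (I.Eq a b) :=
  I.ofLift rfl a b ((congrArg (a.hom ≫ ·) (𝒟.cart_rfl A k)).trans ha)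
    ((congrArg (b.hom ≫ ·) (𝒟.cart_rfl A k)).trans hb) p

/-- This gives the stability of the propositional computation terms outside the `Π` rules: it
reduces to a re-indexing statement about 2-cells between arrows into `A`, with no reference to the
pulled-back type `A[k]`. -/
theorem ofSlice_subst {Γ Γ' Θ Θ' : B} {u : Θ' ⟶ Θ} {k : Θ ⟶ Γ} {k' : Θ' ⟶ Γ'}
    {m : Γ' ⟶ Γ} (sq : k' ≫ m = u ≫ k) {A : 𝒟.Ty Γ} {A' : 𝒟.Ty Γ'} (h : 𝒟.sub A m = A')
    {a b : Tm (𝒟.sub A k)} {a' b' : Tm (𝒟.sub A' k')} (ea : a.subst (𝒟.sub_square sq h) = a')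
    (eb : b.subst (𝒟.sub_square sq h) = b') {x y : SliceHom k A.proj} (ha : a.arrow = x.hom)
    (hb : b.arrow = y.hom) {p : x ⟶ y} {x' y' : SliceHom k' A'.proj} (ha' : a'.arrow = x'.hom)
    (hb' : b'.arrow = y'.hom) {p' : x' ⟶ y'} (hpp : Reindexes₂ u (𝒟.cart h) p'.cell p.cell)
    (hE : 𝒟.sub (I.Eq a b) u = I.Eq a' b') :
    (I.ofSlice a b ha hb p).subst hE = I.ofSlice a' b' ha' hb' p' := by
  refine I.term_ext (rfl : 𝒟.sub A' k' = _) ?_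
  refine sameCell_of_cart h ?_ ?_
  · have key : ∀ e : Tm (I.Eq a' b'), SameCell
        (((I.cell e).cell ▷ 𝒟.cart (rfl : 𝒟.sub A' k' = _)) ▷ A'.proj) (𝟙 k') :=
      fun e => (sameCell_whiskerRight_comp _ _ _).trans <|
        (sameCell_whiskerRight_congr (𝒟.cart_proj _) _).trans <|
          (sameCell_whiskerRight_comp _ _ _).symm.trans <|
            ((I.cell e).vertical.whiskerRight_id _).trans (sameCell_id (Category.id_comp _))
    exact (key _).trans (key _).symm
  · have hc := I.cell_subst (𝒟.sub_square sq h) ea eb (I.ofSlice a b ha hb p) hE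
    have sq' : 𝒟.cart (rfl : 𝒟.sub A' k' = _) ≫ 𝒟.cart h =
        𝒟.cart (𝒟.sub_square sq h) ≫ 𝒟.cart (rfl : 𝒟.sub A k = _) := by
      rw [cart_rfl, cart_rfl, 𝒟.cart_square sq h]
    refine SameCell.trans (Reindexes₂.whiskerRight hc sq') ?_
    refine ((I.cell_ofLift _ _ _ _ _ _).whiskerLeft u).trans (SameCell.symm ?_)
    exact ((I.cell_ofLift _ _ _ _ _ _).whiskerRight _).trans hpp

end AxiomaticId

/-! ### Identity types: reflexivity, contraction, elimination and computation. -/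

namespace AxiomaticId

variable (I : 𝒟.AxiomaticId)

theorem exists_rArrow {Γ : B} (A : 𝒟.Ty Γ) :
    ∃ x : A.ext ⟶ (I.Id A).ext, SameCell (x ◁ I.α A) (𝟙 (𝟙 A.ext)) :=
  I.exists_factor (h := A.proj) (𝟙 (⟨𝟙 A.ext, Category.id_comp _⟩ : SliceHom A.proj A.proj))

/-- The arrow that classifies the identity 2-cell. -/
noncomputable def rArrow {Γ : B} (A : 𝒟.Ty Γ) : A.ext ⟶ (I.Id A).ext :=
  (I.exists_rArrow A).choose

theorem rArrow_α {Γ : B} (A : 𝒟.Ty Γ) : SameCell (I.rArrow A ◁ I.α A) (𝟙 (𝟙 A.ext)) :=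
  (I.exists_rArrow A).choose_spec

theorem rArrow_src {Γ : B} (A : 𝒟.Ty Γ) : I.rArrow A ≫ I.src A = 𝟙 A.ext :=
  (I.rArrow_α A).left

theorem rArrow_tgt {Γ : B} (A : 𝒟.Ty Γ) : I.rArrow A ≫ I.tgt A = 𝟙 A.ext :=
  (I.rArrow_α A).right

theorem rArrow_proj {Γ : B} (A : 𝒟.Ty Γ) : I.rArrow A ≫ (I.Id A).proj = diag A := by
  apply wk_hom_ext
  · rw [pr_proj, Category.assoc, I.rArrow_src]
  · rw [pr_lift, Category.assoc, I.rArrow_tgt]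

theorem rArrow_sub {Γ Θ : B} {A : 𝒟.Ty Γ} {f : Θ ⟶ Γ} {A' : 𝒟.Ty Θ} (h : 𝒟.sub A f = A') :
    I.rArrow A' ≫ 𝒟.cart (I.Id_sub h) = 𝒟.cart h ≫ I.rArrow A := by
  refine I.hom_ext ?_
  refine (sameCell_comp_whiskerLeft _ _ _).trans <|
    (SameCell.whiskerLeft _ (SameCell.symm (I.α_sub h))).trans <|
      (sameCell_whiskerLeft_whiskerRight _ _ _).symm.trans <|
        ((I.rArrow_α A').whiskerRight_id _).trans <| .trans (sameCell_id (by simp)) <|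
          ((I.rArrow_α A).whiskerLeft_id (𝒟.cart h)).symm.trans
            (sameCell_comp_whiskerLeft _ _ _).symm

/-- Identity types with the reflexivity terms that classify identity 2-cells. -/
@[reducible]
noncomputable def toIdIntro : 𝒟.toDisplayMapCategory.IdIntro where
  toIdFormer := I.toIdFormer
  refl A := Tm.ofArrow (I.rArrow A) (I.rArrow_proj A)
  refl_sub {Γ Θ A f A'} h := by
    refine Tm.ext_arrow (𝒟.cart_hom_ext (I.Id_sub h) ?_ ?_)
    · refine (Tm.arrow_square (diag_sub h) (I.Id_sub h) _).trans ?_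
      rw [Tm.ofArrow_arrow, Tm.ofArrow_arrow, I.rArrow_sub h]
    · rw [Tm.arrow_proj, Tm.arrow_proj]

theorem toIdIntro_r {Γ : B} (A : 𝒟.Ty Γ) : I.toIdIntro.r A = I.rArrow A :=
  Tm.ofArrow_arrow _ (I.rArrow_proj A)

/-- The arrow of the reflexivity term at `a` is `a` followed by `rArrow`, so the 2-cell it
classifies is the restriction of an identity. -/
theorem path_reflAt {Γ : B} {A : 𝒟.Ty Γ} (a : Tm A) :
    I.Path (I.toIdIntro.reflAt a) (𝟙 a.hom) := by
  have h₁ : Tm.arrow (A := I.Id A) (k := pair a a) (I.toIdIntro.reflAt a) =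
      a.hom ≫ I.rArrow A := by
    refine Eq.trans ?_ (congrArg (a.hom ≫ ·) (I.toIdIntro_r A))
    have := 𝒟.cart_trans (rfl : 𝒟.sub (I.Id A) (diag A) = _) (I.toIdIntro.Eq_self a)
    unfold Tm.arrow IdIntro.r
    have e : 𝒟.lift (I.Id A) (pair a a) =
        𝒟.cart (𝒟.sub_trans (rfl : 𝒟.sub (I.Id A) (diag A) = _) (I.toIdIntro.Eq_self a)) :=
      (𝒟.cart_rfl _ _).symm.trans (𝒟.cart_congr (diag_term a).symm _ _)
    refine (congrArg (_ ≫ ·) (e.trans this)).trans <| (Category.assoc _ _ _).symm.trans <|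
      (congrArg (· ≫ _) (Tm.subst_hom_cart _ _)).trans <| (Category.assoc _ _ _).trans ?_
    rw [cart_rfl, Tm.arrow]
  refine (sameCell_whiskerLeft_congr h₁ _).trans <| (sameCell_comp_whiskerLeft _ _ _).trans <|
    ((I.rArrow_α A).whiskerLeft_id a.hom).trans (sameCell_id (Category.comp_id _))

/-- A path `p` from `x` to `y` is contracted to reflexivity at `x` by the identity on the source and
the inverse of `α` on the target. The required square says that `α` followed by its inverse is the
identity, since `rArrow` whiskers `α` to an identity. -/
theorem exists_contraction {Γ : B} (A : 𝒟.Ty Γ) :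
    ∃ θ : 𝟙 (I.Id A).ext ⟶ I.src A ≫ I.rArrow A, SameCell (θ ▷ I.src A) (𝟙 (I.src A)) ∧
      SameCell (θ ▷ I.tgt A)
        (letI := 𝒟.isIso (I.α A); inv (I.α A)) := by
  let _ := 𝒟.isIso (I.α A)
  have hv := I.α_vertical A
  have hs : (I.src A ≫ I.rArrow A) ≫ I.src A = I.src A := by
    rw [Category.assoc, I.rArrow_src, Category.comp_id]
  have ht : (I.src A ≫ I.rArrow A) ≫ I.tgt A = I.src A := by
    rw [Category.assoc, I.rArrow_tgt, Category.comp_id]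
  have h₁ : castCell hs ht ((I.src A ≫ I.rArrow A) ◁ I.α A) = 𝟙 _ := by
    refine ((sameCell_castCell _ _ _).trans <| (sameCell_comp_whiskerLeft _ _ _).trans <|
      ((I.rArrow_α A).whiskerLeft_id _).trans <| sameCell_id (Category.comp_id _)).eq
  have h₂ : castCell (Category.id_comp _) (Category.id_comp _) (𝟙 (I.Id A).ext ◁ I.α A) = I.α A :=
    ((sameCell_castCell _ _ _).trans (sameCell_id_whiskerLeft _)).eq
  obtain ⟨θ, h, -⟩ := I.existsUnique_cell (A := A) (x := 𝟙 (I.Id A).ext)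
    (y := I.src A ≫ I.rArrow A)
    (h := I.src A ≫ A.proj) (𝟙 (I.src A)) (inv (I.α A))
    (by rw [Bicategory.id_whiskerRight]; rfl)
    (by
      rw [← inv_whiskerRight]
      exact (SameCell.inv_id hv).trans (sameCell_id (Category.assoc _ _ _).symm))
    (Category.id_comp _) hs (Category.id_comp _) ht (by rw [h₁, h₂]; simp)
  exact ⟨θ, h⟩

/-- The 2-cell that contracts the type of identities onto the reflexivities. -/
noncomputable def contraction {Γ : B} (A : 𝒟.Ty Γ) : 𝟙 (I.Id A).ext ⟶ I.src A ≫ I.rArrow A :=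
  (I.exists_contraction A).choose

theorem contraction_src {Γ : B} (A : 𝒟.Ty Γ) :
    SameCell (I.contraction A ▷ I.src A) (𝟙 (I.src A)) :=
  (I.exists_contraction A).choose_spec.1

theorem contraction_tgt {Γ : B} (A : 𝒟.Ty Γ) :
    SameCell (I.contraction A ▷ I.tgt A) (letI := 𝒟.isIso (I.α A); inv (I.α A)) :=
  (I.exists_contraction A).choose_spec.2

theorem contraction_vertical {Γ : B} (A : 𝒟.Ty Γ) :
    SameCell (I.contraction A ▷ (I.src A ≫ A.proj)) (𝟙 (I.src A ≫ A.proj)) :=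
  (sameCell_whiskerRight_comp _ _ _).symm.trans ((I.contraction_src A).whiskerRight_id _)

/-- Both projections of the restricted contraction are identities: on the source by construction,
and on the target because `α` restricts to an identity along `rArrow`. This is what makes the
computation 2-cell `hCell` vertical. -/
theorem rArrow_contraction {Γ : B} (A : 𝒟.Ty Γ) :
    SameCell (I.rArrow A ◁ I.contraction A) (𝟙 (I.rArrow A)) := by
  let _ := 𝒟.isIso (I.α A)
  have hs : SameCell ((I.rArrow A ◁ I.contraction A) ▷ I.src A) (𝟙 (𝟙 A.ext)) :=
    (sameCell_whiskerLeft_whiskerRight _ _ _).trans <|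
      ((I.contraction_src A).whiskerLeft_id _).trans (sameCell_id (I.rArrow_src A))
  refine I.sameCell_of_src_tgt (h := A.proj) (Category.comp_id _) ?_ ?_ ?_ ?_
  · rw [← Category.assoc, I.rArrow_src, Category.id_comp]
  · exact (sameCell_whiskerRight_comp _ _ _).symm.trans <|
      (hs.whiskerRight_id A.proj).trans (sameCell_id (Category.id_comp _))
  · refine hs.trans ?_
    rw [Bicategory.id_whiskerRight]
    exact sameCell_id (I.rArrow_src A).symm
  · refine (sameCell_whiskerLeft_whiskerRight _ _ _).trans <|
      ((I.contraction_tgt A).whiskerLeft _).trans ?_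
    rw [← inv_whiskerLeft, Bicategory.id_whiskerRight]
    exact (SameCell.inv_id (I.rArrow_α A)).trans (sameCell_id (I.rArrow_tgt A).symm)

/-- The contraction is fixed by its two projections, an identity and the inverse of `α`, and both
are stable. -/
theorem contraction_sub {Γ Θ : B} {A : 𝒟.Ty Γ} {f : Θ ⟶ Γ} {A' : 𝒟.Ty Θ}
    (h : 𝒟.sub A f = A') :
    Reindexes₂ (𝒟.cart (I.Id_sub h)) (𝒟.cart (I.Id_sub h)) (I.contraction A')
      (I.contraction A) := by
  let _ := 𝒟.isIso (I.α A)
  let _ := 𝒟.isIso (I.α A')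
  have hs' : SameCell ((I.contraction A' ▷ 𝒟.cart (I.Id_sub h)) ▷ I.src A)
      (𝟙 (I.src A' ≫ 𝒟.cart h)) :=
    (sameCell_whiskerRight_comp _ _ _).trans <|
      (sameCell_whiskerRight_congr (I.src_cart h).symm _).trans <|
        (sameCell_whiskerRight_comp _ _ _).symm.trans ((I.contraction_src A').whiskerRight_id _)
  refine I.sameCell_of_src_tgt (h := I.src A' ≫ 𝒟.cart h ≫ A.proj) ?_ ?_ ?_ ?_ ?_
  · rw [Category.id_comp, Category.comp_id]
  · rw [Category.assoc, I.rArrow_sub h, ← Category.assoc, I.src_cart h, Category.assoc]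
  · exact (sameCell_whiskerRight_comp _ _ _).symm.trans <|
      (hs'.whiskerRight_id A.proj).trans (sameCell_id (Category.assoc _ _ _))
  · exact hs'.trans <| .trans (sameCell_id (I.src_cart h)) <|
      .trans ((I.contraction_src A).whiskerLeft_id _).symm
        (sameCell_whiskerLeft_whiskerRight _ _ _).symm
  · refine (sameCell_whiskerRight_comp _ _ _).trans <|
      (sameCell_whiskerRight_congr (I.tgt_cart h).symm _).trans <|
        (sameCell_whiskerRight_comp _ _ _).symm.trans <|
          ((I.contraction_tgt A').whiskerRight _).trans <| .trans ?_ <|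
            ((I.contraction_tgt A).whiskerLeft _).symm.trans
              (sameCell_whiskerLeft_whiskerRight _ _ _).symm
    exact Reindexes₂.inv (I.α_sub h)

section Elimination

variable {Γ : B} {A : 𝒟.Ty Γ} {M : 𝒟.Ty (I.Id A).ext} {r : A.ext ⟶ (I.Id A).ext}
  (hr : r = I.rArrow A) (c : SliceHom r M.proj)

/-- The arrow `r` is kept as a variable with `r = I.rArrow A` because the reflexivity arrow of
`toIdIntro` equals `rArrow` only propositionally; slices over it can then be used as they are. -/
theorem src_slice_proj (hr : r = I.rArrow A) (c : SliceHom r M.proj) :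
    (I.src A ≫ c.hom) ≫ M.proj = I.src A ≫ I.rArrow A := by
  rw [Category.assoc, c.comm, hr]

/-- The 2-cell along which the eliminator transports. -/
noncomputable def jCell : 𝟙 (I.Id A).ext ⟶ (I.src A ≫ c.hom) ≫ M.proj :=
  castCell rfl (I.src_slice_proj hr c).symm (I.contraction A)

theorem jCell_same : SameCell (I.jCell hr c) (I.contraction A) :=
  sameCell_castCell _ _ _

/-- The eliminator of identity types. -/
noncomputable def jTerm : Tm M :=
  ⟨𝒟.tr M (I.src A ≫ c.hom) (I.jCell hr c), 𝒟.tr_proj M (I.src A ≫ c.hom) (I.jCell hr c)⟩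

/-- The 2-cell that transports the eliminator. -/
noncomputable def jτ : (I.jTerm hr c).hom ⟶ I.src A ≫ c.hom :=
  𝒟.τ M (I.src A ≫ c.hom) (I.jCell hr c)

theorem jτ_proj : SameCell (I.jτ hr c ▷ M.proj) (I.contraction A) :=
  (𝒟.τ_proj M (I.src A ≫ c.hom) (I.jCell hr c)).trans (I.jCell_same hr c)

/-- Verticality over `Γ` is the hypothesis under which the transports of the isofibration structure
are stable. -/
theorem jCell_vertical : SameCell (I.jCell hr c ▷ (((I.Id A).proj ≫ (wk A).proj) ≫ A.proj))
    (𝟙 (𝟙 _ ≫ ((I.Id A).proj ≫ (wk A).proj) ≫ A.proj)) :=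
  ((I.jCell_same hr c).whiskerRight _).trans <|
    (I.contraction_vertical A).trans (sameCell_id (Category.id_comp _).symm)

theorem r_src_slice (hr : r = I.rArrow A) (c : SliceHom r M.proj) :
    r ≫ I.src A ≫ c.hom = c.hom := by
  subst hr
  rw [← Category.assoc, I.rArrow_src, Category.id_comp]

/-- The 2-cell of the computation rule of identity types. -/
noncomputable def hCell :
    (⟨r ≫ (I.jTerm hr c).hom, by rw [Category.assoc, Tm.hom_proj, Category.comp_id]⟩ :
      SliceHom r M.proj) ⟶ c where
  cell := castCell rfl (I.r_src_slice hr c) (r ◁ I.jτ hr c)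
  vertical := by
    refine ((sameCell_castCell _ _ _).whiskerRight _).trans <|
      (sameCell_whiskerLeft_whiskerRight _ _ _).trans <|
        ((I.jτ_proj hr c).whiskerLeft _).trans ?_
    -- What remains is the restriction of the contraction along reflexivity.
    subst hr
    exact I.rArrow_contraction A

variable {Θ : B} {f : Θ ⟶ Γ} {A' : 𝒟.Ty Θ} (h : 𝒟.sub A f = A') {M' : 𝒟.Ty (I.Id A').ext}
  (k : 𝒟.sub M (𝒟.cart (I.Id_sub h)) = M') {r' : A'.ext ⟶ (I.Id A').ext}
  (hr' : r' = I.rArrow A') {c' : SliceHom r' M'.proj} {c}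

/-- The types `A`, `A[P_A]` and `Id_A` form the telescope over which `M` lives, so `tr_sub_three`
applies once the transporting 2-cell and its endpoint are known to be stable. -/
theorem j_sub (hc : Reindexes₁ (𝒟.cart h) (𝒟.cart k) c'.hom c.hom) :
    Reindexes₁ (𝒟.cart (I.Id_sub h)) (𝒟.cart k) (I.jTerm hr' c').hom (I.jTerm hr c).hom ∧
    Reindexes₂ (𝒟.cart (I.Id_sub h)) (𝒟.cart k) (I.jτ hr' c') (I.jτ hr c) := by
  refine tr_sub_three h (wk_sub h) (I.Id_sub h) k (𝒟.cart (I.Id_sub h)) (I.jCell hr c)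
    (I.jCell hr' c') (I.jCell_vertical hr c) (I.jCell_vertical hr' c') ?_ ?_ ?_
  · unfold Reindexes₁ at *
    rw [Category.assoc, hc, ← Category.assoc, I.src_cart h, Category.assoc]
  · unfold Reindexes₁
    rw [Category.id_comp, Category.comp_id]
  · exact (I.contraction_sub h).congr (I.jCell_same _ _) (I.jCell_same _ _)

theorem hCell_sub (hc : Reindexes₁ (𝒟.cart h) (𝒟.cart k) c'.hom c.hom) :
    Reindexes₂ (𝒟.cart h) (𝒟.cart k) (I.hCell hr' c').cell (I.hCell hr c).cell := by
  refine (Reindexes₂.whiskerLeft (I.j_sub hr h k hr' hc).2 ?_).congr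
    (sameCell_castCell rfl _ _) (sameCell_castCell rfl _ _)
  rw [hr, hr', I.rArrow_sub h]

end Elimination

theorem jTerm_subst {Γ Θ : B} {A : 𝒟.Ty Γ} {f : Θ ⟶ Γ} {A' : 𝒟.Ty Θ} (h : 𝒟.sub A f = A')
    {M : 𝒟.Ty (I.Id A).ext} {M' : 𝒟.Ty (I.Id A').ext}
    (k : 𝒟.sub M (𝒟.cart (I.Id_sub h)) = M') (c : Tm (𝒟.sub M (I.toIdIntro.r A))) :
    (I.jTerm (I.toIdIntro_r A) (slice c)).subst k = I.jTerm (I.toIdIntro_r A')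
      (slice (c.subst (𝒟.sub_square (I.toIdIntro.r_sub h) k))) :=
  (Tm.eq_subst k (I.j_sub _ h k _ (reindexes_arrow (I.toIdIntro.r_sub h) k rfl)).1).symm

/-- The axiomatic identity types of the underlying display map category. -/
@[reducible]
noncomputable def toModel : 𝒟.toDisplayMapCategory.AxiomaticId where
  toIdIntro := I.toIdIntro
  J _ c := I.jTerm (I.toIdIntro_r _) (slice c)
  J_sub h _ _ k c := I.jTerm_subst h k c
  H _ c := I.ofSlice _ _ (arrow_sub _ _) rfl (I.hCell (I.toIdIntro_r _) (slice c))
  H_sub h _ _ k c := I.ofSlice_subst (I.toIdIntro.r_sub h) k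
    ((Tm.subst_square (I.toIdIntro.r_sub h) k _).trans
      (congrArg (Tm.sub · _) (I.jTerm_subst h k c))) rfl _ _ _ _
      (I.hCell_sub _ h k _ (reindexes_arrow (I.toIdIntro.r_sub h) k rfl)) _

end AxiomaticId

/-! ### Dependent sums: adjoint counit, elimination and computation. -/

namespace AxiomaticSigma

section Adjointification

variable {X Y : B} {p : X ⟶ Y} {π : Y ⟶ X} (η : 𝟙 Y ⟶ π ≫ p) (β : p ≫ π ⟶ 𝟙 X) [IsIso η] [IsIso β]

/-- The automorphism of `π` that measures the failure of the triangle identities. -/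
noncomputable def zigzag : π ⟶ π :=
  castCell (g' := (π ≫ p) ≫ π) (Category.comp_id π) (Category.assoc π p π).symm (π ◁ inv β) ≫
    castCell rfl (Category.id_comp π) (inv η ▷ π)

/-- The counit that makes an equivalence adjoint. -/
noncomputable def counit : p ≫ π ⟶ 𝟙 X := p ◁ zigzag η β ≫ β

/-- Up to coherence isomorphisms, all of them `eqToHom`s here, `counit` is the standard
adjointification of the counit. The explicit form is kept because its stability can be read off from
its factors. -/
theorem counit_eq : counit η β = (adjointifyCounit (asIso η) (asIso β)).hom := by
  simp [counit, zigzag, adjointifyCounit, bicategoricalIsoComp, castCell,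
    Strict.associator_eqToIso, Strict.leftUnitor_eqToIso, Strict.rightUnitor_eqToIso,
    BicategoricalCoherence.iso]

/-- One triangle identity of the adjoint equivalence. The factors enter through `SameCell`, since
without associators their boundaries would not compose literally. -/
theorem counit_triangle {x y z : X ⟶ Y} {q : x ⟶ y} {s : y ⟶ z} (hq : SameCell q (p ◁ η))
    (hs : SameCell s (counit η β ▷ p)) : SameCell (q ≫ s) (𝟙 p) := by
  have h := (Equivalence.mkOfAdjointifyCounit (asIso η) (asIso β)).right_triangle_hom
  obtain rfl := hs.left
  obtain rfl := hs.right
  obtain rfl := hq.left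
  obtain rfl := hs.eq
  have e : q = castCell rfl (Category.assoc p π p).symm (p ◁ η) :=
    (hq.trans (sameCell_castCell rfl _ _).symm).eq
  subst e
  rw [counit_eq]
  simp only [Equivalence.mkOfAdjointifyCounit, rightZigzag, bicategoricalComp] at h
  simp [Strict.associator_eqToIso, Strict.leftUnitor_eqToIso, Strict.rightUnitor_eqToIso,
    BicategoricalCoherence.iso] at h
  simp only [castCell, Category.assoc]
  exact (sameCell_eqToHom_comp _ _).trans <| (SameCell.of_eq h).trans <|
    (sameCell_eqToHom _).trans (sameCell_id (Category.comp_id p))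

/-- Re-indexing of 2-cells is preserved by inverses, whiskering and composition, and `zigzag` is
built from `η` and `β` by these operations. -/
theorem zigzag_same {X' Y' : B} {p' : X' ⟶ Y'} {π' : Y' ⟶ X'} (η' : 𝟙 Y' ⟶ π' ≫ p')
    (β' : p' ≫ π' ⟶ 𝟙 X') [IsIso η'] [IsIso β'] {m : X' ⟶ X} {n : Y' ⟶ Y}
    (hπ : Reindexes₁ n m π' π) (hη : Reindexes₂ n n η' η) (hβ : Reindexes₂ m m β' β) :
    Reindexes₂ n m (zigzag η' β') (zigzag η β) :=
  ((hβ.inv.whiskerLeft hπ).congr (sameCell_castCell _ _ _) (sameCell_castCell _ _ _)).comp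
    ((hη.inv.whiskerRight hπ).congr (sameCell_castCell rfl _ _) (sameCell_castCell rfl _ _))

theorem counit_same {X' Y' : B} {p' : X' ⟶ Y'} {π' : Y' ⟶ X'} (η' : 𝟙 Y' ⟶ π' ≫ p')
    (β' : p' ≫ π' ⟶ 𝟙 X') [IsIso η'] [IsIso β'] {m : X' ⟶ X} {n : Y' ⟶ Y}
    (hp : Reindexes₁ m n p' p) (hπ : Reindexes₁ n m π' π) (hη : Reindexes₂ n n η' η)
    (hβ : Reindexes₂ m m β' β) : Reindexes₂ m m (counit η' β') (counit η β) :=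
  ((zigzag_same η β η' β' hπ hη hβ).whiskerLeft hp).comp hβ

end Adjointification

variable (S : 𝒟.AxiomaticSigma)

/-- Dependent sum types with the pairing terms given by `p`. -/
@[reducible]
noncomputable def toSigmaIntro : 𝒟.toDisplayMapCategory.SigmaIntro where
  toSigmaFormer := S.toSigmaFormer
  pair A E := Tm.ofArrow (S.p A E) (S.p_proj A E)
  pair_sub {Γ Θ A E f A' E'} h k := by
    refine Tm.ext_arrow (𝒟.cart_hom_ext (S.Sig_sub h k) ?_ ?_)
    · refine (Tm.arrow_square (cart_cart_proj h k) (S.Sig_sub h k) _).trans ?_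
      rw [Tm.ofArrow_arrow, Tm.ofArrow_arrow, S.p_sub h k]
    · rw [Tm.arrow_proj, Tm.arrow_proj]

theorem toSigmaIntro_p {Γ : B} (A : 𝒟.Ty Γ) (E : 𝒟.Ty A.ext) : S.toSigmaIntro.p A E = S.p A E :=
  Tm.ofArrow_arrow _ (S.p_proj A E)

variable {Γ : B} {A : 𝒟.Ty Γ} {E : 𝒟.Ty A.ext} {M : 𝒟.Ty (S.Sig A E).ext}
  {q : E.ext ⟶ (S.Sig A E).ext} (hq : q = S.p A E) (c : SliceHom q M.proj)

theorem π_slice_proj (hq : q = S.p A E) (c : SliceHom q M.proj) :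
    (S.π A E ≫ c.hom) ≫ M.proj = S.π A E ≫ S.p A E := by
  rw [Category.assoc, c.comm, hq]

/-- The 2-cell along which the eliminator transports. -/
noncomputable def splitCell : 𝟙 (S.Sig A E).ext ⟶ (S.π A E ≫ c.hom) ≫ M.proj :=
  castCell rfl (S.π_slice_proj hq c).symm (S.η A E)

theorem splitCell_same : SameCell (S.splitCell hq c) (S.η A E) :=
  sameCell_castCell _ _ _

/-- The eliminator of dependent sum types. -/
noncomputable def splitTerm : Tm M :=
  ⟨𝒟.tr M (S.π A E ≫ c.hom) (S.splitCell hq c), 𝒟.tr_proj M (S.π A E ≫ c.hom) (S.splitCell hq c)⟩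

/-- The 2-cell that transports the eliminator. -/
noncomputable def splitτ : (S.splitTerm hq c).hom ⟶ S.π A E ≫ c.hom :=
  𝒟.τ M (S.π A E ≫ c.hom) (S.splitCell hq c)

theorem splitτ_proj : SameCell (S.splitτ hq c ▷ M.proj) (S.η A E) :=
  (𝒟.τ_proj M (S.π A E ≫ c.hom) (S.splitCell hq c)).trans (S.splitCell_same hq c)

theorem splitCell_vertical : SameCell (S.splitCell hq c ▷ (S.Sig A E).proj)
    (𝟙 (𝟙 _ ≫ (S.Sig A E).proj)) :=
  ((S.splitCell_same hq c).whiskerRight _).trans <|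
    (S.η_vertical A E).trans (sameCell_id (Category.id_comp _).symm)

/-- The adjoint counit of the equivalence of dependent sum types. -/
noncomputable def adjCounit {Γ : B} (A : 𝒟.Ty Γ) (E : 𝒟.Ty A.ext) : S.p A E ≫ S.π A E ⟶ 𝟙 E.ext :=
  have := 𝒟.isIso (S.η A E)
  have := 𝒟.isIso (S.β A E)
  counit (S.η A E) (S.β A E)

theorem adjCounit_triangle {Γ : B} (A : 𝒟.Ty Γ) (E : 𝒟.Ty A.ext)
    {x y z : E.ext ⟶ (S.Sig A E).ext} {q : x ⟶ y} {s : y ⟶ z}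
    (hq : SameCell q (S.p A E ◁ S.η A E)) (hs : SameCell s (S.adjCounit A E ▷ S.p A E)) :
    SameCell (q ≫ s) (𝟙 (S.p A E)) :=
  have := 𝒟.isIso (S.η A E)
  have := 𝒟.isIso (S.β A E)
  counit_triangle (S.η A E) (S.β A E) hq hs

theorem adjCounit_sub {Γ Θ : B} {A : 𝒟.Ty Γ} {E : 𝒟.Ty A.ext} {f : Θ ⟶ Γ} {A' : 𝒟.Ty Θ}
    {E' : 𝒟.Ty A'.ext} (h : 𝒟.sub A f = A') (k : 𝒟.sub E (𝒟.cart h) = E') :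
    Reindexes₂ (𝒟.cart k) (𝒟.cart k) (S.adjCounit A' E') (S.adjCounit A E) :=
  have := 𝒟.isIso (S.η A E)
  have := 𝒟.isIso (S.β A E)
  have := 𝒟.isIso (S.η A' E')
  have := 𝒟.isIso (S.β A' E')
  counit_same (S.η A E) (S.β A E) (S.η A' E') (S.β A' E') (S.p_sub h k) (S.π_sub h k)
    (S.η_sub h k) (S.β_sub h k)

theorem q_π_slice (hq : q = S.p A E) (c : SliceHom q M.proj) :
    q ≫ S.π A E ≫ c.hom = (S.p A E ≫ S.π A E) ≫ c.hom := by
  subst hq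
  rw [Category.assoc]

/-- The 2-cell of the computation rule of dependent sum types. -/
noncomputable def σCell :
    (⟨q ≫ (S.splitTerm hq c).hom, by rw [Category.assoc, Tm.hom_proj, Category.comp_id]⟩ :
      SliceHom q M.proj) ⟶ c where
  cell := castCell rfl (S.q_π_slice hq c) (q ◁ S.splitτ hq c) ≫
    castCell rfl (Category.id_comp _) (S.adjCounit A E ▷ c.hom)
  vertical := by
    have hc : c.hom ≫ M.proj = S.p A E := c.comm.trans hq
    have h₁ : SameCell ((castCell rfl (S.q_π_slice hq c) (q ◁ S.splitτ hq c)) ▷ M.proj)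
        (S.p A E ◁ S.η A E) :=
      ((sameCell_castCell _ _ _).whiskerRight _).trans <|
        (sameCell_whiskerLeft_whiskerRight _ _ _).trans <|
          ((S.splitτ_proj hq c).whiskerLeft _).trans (sameCell_whiskerLeft_congr hq _)
    have h₂ : SameCell ((castCell rfl (Category.id_comp _) (S.adjCounit A E ▷ c.hom)) ▷ M.proj)
        (S.adjCounit A E ▷ S.p A E) :=
      ((sameCell_castCell _ _ _).whiskerRight _).trans <| (sameCell_whiskerRight_comp _ _ _).trans <|
        sameCell_whiskerRight_congr hc _
    rw [comp_whiskerRight]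
    -- The transport contributes the whiskering of `η` by `p`, and the counit its own whiskering by
    -- `p`; the triangle identity cancels them, so the composite lies over the identity of `p`.
    exact (S.adjCounit_triangle A E h₁ h₂).trans (sameCell_id hq.symm)

section Stability

variable {Θ : B} {f : Θ ⟶ Γ} {A' : 𝒟.Ty Θ} {E' : 𝒟.Ty A'.ext} (h : 𝒟.sub A f = A')
  (k : 𝒟.sub E (𝒟.cart h) = E') {M' : 𝒟.Ty (S.Sig A' E').ext}
  (l : 𝒟.sub M (𝒟.cart (S.Sig_sub h k)) = M') {q' : E'.ext ⟶ (S.Sig A' E').ext}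
  (hq' : q' = S.p A' E') {c' : SliceHom q' M'.proj} {c}

theorem split_reindexes (hc : Reindexes₁ (𝒟.cart k) (𝒟.cart l) c'.hom c.hom) :
    Reindexes₁ (𝒟.cart (S.Sig_sub h k)) (𝒟.cart l) (S.splitTerm hq' c').hom
      (S.splitTerm hq c).hom ∧
    Reindexes₂ (𝒟.cart (S.Sig_sub h k)) (𝒟.cart l) (S.splitτ hq' c') (S.splitτ hq c) := by
  refine tr_sub_one (S.Sig_sub h k) l (𝒟.cart (S.Sig_sub h k)) (S.splitCell hq c)
    (S.splitCell hq' c') (S.splitCell_vertical hq c) (S.splitCell_vertical hq' c') ?_ ?_ ?_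
  · have := S.π_sub h k
    unfold Reindexes₁ at *
    rw [Category.assoc, hc, ← Category.assoc, this, Category.assoc]
  · unfold Reindexes₁
    rw [Category.id_comp, Category.comp_id]
  · exact (S.η_sub h k).congr (S.splitCell_same _ _) (S.splitCell_same _ _)

theorem σCell_sub (hc : Reindexes₁ (𝒟.cart k) (𝒟.cart l) c'.hom c.hom) :
    Reindexes₂ (𝒟.cart k) (𝒟.cart l) (S.σCell hq' c').cell (S.σCell hq c).cell := by
  refine Reindexes₂.comp (Reindexes₂.congr (Reindexes₂.whiskerLeft
      (S.split_reindexes hq h k l hq' hc).2 ?_)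
    (sameCell_castCell rfl _ _) (sameCell_castCell rfl _ _))
    (((S.adjCounit_sub h k).whiskerRight hc).congr (sameCell_castCell rfl _ _)
      (sameCell_castCell rfl _ _))
  rw [hq, hq']
  exact S.p_sub h k

end Stability

theorem splitTerm_subst {Γ Θ : B} {A : 𝒟.Ty Γ} {E : 𝒟.Ty A.ext} {f : Θ ⟶ Γ} {A' : 𝒟.Ty Θ}
    {E' : 𝒟.Ty A'.ext} (h : 𝒟.sub A f = A') (k : 𝒟.sub E (𝒟.cart h) = E')
    {M : 𝒟.Ty (S.Sig A E).ext} {M' : 𝒟.Ty (S.Sig A' E').ext}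
    (l : 𝒟.sub M (𝒟.cart (S.Sig_sub h k)) = M') (c : Tm (𝒟.sub M (S.toSigmaIntro.p A E))) :
    (S.splitTerm (S.toSigmaIntro_p A E) (slice c)).subst l = S.splitTerm (S.toSigmaIntro_p A' E')
      (slice (c.subst (𝒟.sub_square (S.toSigmaIntro.p_sub h k) l))) :=
  (Tm.eq_subst l (S.split_reindexes _ h k l _
    (reindexes_arrow (S.toSigmaIntro.p_sub h k) l rfl)).1).symm

/-- The axiomatic dependent sum types of the underlying display map category. -/
noncomputable def toModel (I : 𝒟.AxiomaticId) :
    𝒟.toDisplayMapCategory.AxiomaticSigma I.toIdFormer where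
  toSigmaIntro := S.toSigmaIntro
  split _ c := S.splitTerm (S.toSigmaIntro_p _ _) (slice c)
  split_sub h k _ _ l c := S.splitTerm_subst h k l c
  σ _ c := I.ofSlice _ _ (arrow_sub _ _) rfl (S.σCell (S.toSigmaIntro_p _ _) (slice c))
  σ_sub h k _ _ l c := I.ofSlice_subst (S.toSigmaIntro.p_sub h k) l
    ((Tm.subst_square (S.toSigmaIntro.p_sub h k) l _).trans
      (congrArg (Tm.sub · _) (S.splitTerm_subst h k l c))) rfl _ _ _ _
      (S.σCell_sub _ h k l _ (reindexes_arrow (S.toSigmaIntro.p_sub h k) l rfl)) _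

end AxiomaticSigma

/-! ### Empty, unit and two-element types. -/

/-- The axiomatic empty types of the underlying display map category. -/
def AxiomaticEmpty.toModel (T : 𝒟.AxiomaticEmpty) :
    𝒟.toDisplayMapCategory.AxiomaticEmpty where
  toEmptyFormer := T.toEmptyFormer
  ind M := ofSect ((T.ind M).inv.obj ⟨⟨⟩⟩)
  ind_sub f _ _ k := ofSect_subst _ (T.ind_sub f k)

namespace AxiomaticUnit

variable (T : 𝒟.AxiomaticUnit)

theorem ind_subst {Γ Θ : B} (f : Θ ⟶ Γ) {M : 𝒟.Ty (T.T Γ).ext} {M' : 𝒟.Ty (T.T Θ).ext}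
    (k : 𝒟.sub M (𝒟.cart (T.T_sub f)) = M') (c : Tm (𝒟.sub M (T.star Γ).hom)) :
    (ofSect ((T.ind M).inv.obj (slice c))).subst k = ofSect ((T.ind M').inv.obj
      (slice (c.subst (𝒟.sub_square (term_square (T.star_sub f)) k)))) :=
  ofSect_subst _ (T.ind_obj_sub f k (slice _) (slice c)
    (reindexes_arrow (term_square (T.star_sub f)) k rfl))

/-- The axiomatic unit types of the underlying display map category. -/
noncomputable def toModel (I : 𝒟.AxiomaticId) :
    𝒟.toDisplayMapCategory.AxiomaticUnit I.toIdFormer where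
  toUnitFormer := T.toUnitFormer
  ind M c := ofSect ((T.ind M).inv.obj (slice c))
  ind_sub f _ _ k c := T.ind_subst f k c
  β M c := I.ofSlice _ _ (arrow_sub _ _) rfl ((T.ind M).β.hom.app (slice c))
  β_sub f _ _ k c := I.ofSlice_subst (term_square (T.star_sub f)) k
    ((Tm.subst_square (term_square (T.star_sub f)) k _).trans
      (congrArg (Tm.sub · _) (T.ind_subst f k c))) rfl _ _ _ _
    (T.β_sub f k _ _ (reindexes_arrow (term_square (T.star_sub f)) k rfl)) _

end AxiomaticUnit

namespace AxiomaticBool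

variable (T : 𝒟.AxiomaticBool)

theorem ind_subst {Γ Θ : B} (f : Θ ⟶ Γ) {M : 𝒟.Ty (T.T Γ).ext} {M' : 𝒟.Ty (T.T Θ).ext}
    (k : 𝒟.sub M (𝒟.cart (T.T_sub f)) = M') (c : Tm (𝒟.sub M (T.bot Γ).hom))
    (d : Tm (𝒟.sub M (T.top Γ).hom)) :
    (ofSect ((T.ind M).inv.obj (slice c, slice d))).subst k = ofSect ((T.ind M').inv.obj
      (slice (c.subst (𝒟.sub_square (term_square (T.bot_sub f)) k)),
        slice (d.subst (𝒟.sub_square (term_square (T.top_sub f)) k)))) :=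
  ofSect_subst _ (T.ind_obj_sub f k (slice _, slice _) (slice c, slice d)
    (reindexes_arrow (term_square (T.bot_sub f)) k rfl)
    (reindexes_arrow (term_square (T.top_sub f)) k rfl))

/-- The axiomatic two-element types of the underlying display map category. -/
noncomputable def toModel (I : 𝒟.AxiomaticId) :
    𝒟.toDisplayMapCategory.AxiomaticBool I.toIdFormer where
  toBoolFormer := T.toBoolFormer
  ind M c d := ofSect ((T.ind M).inv.obj (slice c, slice d))
  ind_sub f _ _ k c d := T.ind_subst f k c d
  βbot M c d := I.ofSlice _ _ (arrow_sub _ _) rfl ((T.ind M).β.hom.app (slice c, slice d)).1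
  βtop M c d := I.ofSlice _ _ (arrow_sub _ _) rfl ((T.ind M).β.hom.app (slice c, slice d)).2
  βbot_sub f _ _ k c d := I.ofSlice_subst (term_square (T.bot_sub f)) k
    ((Tm.subst_square (term_square (T.bot_sub f)) k _).trans
      (congrArg (Tm.sub · _) (T.ind_subst f k c d))) rfl _ _ _ _
    (T.β_sub f k (slice _, slice _) (slice c, slice d)
      (reindexes_arrow (term_square (T.bot_sub f)) k rfl)
      (reindexes_arrow (term_square (T.top_sub f)) k rfl)).1 _
  βtop_sub f _ _ k c d := I.ofSlice_subst (term_square (T.top_sub f)) k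
    ((Tm.subst_square (term_square (T.top_sub f)) k _).trans
      (congrArg (Tm.sub · _) (T.ind_subst f k c d))) rfl _ _ _ _
    (T.β_sub f k (slice _, slice _) (slice c, slice d)
      (reindexes_arrow (term_square (T.bot_sub f)) k rfl)
      (reindexes_arrow (term_square (T.top_sub f)) k rfl)).2 _

end AxiomaticBool

/-! ### Natural numbers. -/

/-- Translates the syntactic step `d(n, x(n))` into composition of arrows, the form in which the
2-cell `atSucc` of an algebra has its target. -/
theorem step_arrow {𝒩 : 𝒟.toDisplayMapCategory.NatFormer} {Γ : B} {M : 𝒟.Ty (𝒩.N Γ).ext}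
    (d : Tm (𝒟.sub M (M.proj ≫ 𝒩.s Γ))) (x : Tm M) :
    (𝒩.step d x).arrow = x.hom ≫ d.arrow := by
  have e : x.hom ≫ M.proj ≫ 𝒩.s Γ = 𝒩.s Γ := by
    rw [← Category.assoc, x.hom_proj, Category.id_comp]
  have h := 𝒟.cart_trans (rfl : 𝒟.sub M (M.proj ≫ 𝒩.s Γ) = _) (NatFormer.step_type x)
  have h' : 𝒟.lift M (𝒩.s Γ) = _ :=
    (𝒟.cart_rfl _ _).symm.trans ((𝒟.cart_congr e.symm _ _).trans h)
  unfold Tm.arrow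
  refine (congrArg (_ ≫ ·) h').trans <| (Category.assoc _ _ _).symm.trans <|
    (congrArg (· ≫ _) (Tm.subst_hom_cart _ _)).trans <| (Category.assoc _ _ _).trans ?_
  rw [cart_rfl]

namespace AxiomaticNat

variable (T : 𝒟.AxiomaticNat)

theorem toNatFormer_s (Γ : B) : T.toNatData.toNatFormer.s Γ = T.s Γ :=
  Tm.ofArrow_arrow _ (T.s_proj Γ)

/-- The arrow of a step term, as an object of the slice over the successor. -/
noncomputable def stepSlice {Γ : B} {M : 𝒟.Ty (T.N Γ).ext}
    (d : Tm (𝒟.sub M (M.proj ≫ T.toNatData.toNatFormer.s Γ))) :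
    SliceHom (M.proj ≫ T.s Γ) M.proj :=
  ⟨d.arrow, d.arrow_proj.trans (congrArg (M.proj ≫ ·) (T.toNatFormer_s Γ))⟩

/-- The chosen algebra of a zero term and a step term. -/
noncomputable def indAlg {Γ : B} {M : 𝒟.Ty (T.N Γ).ext} (c : Tm (𝒟.sub M (T.zero Γ).hom))
    (d : Tm (𝒟.sub M (M.proj ≫ T.toNatData.toNatFormer.s Γ))) :
    T.toNatData.Alg M (slice c) (T.stepSlice d) :=
  T.ind M (slice c) (T.stepSlice d)

section Successor

variable {Γ : B} {M : 𝒟.Ty (T.N Γ).ext} (c : Tm (𝒟.sub M (T.zero Γ).hom))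
  (d : Tm (𝒟.sub M (M.proj ≫ T.toNatData.toNatFormer.s Γ)))

/-- The 2-cell of the computation rule for successors. -/
noncomputable def succCell {s : (T.N Γ).ext ⟶ (T.N Γ).ext} (hs : s = T.s Γ)
    (y : SliceHom s M.proj) (hy : y.hom = (T.indAlg c d).sec.hom ≫ d.arrow) :
    (⟨s ≫ (T.indAlg c d).sec.hom, by
      rw [Category.assoc, (T.indAlg c d).sec.comm, Category.comp_id]⟩ : SliceHom s M.proj) ⟶ y where
  cell := castCell (congrArg (· ≫ _) hs.symm) hy.symm (T.indAlg c d).atSucc.cell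
  vertical := ((sameCell_castCell _ _ _).whiskerRight _).trans <|
    (T.indAlg c d).atSucc.vertical.trans (sameCell_id hs.symm)

/-- The change of boundary in `succCell` is invisible to re-indexing, so its stability is that of
`atSucc`. -/
theorem succCell_same {s : (T.N Γ).ext ⟶ (T.N Γ).ext} (hs : s = T.s Γ)
    (y : SliceHom s M.proj) (hy : y.hom = (T.indAlg c d).sec.hom ≫ d.arrow) :
    SameCell (T.succCell c d hs y hy).cell (T.indAlg c d).atSucc.cell :=
  sameCell_castCell (congrArg (· ≫ _) hs.symm) hy.symm _

theorem ind_subst {Θ : B} (f : Θ ⟶ Γ) {M' : 𝒟.Ty (T.N Θ).ext}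
    (k : 𝒟.sub M (𝒟.cart (T.N_sub f)) = M') :
    (ofSect (T.indAlg c d).sec).subst k = ofSect (T.indAlg
      (c.subst (𝒟.sub_square (term_square (T.zero_sub f)) k))
      (d.subst (𝒟.sub_square (T.toNatData.toNatFormer.proj_s_sub f k) k))).sec :=
  ofSect_subst _ (T.sec_sub f k _ _ _ _ (reindexes_arrow (term_square (T.zero_sub f)) k rfl)
    (reindexes_arrow (T.toNatData.toNatFormer.proj_s_sub f k) k rfl))

end Successor

/-- The axiomatic natural numbers types of the underlying display map category. -/
noncomputable def toModel (I : 𝒟.AxiomaticId) :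
    𝒟.toDisplayMapCategory.AxiomaticNat I.toIdFormer where
  toNatFormer := T.toNatData.toNatFormer
  ind _ c d := ofSect (T.indAlg c d).sec
  ind_sub f _ _ k c d := T.ind_subst c d f k
  βzero _ c d := I.ofSlice _ _ (arrow_sub _ _) rfl (T.indAlg c d).atZero
  βsucc _ c d := I.ofSlice _ _ (arrow_sub _ _) rfl (T.succCell c d (T.toNatFormer_s _)
    (slice (T.toNatData.toNatFormer.step d (ofSect (T.indAlg c d).sec))) (step_arrow _ _))
  βzero_sub f _ _ k c d := I.ofSlice_subst (term_square (T.zero_sub f)) k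
    ((Tm.subst_square (term_square (T.zero_sub f)) k _).trans
      (congrArg (Tm.sub · _) (T.ind_subst c d f k))) rfl _ _ _ _
    (T.atZero_sub f k _ _ (T.stepSlice _) (T.stepSlice d) (reindexes_arrow (term_square (T.zero_sub f)) k rfl)
      (reindexes_arrow (T.toNatData.toNatFormer.proj_s_sub f k) k rfl)) _
  βsucc_sub f _ _ k c d := I.ofSlice_subst (T.toNatData.toNatFormer.s_sub f) k
    ((Tm.subst_square (T.toNatData.toNatFormer.s_sub f) k _).trans
      (congrArg (Tm.sub · _) (T.ind_subst c d f k)))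
    (T.toNatData.toNatFormer.step_sub f k d (T.ind_subst c d f k)) _ _ _ _
    ((T.atSucc_sub f k _ _ (T.stepSlice _) (T.stepSlice d) (reindexes_arrow (term_square (T.zero_sub f)) k rfl)
      (reindexes_arrow (T.toNatData.toNatFormer.proj_s_sub f k) k rfl)).congr
      (T.succCell_same _ _ _ _ _) (T.succCell_same _ _ _ _ _)) _

end AxiomaticNat

/-! ### Dependent products: stability of application, evaluation and abstraction. -/

theorem sameCell_map_of_eq {X : Type*} [Category* X] {Γ Θ E : B} {h : Θ ⟶ Γ} {P : E ⟶ Γ}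
    {F G : X ⥤ SliceHom h P} (e : F = G) {x y : X} (p : x ⟶ y) :
    SameCell (F.map p).cell (G.map p).cell := by
  subst e
  rfl

namespace AxiomaticPi

variable (P : 𝒟.AxiomaticPi)

theorem app_map_congr {Γ Θ : B} {A : 𝒟.Ty Γ} {E : 𝒟.Ty A.ext} {f f' : Θ ⟶ Γ} {A₁ : 𝒟.Ty Θ}
    (e : f = f') (h : 𝒟.sub A f = A₁) (h' : 𝒟.sub A f' = A₁)
    {x y : SliceHom f (P.Pi A E).proj} {x' y' : SliceHom f' (P.Pi A E).proj} {p : x ⟶ y}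
    {p' : x' ⟶ y'} (hp : SameCell p.cell p'.cell) :
    SameCell ((P.app A E h).map p).cell ((P.app A E h').map p').cell := by
  subst e
  obtain rfl : x = x' := SliceHom.ext hp.left
  obtain rfl : y = y' := SliceHom.ext hp.right
  obtain rfl : p = p' := SliceHom.Hom.ext hp.eq
  rfl

/-- Naturality `app_nat` with a free name for the base arrow: the boundaries of the 2-cells force it
to be `g ≫ f`. -/
theorem app_map_pre {Γ Θ Ω : B} {A : 𝒟.Ty Γ} {E : 𝒟.Ty A.ext} {f : Θ ⟶ Γ} {A₁ : 𝒟.Ty Θ}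
    (h : 𝒟.sub A f = A₁) {g : Ω ⟶ Θ} {A₂ : 𝒟.Ty Ω} (h₁ : 𝒟.sub A₁ g = A₂) {f' : Ω ⟶ Γ}
    (h' : 𝒟.sub A f' = A₂) {x y : SliceHom f (P.Pi A E).proj}
    {x' y' : SliceHom f' (P.Pi A E).proj} {p : x ⟶ y} {p' : x' ⟶ y'}
    (hp : SameCell p'.cell (g ◁ p.cell)) :
    SameCell ((P.app A E h').map p').cell (𝒟.cart h₁ ◁ ((P.app A E h).map p).cell) := by
  have e : f' = g ≫ f := by
    rw [← x'.comm, hp.left, Category.assoc, x.comm]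
  exact (P.app_map_congr e h' (𝒟.sub_trans h h₁)
    (p' := (SliceHom.pre (P.Pi A E).proj g rfl).map p) hp).trans
      (sameCell_map_of_eq (P.app_nat A E h h₁) p)

/-- Combines the two kinds of stability of `app`, along a change of the base of `Π` and along
precomposition. The given re-indexing laws mention sections only, so arrows over `g'` are first
turned into sections of a further re-indexed product. -/
theorem app_map_reindexes {Γ Θ Ω Ω' : B} {A : 𝒟.Ty Γ} {E : 𝒟.Ty A.ext} {f : Θ ⟶ Γ}
    {A' : 𝒟.Ty Θ} {E' : 𝒟.Ty A'.ext} (h : 𝒟.sub A f = A') (k : 𝒟.sub E (𝒟.cart h) = E')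
    {g : Ω ⟶ Γ} {A₁ : 𝒟.Ty Ω} (hA : 𝒟.sub A g = A₁) {g' : Ω' ⟶ Θ} {A₁' : 𝒟.Ty Ω'}
    (hA' : 𝒟.sub A' g' = A₁') {m : Ω' ⟶ Ω} (hm : 𝒟.sub A₁ m = A₁')
    {x y : SliceHom g (P.Pi A E).proj} {x' y' : SliceHom g' (P.Pi A' E').proj} {p : x ⟶ y}
    {p' : x' ⟶ y'} (hp : Reindexes₂ m (𝒟.cart (P.Pi_sub h k)) p'.cell p.cell) :
    Reindexes₂ (𝒟.cart hm) (𝒟.cart k) ((P.app A' E' hA').map p').cell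
      ((P.app A E hA).map p).cell := by
  let E₁ := 𝒟.sub E' (𝒟.cart hA')
  have hE₁ : 𝒟.sub E (𝒟.cart (𝒟.sub_trans h hA')) = E₁ := by
    rw [𝒟.cart_trans h hA', 𝒟.sub_comp, k]
  have hc : 𝒟.cart hE₁ = 𝒟.cart (rfl : 𝒟.sub E' (𝒟.cart hA') = E₁) ≫ 𝒟.cart k :=
    (𝒟.cart_congr (𝒟.cart_trans h hA') _ _).trans (𝒟.cart_trans k rfl)
  have hPi : 𝒟.cart (P.Pi_sub (𝒟.sub_trans h hA') hE₁) =
      𝒟.cart (P.Pi_sub hA' (rfl : _ = E₁)) ≫ 𝒟.cart (P.Pi_sub h k) :=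
    𝒟.cart_trans (P.Pi_sub h k) (P.Pi_sub hA' (rfl : _ = E₁))
  have hsec : ∀ z : SliceHom g' (P.Pi A' E').proj, ∃ z₁ : 𝒟.Sect (P.Pi A₁' E₁),
      z₁.hom ≫ 𝒟.cart (P.Pi_sub hA' (rfl : _ = E₁)) = z.hom := fun z =>
    ⟨⟨(𝒟.cart_isPullback (P.Pi_sub hA' (rfl : _ = E₁))).lift z.hom (𝟙 _)
      (by rw [z.comm, Category.id_comp]), IsPullback.lift_snd _ _ _ _⟩,
      IsPullback.lift_fst _ _ _ _⟩
  obtain ⟨x₁, hx₁⟩ := hsec x'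
  obtain ⟨y₁, hy₁⟩ := hsec y'
  obtain ⟨q, hq⟩ := exists_sliceHom_cart (P.Pi_sub hA' (rfl : _ = E₁)) hx₁ hy₁ p'
  let post (z : SliceHom g' (P.Pi A' E').proj) : SliceHom (g' ≫ f) (P.Pi A E).proj :=
    ⟨z.hom ≫ 𝒟.cart (P.Pi_sub h k), by rw [Category.assoc, 𝒟.cart_proj, ← Category.assoc, z.comm]⟩
  let p'' : post x' ⟶ post y' := ⟨p'.cell ▷ 𝒟.cart (P.Pi_sub h k),
    (sameCell_whiskerRight_comp _ _ _).trans <|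
      (sameCell_whiskerRight_congr (𝒟.cart_proj _) _).trans <|
        (sameCell_whiskerRight_comp _ _ _).symm.trans (p'.vertical.whiskerRight_id f)⟩
  -- The same 2-cell `q` of sections is pushed forward once to `A'` and once all the way to `A`;
  -- comparing the two results gives the change of base, and `app_map_pre` gives the change of
  -- context.
  have h₁ := P.app_map_sub hA' (rfl : _ = E₁) q p' hq
  have h₂ := P.app_map_sub (𝒟.sub_trans h hA') hE₁ q p'' <|
    (sameCell_whiskerRight_congr hPi _).trans <| (sameCell_whiskerRight_comp _ _ _).symm.trans <|
      hq.whiskerRight _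
  have h₃ := P.app_map_pre hA hm (𝒟.sub_trans h hA') (p := p) (p' := p'') hp
  exact (h₁.whiskerRight _).symm.trans <| (sameCell_whiskerRight_comp _ _ _).trans <|
    (sameCell_whiskerRight_congr hc _).symm.trans (h₂.trans h₃)

/-- Statements on objects are the boundaries of the statements on 2-cells, taken at identities. -/
theorem app_obj_pre {Γ Θ Ω : B} {A : 𝒟.Ty Γ} {E : 𝒟.Ty A.ext} {f : Θ ⟶ Γ} {A₁ : 𝒟.Ty Θ}
    (h : 𝒟.sub A f = A₁) {g : Ω ⟶ Θ} {A₂ : 𝒟.Ty Ω} (h₁ : 𝒟.sub A₁ g = A₂) {f' : Ω ⟶ Γ}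
    (h' : 𝒟.sub A f' = A₂) {x : SliceHom f (P.Pi A E).proj} {x' : SliceHom f' (P.Pi A E).proj}
    (hx : x'.hom = g ≫ x.hom) :
    ((P.app A E h').obj x').hom = 𝒟.cart h₁ ≫ ((P.app A E h).obj x).hom :=
  (P.app_map_pre h h₁ h' (p := 𝟙 x) (p' := 𝟙 x')
    ((sameCell_id hx).trans (SameCell.whiskerLeft_id g (.refl (𝟙 x.hom))).symm)).left

theorem app_obj_reindexes {Γ Θ Ω Ω' : B} {A : 𝒟.Ty Γ} {E : 𝒟.Ty A.ext} {f : Θ ⟶ Γ}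
    {A' : 𝒟.Ty Θ} {E' : 𝒟.Ty A'.ext} (h : 𝒟.sub A f = A') (k : 𝒟.sub E (𝒟.cart h) = E')
    {g : Ω ⟶ Γ} {A₁ : 𝒟.Ty Ω} (hA : 𝒟.sub A g = A₁) {g' : Ω' ⟶ Θ} {A₁' : 𝒟.Ty Ω'}
    (hA' : 𝒟.sub A' g' = A₁') {m : Ω' ⟶ Ω} (hm : 𝒟.sub A₁ m = A₁')
    {x : SliceHom g (P.Pi A E).proj} {x' : SliceHom g' (P.Pi A' E').proj}
    (hx : Reindexes₁ m (𝒟.cart (P.Pi_sub h k)) x'.hom x.hom) :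
    Reindexes₁ (𝒟.cart hm) (𝒟.cart k) ((P.app A' E' hA').obj x').hom
      ((P.app A E hA).obj x).hom :=
  (P.app_map_reindexes h k hA hA' hm (p := 𝟙 x) (p' := 𝟙 x') (Reindexes₂.id hx)).left

/-- Evaluation, as an object of the slice over `A[P_Π]`. -/
def evSlice {Γ : B} (A : 𝒟.Ty Γ) (E : 𝒟.Ty A.ext) :
    SliceHom (𝒟.cart (rfl : 𝒟.sub A (P.Pi A E).proj = _)) E.proj :=
  (P.app A E rfl).obj ⟨𝟙 _, Category.id_comp _⟩

theorem evSlice_proj {Γ : B} (A : 𝒟.Ty Γ) (E : 𝒟.Ty A.ext) :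
    (P.evSlice A E).hom ≫ E.proj = 𝒟.lift A (P.Pi A E).proj :=
  (P.evSlice A E).comm.trans (𝒟.cart_rfl _ _)

/-- Dependent product types with evaluation. -/
@[reducible]
noncomputable def toPiEval : 𝒟.toDisplayMapCategory.PiEval where
  toPiFormer := P.toPiFormer
  ev A E := Tm.ofArrow (P.evSlice A E).hom (P.evSlice_proj A E)
  ev_sub {Γ Θ A E f A' E'} h k := by
    refine Tm.ext_arrow (𝒟.cart_hom_ext k ?_ ?_)
    · refine (Tm.arrow_square (P.toPiFormer.dom_sub_lift h k) k _).trans ?_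
      rw [Tm.ofArrow_arrow, Tm.ofArrow_arrow]
      refine (P.app_obj_reindexes h k rfl rfl (P.toPiFormer.dom_sub h k) ?_).symm
      unfold Reindexes₁
      rw [Category.id_comp, Category.comp_id]
    · rw [Tm.arrow_proj, Tm.arrow_proj]

/-- A Yoneda argument: every `z` is the precomposition with `z` of the identity of `Γ.Π`, so by
naturality `app` at `z` is evaluation re-indexed along `z`. -/
theorem evAt_cart {Γ Θ : B} {A : 𝒟.Ty Γ} {E : 𝒟.Ty A.ext} {f : Θ ⟶ Γ} {A' : 𝒟.Ty Θ}
    {E' : 𝒟.Ty A'.ext} (h : 𝒟.sub A f = A') (k : 𝒟.sub E (𝒟.cart h) = E')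
    (z : Θ ⟶ (P.Pi A E).ext) (hz : z ≫ (P.Pi A E).proj = f) :
    (P.toPiEval.evAt h k z hz).hom ≫ 𝒟.cart k = ((P.app A E h).obj ⟨z, hz⟩).hom := by
  refine (P.toPiEval.evAt_cart h k z hz).trans ?_
  refine (congrArg (_ ≫ ·) (Tm.ofArrow_arrow _ (P.evSlice_proj A E))).trans ?_
  exact (P.app_obj_pre rfl (P.toPiEval.dom_term h hz) h (Category.comp_id z).symm).symm

theorem cart_sub_cart_id {Γ : B} {A : 𝒟.Ty Γ} (E : 𝒟.Ty A.ext) :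
    𝒟.cart (PiEval.sub_cart_id E) = 𝟙 E.ext :=
  (𝒟.cart_congr (𝒟.cart_id A) _ _).trans (𝒟.cart_id E)

theorem app_hom {Γ : B} {A : 𝒟.Ty Γ} {E : 𝒟.Ty A.ext} (z : Tm (P.Pi A E)) :
    (P.toPiEval.app z).hom = ((P.app A E (𝒟.sub_id A)).obj (sect z)).hom := by
  refine Eq.trans ?_ (P.evAt_cart (𝒟.sub_id A) (PiEval.sub_cart_id E) z.hom z.hom_proj)
  rw [cart_sub_cart_id]
  exact (Category.comp_id _).symm

/-- A term of type `E` as an object of the slice over `1.A`. -/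
def idSlice {Γ : B} {A : 𝒟.Ty Γ} {E : 𝒟.Ty A.ext} (υ : Tm E) :
    SliceHom (𝒟.cart (𝒟.sub_id A)) E.proj :=
  ⟨υ.hom, υ.hom_proj.trans (𝒟.cart_id A).symm⟩

/-- Needed because naturality of `lam` and `β` at a section yields arrows over `f ≫ 𝟙 Γ`, whereas
re-indexing yields arrows over `f`. -/
theorem lam_congr {Γ Θ : B} {A : 𝒟.Ty Γ} {E : 𝒟.Ty A.ext} {f f' : Θ ⟶ Γ} {A₁ : 𝒟.Ty Θ}
    (e : f = f') (h : 𝒟.sub A f = A₁) (h' : 𝒟.sub A f' = A₁)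
    {x : SliceHom (𝒟.cart h) E.proj} {x' : SliceHom (𝒟.cart h') E.proj} (hx : x.hom = x'.hom) :
    ((P.lam A E h).obj x).hom = ((P.lam A E h').obj x').hom ∧
      SameCell ((P.β A E h).hom.app x).cell ((P.β A E h').hom.app x').cell := by
  subst e
  obtain rfl : x = x' := SliceHom.ext hx
  exact ⟨rfl, .refl _⟩

section Stability

variable {Γ Θ : B} {A : 𝒟.Ty Γ} {E : 𝒟.Ty A.ext} {f : Θ ⟶ Γ} {A' : 𝒟.Ty Θ}
    {E' : 𝒟.Ty A'.ext} (h : 𝒟.sub A f = A') (k : 𝒟.sub E (𝒟.cart h) = E') (υ : Tm E)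

theorem lam_sub : Reindexes₁ f (𝒟.cart (P.Pi_sub h k))
    ((P.lam A' E' (𝒟.sub_id A')).obj (idSlice (υ.subst k))).hom
    ((P.lam A E (𝒟.sub_id A)).obj (idSlice υ)).hom := by
  -- The intermediate arrow over `f.A`: re-indexing relates it to the section over `Θ`, and
  -- naturality relates it to the section over `Γ`.
  let x : SliceHom (𝒟.cart h) E.proj := ⟨(υ.subst k).hom ≫ 𝒟.cart k, by
    rw [Category.assoc, 𝒟.cart_proj, ← Category.assoc, Tm.hom_proj, Category.id_comp]⟩
  refine (P.lam_obj_sub h k (idSlice (υ.subst k)) x rfl).trans ?_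
  refine (P.lam_congr (Category.comp_id f).symm h (𝒟.sub_trans (𝒟.sub_id A) h)
    (x' := (𝒟.preCart E (𝒟.sub_id A) h).obj (idSlice υ)) (υ.subst_hom_cart k)).1.trans ?_
  exact congrArg (fun F => (F.obj (idSlice υ)).hom) (P.lam_nat A E (𝒟.sub_id A) h)

theorem β_reindexes : Reindexes₂ (𝒟.cart h) (𝒟.cart k)
    ((P.β A' E' (𝒟.sub_id A')).hom.app (idSlice (υ.subst k))).cell
    ((P.β A E (𝒟.sub_id A)).hom.app (idSlice υ)).cell := by
  let x : SliceHom (𝒟.cart h) E.proj := ⟨(υ.subst k).hom ≫ 𝒟.cart k, by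
    rw [Category.assoc, 𝒟.cart_proj, ← Category.assoc, Tm.hom_proj, Category.id_comp]⟩
  refine (P.β_sub h k (idSlice (υ.subst k)) x rfl).trans ?_
  refine (P.lam_congr (Category.comp_id f).symm h (𝒟.sub_trans (𝒟.sub_id A) h)
    (x' := (𝒟.preCart E (𝒟.sub_id A) h).obj (idSlice υ)) (υ.subst_hom_cart k)).2.trans ?_
  exact (P.β_nat A E (𝒟.sub_id A) h (idSlice υ)).symm

end Stability

/-- Dependent product types with abstraction. -/
@[reducible]
noncomputable def toPiIntro : 𝒟.toDisplayMapCategory.PiIntro where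
  toPiEval := P.toPiEval
  abs {_ A E} υ := ofSect ((P.lam A E (𝒟.sub_id A)).obj (idSlice υ))
  abs_sub h k υ := ofSect_subst _ (P.lam_sub h k υ)

/-- The 2-cell of the computation rule of dependent product types. -/
noncomputable def βCell {Γ : B} {A : 𝒟.Ty Γ} {E : 𝒟.Ty A.ext} (υ : Tm E) :
    sect (P.toPiEval.app (P.toPiIntro.abs υ)) ⟶ sect υ where
  cell := castCell (P.app_hom (P.toPiIntro.abs υ)).symm rfl
    ((P.β A E (𝒟.sub_id A)).hom.app (idSlice υ)).cell
  vertical := ((sameCell_castCell _ _ _).whiskerRight _).trans <|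
    ((P.β A E (𝒟.sub_id A)).hom.app (idSlice υ)).vertical.trans (sameCell_id (𝒟.cart_id A))

theorem βCell_same {Γ : B} {A : 𝒟.Ty Γ} {E : 𝒟.Ty A.ext} (υ : Tm E) :
    SameCell (P.βCell υ).cell ((P.β A E (𝒟.sub_id A)).hom.app (idSlice υ)).cell :=
  sameCell_castCell (P.app_hom (P.toPiIntro.abs υ)).symm rfl _

variable (I : 𝒟.AxiomaticId)

/-- The axiomatic dependent product types of the underlying display map category. -/
@[reducible]
noncomputable def toModel : 𝒟.toDisplayMapCategory.AxiomaticPi I.toModel.toIdFormer where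
  toPiIntro := P.toPiIntro
  β υ := I.ofCell (P.βCell υ)
  β_sub h k υ := I.ofCell_subst k
    ((P.toPiEval.app_sub h k _).trans (congrArg _ (P.toPiIntro.abs_sub h k υ))) rfl
    ((P.β_reindexes h k υ).congr (P.βCell_same _) (P.βCell_same _)) _

end AxiomaticPi

/-! ### Function extensionality. -/

namespace AxiomaticPi

variable (P : 𝒟.AxiomaticPi)

section Application

variable {Γ : B} {A : 𝒟.Ty Γ} {E : 𝒟.Ty A.ext} {z z' : Tm (P.Pi A E)}

/-- The action of application on 2-cells between terms. -/
noncomputable def appMap (p : sect z ⟶ sect z') :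
    sect (P.toPiEval.app z) ⟶ sect (P.toPiEval.app z') where
  cell := castCell (P.app_hom z).symm (P.app_hom z').symm ((P.app A E (𝒟.sub_id A)).map p).cell
  vertical := ((sameCell_castCell _ _ _).whiskerRight _).trans <|
    ((P.app A E (𝒟.sub_id A)).map p).vertical.trans (sameCell_id (𝒟.cart_id A))

theorem appMap_same (p : sect z ⟶ sect z') :
    SameCell (P.appMap p).cell ((P.app A E (𝒟.sub_id A)).map p).cell :=
  sameCell_castCell (P.app_hom z).symm (P.app_hom z').symm _

theorem app_isEquivalence (A : 𝒟.Ty Γ) (E : 𝒟.Ty A.ext) :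
    (P.app A E (𝒟.sub_id A)).IsEquivalence :=
  (CategoryTheory.Equivalence.mk (P.app A E (𝒟.sub_id A)) (P.lam A E (𝒟.sub_id A))
    (P.η A E (𝒟.sub_id A)) (P.β A E (𝒟.sub_id A))).isEquivalence_functor

/-- Application is part of an equivalence of categories, hence faithful; `appMap` is its action on
2-cells with the boundary renamed. Fullness gives `exists_appMap_eq` in the same way. -/
theorem appMap_injective {p q : sect z ⟶ sect z'} (h : P.appMap p = P.appMap q) : p = q := by
  have := P.app_isEquivalence A E
  exact (P.app A E (𝒟.sub_id A)).map_injective <| SliceHom.Hom.ext <|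
    ((P.appMap_same p).symm.trans <|
      (SameCell.of_eq (congrArg SliceHom.Hom.cell h)).trans (P.appMap_same q)).eq

theorem exists_appMap_eq (φ : sect (P.toPiEval.app z) ⟶ sect (P.toPiEval.app z')) :
    ∃ p : sect z ⟶ sect z', P.appMap p = φ := by
  have := P.app_isEquivalence A E
  have hc := sameCell_castCell (P.app_hom z) (P.app_hom z') φ.cell
  obtain ⟨p, hp⟩ := (P.app A E (𝒟.sub_id A)).map_surjective (X := sect z) (Y := sect z')
    ⟨castCell (P.app_hom z) (P.app_hom z') φ.cell, (hc.whiskerRight _).trans <|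
      φ.vertical.trans (sameCell_id (𝒟.cart_id A).symm)⟩
  exact ⟨p, SliceHom.Hom.ext <| ((P.appMap_same p).trans <|
    (SameCell.of_eq (congrArg SliceHom.Hom.cell hp)).trans hc).eq⟩

/-- The inverse of the action of application on 2-cells between terms. -/
noncomputable def unapp (φ : sect (P.toPiEval.app z) ⟶ sect (P.toPiEval.app z')) :
    sect z ⟶ sect z' :=
  (P.exists_appMap_eq φ).choose

theorem appMap_unapp (φ : sect (P.toPiEval.app z) ⟶ sect (P.toPiEval.app z')) :
    P.appMap (P.unapp φ) = φ :=
  (P.exists_appMap_eq φ).choose_spec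

theorem unapp_appMap (p : sect z ⟶ sect z') : P.unapp (P.appMap p) = p :=
  P.appMap_injective (P.appMap_unapp _)

variable {Θ : B} {f : Θ ⟶ Γ} {A' : 𝒟.Ty Θ} {E' : 𝒟.Ty A'.ext} (h : 𝒟.sub A f = A')
  (k : 𝒟.sub E (𝒟.cart h) = E')

theorem appMap_reindexes {y y' : Tm (P.Pi A' E')} {p : sect z ⟶ sect z'} {p' : sect y ⟶ sect y'}
    (hp : Reindexes₂ f (𝒟.cart (P.Pi_sub h k)) p'.cell p.cell) :
    Reindexes₂ (𝒟.cart h) (𝒟.cart k) (P.appMap p').cell (P.appMap p).cell :=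
  (P.app_map_reindexes h k (𝒟.sub_id A) (𝒟.sub_id A') h hp).congr (P.appMap_same p')
    (P.appMap_same p)

/-- The re-indexing of `unapp φ` is sent by `appMap` to a re-indexing of `φ`, which is unique; so it
is `unapp φ'` by injectivity. -/
theorem unapp_reindexes {y y' : Tm (P.Pi A' E')} (hz : z.subst (P.Pi_sub h k) = y)
    (hz' : z'.subst (P.Pi_sub h k) = y') {φ : sect (P.toPiEval.app z) ⟶ sect (P.toPiEval.app z')}
    {φ' : sect (P.toPiEval.app y) ⟶ sect (P.toPiEval.app y')}
    (hφ : Reindexes₂ (𝒟.cart h) (𝒟.cart k) φ'.cell φ.cell) :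
    Reindexes₂ f (𝒟.cart (P.Pi_sub h k)) (P.unapp φ').cell (P.unapp φ).cell := by
  obtain ⟨p, hp⟩ := exists_reindexed (P.Pi_sub h k) hz hz' (P.unapp φ)
  have hp' := P.appMap_reindexes h k hp
  rw [P.appMap_unapp] at hp'
  have e : P.appMap p = φ' := SliceHom.Hom.ext <| SameCell.eq <|
    sameCell_of_cart k ((P.appMap p).vertical.trans φ'.vertical.symm)
      (SameCell.trans hp' (SameCell.symm hφ))
  rwa [← e, P.unapp_appMap]

end Application

variable (I : 𝒟.AxiomaticId)

/-- Application sends the 2-cell of `t` to a propositional equality between terms of an identity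
type, and such terms are then equal. -/
theorem app_eq_of_term {Γ : B} {A : 𝒟.Ty Γ} {E : 𝒟.Ty A.ext} {a b : Tm E}
    {x y : Tm (P.Pi A (I.Eq a b))} (t : Tm (I.Eq x y)) : P.toPiEval.app x = P.toPiEval.app y :=
  I.eq_of_term (I.ofCell (P.appMap (I.cell t)))

/-- For products of identity types the propositional computation rule is strict, by discreteness of
identity types. -/
theorem app_abs {Γ : B} {A : 𝒟.Ty Γ} {E : 𝒟.Ty A.ext} {a b : Tm E} (υ : Tm (I.Eq a b)) :
    P.toPiEval.app (P.toPiIntro.abs υ) = υ :=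
  I.eq_of_term ((P.toModel I).β υ)

/-- The term of an identity type that is obtained by applying a 2-cell. -/
noncomputable def evPath {Γ Θ : B} {A : 𝒟.Ty Γ} {E : 𝒟.Ty A.ext} {f : Θ ⟶ Γ} {A' : 𝒟.Ty Θ}
    {E' : 𝒟.Ty A'.ext} (h : 𝒟.sub A f = A') (k : 𝒟.sub E (𝒟.cart h) = E')
    {x y : SliceHom f (P.Pi A E).proj} (φ : x ⟶ y) :
    Tm (I.Eq (P.toPiEval.evAt h k x.hom x.comm) (P.toPiEval.evAt h k y.hom y.comm)) :=
  I.ofLift k _ _ (P.evAt_cart h k x.hom x.comm) (P.evAt_cart h k y.hom y.comm)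
    ((P.app A E h).map φ)

/-- Gives a criterion for recognising a re-indexed `evPath`: a term `e` whose 2-cell is the
application of the restricted 2-cell `φ'`. It is used with reflexivity and with the arrow of a given
path. -/
theorem evPath_subst {Γ Θ Ω : B} {A : 𝒟.Ty Γ} {E : 𝒟.Ty A.ext} {f : Θ ⟶ Γ} {A' : 𝒟.Ty Θ}
    {E' : 𝒟.Ty A'.ext} (h : 𝒟.sub A f = A') (k : 𝒟.sub E (𝒟.cart h) = E')
    {x y : SliceHom f (P.Pi A E).proj} (φ : x ⟶ y) {g : Ω ⟶ Θ} {A₁ : 𝒟.Ty Ω} {E₁ : 𝒟.Ty A₁.ext}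
    (h' : 𝒟.sub A' g = A₁) (k' : 𝒟.sub E' (𝒟.cart h') = E₁) {f₁ : Ω ⟶ Γ} (h₁ : 𝒟.sub A f₁ = A₁)
    (k₁ : 𝒟.sub E (𝒟.cart h₁) = E₁) {a b : Tm E₁}
    (ha : (P.toPiEval.evAt h k x.hom x.comm).subst k' = a)
    (hb : (P.toPiEval.evAt h k y.hom y.comm).subst k' = b) {e : Tm (I.Eq a b)}
    {x' y' : SliceHom f₁ (P.Pi A E).proj} (φ' : x' ⟶ y')
    (he : SameCell ((I.cell e).cell ▷ 𝒟.cart k₁) ((P.app A E h₁).map φ').cell)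
    (hφ : SameCell φ'.cell (g ◁ φ.cell))
    (hE : 𝒟.sub (I.Eq (P.toPiEval.evAt h k x.hom x.comm) (P.toPiEval.evAt h k y.hom y.comm))
      (𝒟.cart h') = I.Eq a b) : (P.evPath I h k φ).subst hE = e := by
  refine I.term_ext k₁ (SameCell.trans ?_ (SameCell.symm he))
  have ef : f₁ = g ≫ f := by
    rw [← x'.comm, hφ.left, Category.assoc, x.comm]
  have eh : 𝒟.cart h₁ = 𝒟.cart h' ≫ 𝒟.cart h :=
    (𝒟.cart_congr ef _ (𝒟.sub_trans h h')).trans (𝒟.cart_trans h h')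
  have ek : 𝒟.cart k₁ = 𝒟.cart k' ≫ 𝒟.cart k :=
    (𝒟.cart_congr eh _ (𝒟.sub_trans k k')).trans (𝒟.cart_trans k k')
  refine (sameCell_whiskerRight_congr ek _).trans <| (sameCell_whiskerRight_comp _ _ _).symm.trans <|
    (SameCell.whiskerRight _ (I.cell_subst k' ha hb (P.evPath I h k φ) hE)).trans <|
      (sameCell_whiskerLeft_whiskerRight _ _ _).trans <|
        (SameCell.whiskerLeft _ (I.cell_ofLift _ _ _ _ _ _)).trans ?_
  exact (P.app_map_pre h h' h₁ hφ).symm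

/-- Terms of an identity type over a type of identities agree if they agree on reflexivities. -/
theorem eq_of_subst_r (P : 𝒟.AxiomaticPi) {Γ : B} {X : 𝒟.Ty Γ} {A : 𝒟.Ty (I.Id X).ext} {E : 𝒟.Ty A.ext} {a b : Tm E}
    {A' : 𝒟.Ty X.ext} (hr : 𝒟.sub A (I.toIdIntro.r X) = A') {E' : 𝒟.Ty A'.ext} {a' b' : Tm E'}
    (kr : 𝒟.sub (I.Eq a b) (𝒟.cart hr) = I.Eq a' b') {e e' : Tm (I.Eq a b)}
    (he : e.subst kr = e'.subst kr) : e = e' := by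
  have hM : P.Pi A' (I.Eq (e.subst kr) (e.subst kr)) =
      𝒟.sub (P.Pi A (I.Eq e e')) (I.toIdIntro.r X) := by
    rw [P.Pi_sub hr (I.Eq_sub kr e e'), he]
  -- Equality of `e` and `e'` is proved by path induction: reflexivity inhabits the motive over `r`.
  -- The motive is a product because `e` and `e'` live over an extension of the type of identities
  -- by `A`.
  exact I.eq_of_term <| P.toPiEval.app <| I.toModel.J _ <|
    (P.toPiIntro.abs (I.toIdIntro.reflAt (e.subst kr))).cast hM

theorem nonempty_term_uncast {Γ Θ : B} {A : 𝒟.Ty Γ} {f : Θ ⟶ Γ} {A' : 𝒟.Ty Θ} (a : Tm A)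
    {b : Tm A'} (h : A' = 𝒟.sub A f) (t : Tm (I.Eq (a.sub f) (b.cast h))) (h' : 𝒟.sub A f = A') :
    Nonempty (Tm (I.Eq (a.subst h') b)) := by
  subst h
  exact ⟨t⟩

section Happly

variable {Γ : B} (A : 𝒟.Ty Γ) (E : 𝒟.Ty A.ext)

/-- The universal 2-cell between terms of a dependent product type. -/
def univCell :
    (⟨(P.toModel I).s A E, rfl⟩ : SliceHom ((P.toModel I).s A E ≫ (P.Pi A E).proj) _) ⟶
      ⟨(P.toModel I).t A E, (P.toModel I).t_proj A E⟩ :=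
  ⟨I.α (P.Pi A E), (I.α_vertical _).trans (sameCell_id (Category.assoc _ _ _).symm)⟩

/-- The key to function extensionality: the syntactic `happly` is the action of `app` on the
universal 2-cell `α`. Both sides are terms of an identity type over paths, so by `eq_of_subst_r` it
is enough to compare them on reflexivities, where both are reflexivity. -/
theorem app_happly :
    P.toPiEval.app ((P.toModel I).happly A E) = P.evPath I rfl rfl (P.univCell I A E) := by
  have hr : 𝒟.sub (𝒟.sub A ((P.toModel I).s A E ≫ (P.Pi A E).proj))
      (I.toIdIntro.r (P.Pi A E)) = P.toPiFormer.dom A E := by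
    rw [← 𝒟.sub_comp, ← Category.assoc, (P.toModel I).r_s, Category.id_comp]
  have ec : 𝒟.cart hr ≫ 𝒟.cart (rfl : 𝒟.sub A ((P.toModel I).s A E ≫ (P.Pi A E).proj) = _) =
      𝒟.cart (rfl : 𝒟.sub A (P.Pi A E).proj = _) :=
    (𝒟.cart_trans rfl hr).symm.trans (𝒟.cart_congr
      ((Category.assoc _ _ _).symm.trans <| (congrArg (· ≫ _) ((P.toModel I).r_s A E)).trans
        (Category.id_comp _)) _ _)
  have kr' : 𝒟.sub (𝒟.sub E (𝒟.cart rfl)) (𝒟.cart hr) = P.toPiFormer.cod A E :=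
    (𝒟.sub_comp E _ _).symm.trans <| (congrArg (𝒟.sub E) ec).trans ((P.toModel I).cod_id A E)
  have hs := (P.toPiEval.evAt_sub rfl rfl ((P.toModel I).s A E) rfl rfl
    ((P.toModel I).cod_id A E) (𝟙 _) (Category.id_comp _) ((P.toModel I).r_s A E) hr kr').trans
      ((P.toModel I).evAt_id A E)
  have ht := (P.toPiEval.evAt_sub rfl rfl ((P.toModel I).t A E) ((P.toModel I).t_proj A E) rfl
    ((P.toModel I).cod_id A E) (𝟙 _) (Category.id_comp _) ((P.toModel I).r_t A E) hr kr').trans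
      ((P.toModel I).evAt_id A E)
  have kr := (I.Eq_sub kr' _ _).trans (congrArg₂ I.Eq hs ht)
  refine eq_of_subst_r I P hr kr (Eq.trans (b := I.toIdIntro.reflAt (P.toPiEval.ev A E)) ?_ ?_)
  -- On reflexivities `J` computes to the abstraction of reflexivity, propositionally; after
  -- application this is an equality, and `app_abs` removes the abstraction.
  · refine (P.toPiEval.app_sub hr kr _).trans (Eq.trans ?_ (P.app_abs I _))
    obtain ⟨t⟩ := nonempty_term_uncast I ((P.toModel I).happly A E) _
      (I.toModel.H _ _) (P.Pi_sub hr kr)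
    exact P.app_eq_of_term I t
  -- On reflexivities `α` becomes an identity, and the functor `app` preserves identities.
  · refine (P.evPath_subst I rfl rfl (P.univCell I A E) hr kr' rfl ((P.toModel I).cod_id A E) hs ht
      (𝟙 (⟨𝟙 _, Category.id_comp _⟩ : SliceHom (P.Pi A E).proj (P.Pi A E).proj)) ?_ ?_ kr).symm
    · refine (((I.path_cell _).unique (I.path_reflAt _)).whiskerRight_id _).trans ?_
      refine .trans (sameCell_id ?_)
        (SameCell.of_eq (congrArg SliceHom.Hom.cell ((P.app A E rfl).map_id _))).symm
      rw [← (P.toModel I).evAt_id A E]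
      exact P.evAt_cart rfl ((P.toModel I).cod_id A E) (𝟙 _) (Category.id_comp _)
    · rw [I.toIdIntro_r]
      exact (I.rArrow_α _).symm

end Happly

/-- Re-indexing `app_happly` along the arrow of `p` turns `α` into the 2-cell classified by `p`. -/
theorem app_happlyAt {Γ : B} {A : 𝒟.Ty Γ} {E : 𝒟.Ty A.ext} {z z' : Tm (P.Pi A E)}
    (p : Tm (I.Eq z z')) :
    P.toPiEval.app ((P.toModel I).happlyAt p) = I.ofCell (P.appMap (I.cell p)) := by
  let u := (P.toModel I).pathArrow p
  have es : u ≫ (P.toModel I).s A E = z.hom := (P.toModel I).pathArrow_s p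
  have et : u ≫ (P.toModel I).t A E = z'.hom := (P.toModel I).pathArrow_t p
  have eu : u ≫ (P.toModel I).s A E ≫ (P.Pi A E).proj = 𝟙 Γ := by
    rw [← Category.assoc, es, Tm.hom_proj]
  have hu : 𝒟.sub (𝒟.sub A ((P.toModel I).s A E ≫ (P.Pi A E).proj)) u = A := by
    rw [← 𝒟.sub_comp, eu, 𝒟.sub_id]
  have ec : 𝒟.cart hu ≫ 𝒟.cart (rfl : 𝒟.sub A ((P.toModel I).s A E ≫ (P.Pi A E).proj) = _) =
      𝒟.cart (𝒟.sub_id A) :=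
    (𝒟.cart_trans rfl hu).symm.trans (𝒟.cart_congr eu _ _)
  have ku' : 𝒟.sub (𝒟.sub E (𝒟.cart rfl)) (𝒟.cart hu) = E :=
    (𝒟.sub_comp E _ _).symm.trans <| (congrArg (𝒟.sub E) ec).trans (PiEval.sub_cart_id E)
  have hs : _ = P.toPiEval.app z := P.toPiEval.evAt_sub rfl rfl ((P.toModel I).s A E) rfl
    (𝒟.sub_id A) (PiEval.sub_cart_id E) z.hom z.hom_proj es hu ku'
  have ht : _ = P.toPiEval.app z' := P.toPiEval.evAt_sub rfl rfl ((P.toModel I).t A E)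
    ((P.toModel I).t_proj A E) (𝒟.sub_id A) (PiEval.sub_cart_id E) z'.hom z'.hom_proj et hu ku'
  have ku := (I.Eq_sub ku' _ _).trans (congrArg₂ I.Eq hs ht)
  refine (P.toPiEval.app_sub hu ku ((P.toModel I).happly A E)).symm.trans ?_
  rw [P.app_happly I]
  refine P.evPath_subst I rfl rfl (P.univCell I A E) hu ku' (𝒟.sub_id A) (PiEval.sub_cart_id E)
    hs ht (I.cell p) ?_ (SameCell.symm (I.path_cell p)) ku
  rw [I.cell_ofCell, cart_sub_cart_id]
  exact (sameCell_whiskerRight_id _).trans (P.appMap_same _)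

/-- Equal terms are connected by a 2-cell. -/
noncomputable def idCell {Γ : B} {A : 𝒟.Ty Γ} {a b : Tm A} (e : a = b) : sect a ⟶ sect b :=
  eqToHom (congrArg sect e)

theorem idCell_same {Γ : B} {A : 𝒟.Ty Γ} {a b : Tm A} (e : a = b) :
    SameCell (idCell e).cell (𝟙 a.hom) := by
  subst e
  rfl

section Funext

variable {Γ : B} {A : 𝒟.Ty Γ} {E : 𝒟.Ty A.ext} {z z' : Tm (P.Pi A E)}

/-- Function extensionality. -/
noncomputable def funextTerm
    (q : Tm (P.Pi A (I.Eq (P.toPiEval.app z) (P.toPiEval.app z')))) : Tm (I.Eq z z') :=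
  I.ofCell (P.unapp (I.cell (P.toPiEval.app q)))

/-- Only the applications agree strictly: terms of a product are determined by their applications up
to a 2-cell. -/
theorem app_happlyAt_funextTerm
    (q : Tm (P.Pi A (I.Eq (P.toPiEval.app z) (P.toPiEval.app z')))) :
    P.toPiEval.app ((P.toModel I).happlyAt (P.funextTerm I q)) = P.toPiEval.app q := by
  rw [app_happlyAt, funextTerm, I.cell_ofCell, P.appMap_unapp, I.ofCell_cell]

/-- Here the equality is strict, since both sides are terms of an identity type and `unapp` inverts
`appMap`. -/
theorem funextTerm_happlyAt (p : Tm (I.Eq z z')) :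
    p = P.funextTerm I ((P.toModel I).happlyAt p) := by
  rw [funextTerm, app_happlyAt, I.cell_ofCell, P.unapp_appMap, I.ofCell_cell]

variable {Θ : B} {f : Θ ⟶ Γ} {A' : 𝒟.Ty Θ} {E' : 𝒟.Ty A'.ext} (h : 𝒟.sub A f = A')
  (k : 𝒟.sub E (𝒟.cart h) = E')

theorem funextTerm_sub (q : Tm (P.Pi A (I.Eq (P.toPiEval.app z) (P.toPiEval.app z')))) :
    (P.funextTerm I q).subst (I.Eq_sub (P.Pi_sub h k) z z') =
      P.funextTerm I (q.subst ((P.toModel I).Pi_Eq_app_sub h k z z')) := by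
  have hE : 𝒟.sub (I.Eq (P.toPiEval.app z) (P.toPiEval.app z')) (𝒟.cart h) =
      I.Eq (P.toPiEval.app (z.subst (P.Pi_sub h k)))
        (P.toPiEval.app (z'.subst (P.Pi_sub h k))) :=
    (I.Eq_sub k _ _).trans (congrArg₂ I.Eq (P.toPiEval.app_sub h k z) (P.toPiEval.app_sub h k z'))
  refine I.ofCell_subst _ rfl rfl (P.unapp_reindexes h k rfl rfl ?_) _
  have := I.cell_subst k (P.toPiEval.app_sub h k z) (P.toPiEval.app_sub h k z')
    (P.toPiEval.app q) hE
  rwa [P.toPiEval.app_sub h hE q] at this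

end Funext

/-- Axiomatic function extensionality of the underlying display map category. -/
@[reducible]
noncomputable def toFunext : AxiomaticFunext (P.toModel I) where
  funext q := P.funextTerm I q
  -- The identity 2-cell between the equal applications is lifted back to the product by full
  -- faithfulness of `app`.
  β_funext q := I.ofCell (P.unapp (idCell (P.app_happlyAt_funextTerm I q)))
  η_funext p := I.ofCell (idCell (P.funextTerm_happlyAt I p))
  funext_sub h k _ _ q := P.funextTerm_sub I h k q
  β_funext_sub {Γ Θ A E f A' E'} h k z z' q := by
    have hE : 𝒟.sub (I.Eq (P.toPiEval.app z) (P.toPiEval.app z')) (𝒟.cart h) =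
        I.Eq (P.toPiEval.app (z.subst (P.Pi_sub h k)))
          (P.toPiEval.app (z'.subst (P.Pi_sub h k))) :=
      (I.Eq_sub k _ _).trans (congrArg₂ I.Eq (P.toPiEval.app_sub h k z)
        (P.toPiEval.app_sub h k z'))
    have hh := ((P.toModel I).happlyAt_sub h k (P.funextTerm I q)).trans
      (congrArg (P.toModel I).happlyAt (P.funextTerm_sub I h k q))
    refine I.ofCell_subst (P.Pi_sub h hE) hh rfl (P.unapp_reindexes h hE hh rfl ?_) _
    exact (Reindexes₂.id (reindexes_term hE ((P.toPiEval.app_sub h hE _).trans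
      (congrArg P.toPiEval.app hh)))).congr (idCell_same _) (idCell_same _)
  -- Both sides are terms of an iterated identity type, where any two terms agree.
  η_funext_sub _ _ _ _ _ := I.term_subsingleton _ _

end AxiomaticPi

end DisplayMap2Category

/-! ### Assembly of the model. -/

theorem mainTheorem1 {B : Type u} [Bicategory.{w, v} B] [Bicategory.Strict B]
    (𝒟 : DisplayMap2Category B) (hId : 𝒟.AxiomaticId) (hSigma : 𝒟.AxiomaticSigma)
    (hPi : 𝒟.AxiomaticPi) (hEmpty : 𝒟.AxiomaticEmpty) (hUnit : 𝒟.AxiomaticUnit)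
    (hBool : 𝒟.AxiomaticBool) (hNat : 𝒟.AxiomaticNat) :
    ∃ M : 𝒟.toDisplayMapCategory.ModelOfATT,
      M.id.toIdFormer = hId.toIdFormer ∧
      M.sigma.toSigmaFormer = hSigma.toSigmaFormer ∧
      M.pi.toPiFormer = hPi.toPiFormer ∧
      M.empty.toEmptyFormer = hEmpty.toEmptyFormer ∧
      M.unit.toUnitFormer = hUnit.toUnitFormer ∧
      M.bool.toBoolFormer = hBool.toBoolFormer ∧
      M.nat.toNatFormer = hNat.toNatData.toNatFormer :=
  -- Each construction has the given former as its parent structure, so the comparisons of types and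
  -- constructors hold by definition.
  ⟨⟨hId.toModel, hSigma.toModel hId, hPi.toModel hId, hPi.toFunext hId, hEmpty.toModel,
    hUnit.toModel hId, hBool.toModel hId, hNat.toModel hId⟩, rfl, rfl, rfl, rfl, rfl, rfl, rfl⟩
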